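/- Let $d_1,d_2\in\mathbb N$, $T>0$, and let $u_0:\mathbb R^{d_1}\times\mathbb R^{d_2}\to\mathbb R$ be bounded and Lipschitz continuous. Let $H=H(x,y,p,q)\in C^2(\mathbb R^{d_1}\times\mathbb R^{d_2}\times\mathbb R^{d_1}\times\mathbb R^{d_2})$ satisfy $H\ge 0$, $\partial^2_{pp}H>0$, $\partial^2_{qq}H>0$ (positive definite) and, for some constants $C_H>0$, $\gamma\ge 1$ and all $(x,y,p,q)$, $$|\partial_yH(x,y,p,q)|\le C_H(1+|p|^\gamma+|q|^\gamma),$$ $$\langle\partial_pH(x,y,p,q),p\rangle+\langle\partial_qH(x,y,p,q),q\rangle-H(x,y,p,q)\ge C_H^{-1}(|p|^\gamma+|q|^\gamma)-C_H .$$ Then there is a constant $C\ge 0$, depending only on $d_1,d_2,H,\gamma,C_H,u_0,T$ (in particular not on $\sigma$), such that the following holds for every $\sigma>0$. Let $u$ be a classical solution of $$\partial_tu-\sigma\Delta u+H(x,y,\partial_xu,\partial_yu)=0\ \text{ in }(0,T)\times\mathbb R^{d_1}\times\mathbb R^{d_2},\qquad u(0,\cdot,\cdot)=u_0,$$ that is,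 $u$ is continuous on $[0,T]\times\mathbb R^{d_1}\times\mathbb R^{d_2}$, of class $C^{1,2}$ (once in time, twice in space) on $(0,T)\times\mathbb R^{d_1}\times\mathbb R^{d_2}$, and of at most linear growth: $|u(t,x,y)|\le K(1+|x|+|y|)$ for some $K$, which may depend on $u$ and $\sigma$. Let $\tau\in(0,T]$, let $\rho_\tau\in C_c^\infty(\mathbb R^{d_1}\times\mathbb R^{d_2})$ with $\rho_\tau\ge 0$ and $\|\rho_\tau\|_{L^1}=1$, and let $\rho$ be a classical solution of the adjoint Fokker–Planck equation $$-\partial_t\rho-\sigma\Delta\rho-\operatorname{div}_x\big(\partial_pH(x,y,\partial_xu,\partial_yu)\rho\big)-\operatorname{div}_y\big(\partial_qH(x,y,\partial_xu,\partial_yu)\rho\big)=0\ \text{ in }(0,\tau)\times\mathbb R^{d_1}\times\mathbb R^{d_2},\qquad \rho(\tau,\cdot,\cdot)=\rho_\tau,$$ that is, $\rho$ is of class $C^{1,2}$ on $(0,\tau)\times\mathbb R^{d_1}\times\mathbb R^{d_2}$, continuous on $(0,\tau]\times\mathbb R^{d_1}\times\mathbb R^{d_2}$, and $\rho$ and its fluxes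 $\partial_pH(x,y,\partial_xu,\partial_yu)\rho$, $\partial_qH(x,y,\partial_xu,\partial_yu)\rho$ are integrable on $(0,\tau)\times\mathbb R^{d_1}\times\mathbb R^{d_2}$. Then $(|\partial_xu|^\gamma+|\partial_yu|^\gamma)\rho$ is integrable on $[0,\tau]\times\mathbb R^{d_1}\times\mathbb R^{d_2}$ and $$\iint_{[0,\tau]\times\mathbb R^{d_1}\times\mathbb R^{d_2}}\big(|\partial_xu(t,x,y)|^\gamma+|\partial_yu(t,x,y)|^\gamma\big)\rho(t,x,y)\,dt\,dx\,dy\le C .$$ -/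

import Mathlib

open Set MeasureTheory
open scoped ContDiff

/-- The Euclidean space `ℝ^d`. -/
abbrev Euc (d : ℕ) : Type := EuclideanSpace ℝ (Fin d)

section HamiltonJacobi

noncomputable section

/-- The gradient `∂_p H(x, y, p, q)` in the first momentum variable. -/
def gradP {d₁ d₂ : ℕ} (H : Euc d₁ → Euc d₂ → Euc d₁ → Euc d₂ → ℝ)
    (x : Euc d₁) (y : Euc d₂) (p : Euc d₁) (q : Euc d₂) : Euc d₁ :=
  gradient (fun p' => H x y p' q) p

/-- The gradient `∂_q H(x, y, p, q)` in the second momentum variable. -/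
def gradQ {d₁ d₂ : ℕ} (H : Euc d₁ → Euc d₂ → Euc d₁ → Euc d₂ → ℝ)
    (x : Euc d₁) (y : Euc d₂) (p : Euc d₁) (q : Euc d₂) : Euc d₂ :=
  gradient (fun q' => H x y p q') q

/-- The gradient `∂_y H(x, y, p, q)` in the second space variable. -/
def gradYH {d₁ d₂ : ℕ} (H : Euc d₁ → Euc d₂ → Euc d₁ → Euc d₂ → ℝ)
    (x : Euc d₁) (y : Euc d₂) (p : Euc d₁) (q : Euc d₂) : Euc d₂ :=
  gradient (fun y' => H x y' p q) y

/-- The standing assumptions on the Hamiltonian `H`, with growth exponent `γ` and constant `CH`. -/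
structure HamiltonianAssumption {d₁ d₂ : ℕ}
    (H : Euc d₁ → Euc d₂ → Euc d₁ → Euc d₂ → ℝ) (γ CH : ℝ) : Prop where
  one_le_gamma : 1 ≤ γ
  const_pos : 0 < CH
  contDiff : ContDiff ℝ 2
    (fun z : Euc d₁ × Euc d₂ × Euc d₁ × Euc d₂ => H z.1 z.2.1 z.2.2.1 z.2.2.2)
  nonneg : ∀ x y p q, 0 ≤ H x y p q
  hess_p_pos : ∀ x y p q, ∀ v : Euc d₁, v ≠ 0 →
    0 < iteratedFDeriv ℝ 2 (fun p' => H x y p' q) p ![v, v]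
  hess_q_pos : ∀ x y p q, ∀ v : Euc d₂, v ≠ 0 →
    0 < iteratedFDeriv ℝ 2 (fun q' => H x y p q') q ![v, v]
  grad_y_bound : ∀ x y p q, ‖gradYH H x y p q‖ ≤ CH * (1 + ‖p‖ ^ γ + ‖q‖ ^ γ)
  coercive : ∀ x y p q,
    CH⁻¹ * (‖p‖ ^ γ + ‖q‖ ^ γ) - CH ≤
      inner ℝ (gradP H x y p q) p + inner ℝ (gradQ H x y p q) q - H x y p q

/-- Bounded Lipschitz continuous initial data. -/
def IsBoundedLipschitz {d₁ d₂ : ℕ} (u₀ : Euc d₁ → Euc d₂ → ℝ) : Prop :=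
  (∃ M : ℝ, ∀ x y, |u₀ x y| ≤ M) ∧
    ∃ K : NNReal, LipschitzWith K (fun z : Euc d₁ × Euc d₂ => u₀ z.1 z.2)

/-- `w` is of class `C^{1,2}` on `I × ℝ^{d₁} × ℝ^{d₂}`: `w`, its first time derivative and its
space derivatives up to order two exist and are jointly continuous. -/
structure IsC12On {d₁ d₂ : ℕ} (w : ℝ → Euc d₁ → Euc d₂ → ℝ) (I : Set ℝ) : Prop where
  differentiable_time : ∀ t ∈ I, ∀ x y, DifferentiableAt ℝ (fun s => w s x y) t
  contDiff_space : ∀ t ∈ I, ContDiff ℝ 2 (fun z : Euc d₁ × Euc d₂ => w t z.1 z.2)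
  continuousOn : ContinuousOn
    (fun a : ℝ × Euc d₁ × Euc d₂ => w a.1 a.2.1 a.2.2) (I ×ˢ univ)
  continuousOn_deriv : ContinuousOn
    (fun a : ℝ × Euc d₁ × Euc d₂ => deriv (fun s => w s a.2.1 a.2.2) a.1) (I ×ˢ univ)
  continuousOn_fderiv : ContinuousOn
    (fun a : ℝ × Euc d₁ × Euc d₂ =>
      fderiv ℝ (fun z : Euc d₁ × Euc d₂ => w a.1 z.1 z.2) a.2) (I ×ˢ univ)
  continuousOn_fderiv_two : ContinuousOn
    (fun a : ℝ × Euc d₁ × Euc d₂ =>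
      iteratedFDeriv ℝ 2 (fun z : Euc d₁ × Euc d₂ => w a.1 z.1 z.2) a.2) (I ×ˢ univ)

/-- The gradient `∂_x w(t, x, y)`. -/
def gradX {d₁ d₂ : ℕ} (w : ℝ → Euc d₁ → Euc d₂ → ℝ) (t : ℝ) (x : Euc d₁) (y : Euc d₂) : Euc d₁ :=
  gradient (fun x' => w t x' y) x

/-- The gradient `∂_y w(t, x, y)`. -/
def gradY {d₁ d₂ : ℕ} (w : ℝ → Euc d₁ → Euc d₂ → ℝ) (t : ℝ) (x : Euc d₁) (y : Euc d₂) : Euc d₂ :=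
  gradient (fun y' => w t x y') y

/-- The Laplacian `Δ w(t, x, y) = Δ_x w + Δ_y w` in all the space variables. -/
def lapXY {d₁ d₂ : ℕ} (w : ℝ → Euc d₁ → Euc d₂ → ℝ) (t : ℝ) (x : Euc d₁) (y : Euc d₂) : ℝ :=
  Laplacian.laplacian (fun x' => w t x' y) x + Laplacian.laplacian (fun y' => w t x y') y

/-- The divergence of a vector field on `ℝ^d`. -/
def divergence {d : ℕ} (F : Euc d → Euc d) (x : Euc d) : ℝ :=
  LinearMap.trace ℝ (Euc d) (fderiv ℝ F x : Euc d →ₗ[ℝ] Euc d)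

/-- The field `∂_p H(x, y, ∂_x u, ∂_y u)` along `u`. -/
def driftX {d₁ d₂ : ℕ} (H : Euc d₁ → Euc d₂ → Euc d₁ → Euc d₂ → ℝ)
    (u : ℝ → Euc d₁ → Euc d₂ → ℝ) (t : ℝ) (x : Euc d₁) (y : Euc d₂) : Euc d₁ :=
  gradP H x y (gradX u t x y) (gradY u t x y)

/-- The field `∂_q H(x, y, ∂_x u, ∂_y u)` along `u`. -/
def driftY {d₁ d₂ : ℕ} (H : Euc d₁ → Euc d₂ → Euc d₁ → Euc d₂ → ℝ)
    (u : ℝ → Euc d₁ → Euc d₂ → ℝ) (t : ℝ) (x : Euc d₁) (y : Euc d₂) : Euc d₂ :=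
  gradQ H x y (gradX u t x y) (gradY u t x y)

/-- `u` is a classical solution, of at most linear growth, of the Cauchy problem
`∂_t u - σ Δ u + H(x, y, ∂_x u, ∂_y u) = 0`, `u(0) = u₀`, on `[0, T] × ℝ^{d₁} × ℝ^{d₂}`. -/
structure IsHJSolution {d₁ d₂ : ℕ} (H : Euc d₁ → Euc d₂ → Euc d₁ → Euc d₂ → ℝ)
    (σ T : ℝ) (u₀ : Euc d₁ → Euc d₂ → ℝ) (u : ℝ → Euc d₁ → Euc d₂ → ℝ) : Prop where
  regular : IsC12On u (Ioo 0 T)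
  continuousOn : ContinuousOn
    (fun a : ℝ × Euc d₁ × Euc d₂ => u a.1 a.2.1 a.2.2) (Icc 0 T ×ˢ univ)
  growth : ∃ K : ℝ, ∀ t ∈ Icc 0 T, ∀ x y, |u t x y| ≤ K * (1 + ‖x‖ + ‖y‖)
  equation : ∀ t ∈ Ioo 0 T, ∀ x y,
    deriv (fun s => u s x y) t - σ * lapXY u t x y
      + H x y (gradX u t x y) (gradY u t x y) = 0
  initial : ∀ x y, u 0 x y = u₀ x y

/-- Terminal data of the adjoint equation: smooth compactly supported probability densities. -/
structure IsTerminalDensity {d₁ d₂ : ℕ} (ρτ : Euc d₁ → Euc d₂ → ℝ) : Prop where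
  smooth : ContDiff ℝ ∞ (fun z : Euc d₁ × Euc d₂ => ρτ z.1 z.2)
  compactSupport : HasCompactSupport (fun z : Euc d₁ × Euc d₂ => ρτ z.1 z.2)
  nonneg : ∀ x y, 0 ≤ ρτ x y
  integral_eq_one : ∫ z : Euc d₁ × Euc d₂, |ρτ z.1 z.2| = 1

/-- `ρ` is a classical solution of the Fokker-Planck equation on `[0, τ] × ℝ^{d₁} × ℝ^{d₂}`
that is adjoint to the linearization at `u`, with `ρ(τ) = ρτ`. The last three fields say that
`ρ` and its flux `(∂_p H, ∂_q H) ρ` are integrable, as the integral formulation presupposes. -/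
structure IsFPSolution {d₁ d₂ : ℕ} (H : Euc d₁ → Euc d₂ → Euc d₁ → Euc d₂ → ℝ)
    (σ : ℝ) (u : ℝ → Euc d₁ → Euc d₂ → ℝ) (τ : ℝ) (ρτ : Euc d₁ → Euc d₂ → ℝ)
    (ρ : ℝ → Euc d₁ → Euc d₂ → ℝ) : Prop where
  regular : IsC12On ρ (Ioo 0 τ)
  continuousOn : ContinuousOn
    (fun a : ℝ × Euc d₁ × Euc d₂ => ρ a.1 a.2.1 a.2.2) (Ioc 0 τ ×ˢ univ)
  equation : ∀ t ∈ Ioo 0 τ, ∀ x y,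
    - deriv (fun s => ρ s x y) t - σ * lapXY ρ t x y
      - divergence (fun x' => ρ t x' y • driftX H u t x' y) x
      - divergence (fun y' => ρ t x y' • driftY H u t x y') y = 0
  terminal : ∀ x y, ρ τ x y = ρτ x y
  integrable : IntegrableOn
    (fun a : ℝ × Euc d₁ × Euc d₂ => ρ a.1 a.2.1 a.2.2) (Ioo 0 τ ×ˢ univ)
  integrable_fluxX : IntegrableOn
    (fun a : ℝ × Euc d₁ × Euc d₂ => ρ a.1 a.2.1 a.2.2 • driftX H u a.1 a.2.1 a.2.2)
    (Ioo 0 τ ×ˢ univ)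
  integrable_fluxY : IntegrableOn
    (fun a : ℝ × Euc d₁ × Euc d₂ => ρ a.1 a.2.1 a.2.2 • driftY H u a.1 a.2.1 a.2.2)
    (Ioo 0 τ ×ˢ univ)

end

end HamiltonJacobi

open Filter Topology

set_option linter.unusedSectionVars false

/-! Testing the Hamilton–Jacobi equation with `ρ` and the Fokker–Planck equation with `u` cancels
the second-order terms: with b = (∂_pH, ∂_qH), d/dt ∫ uρ = ∫ (b·Du - H)ρ. By coercivity the right
side is at least ∫ (C_H⁻¹(|∂_x u|^γ + |∂_y u|^γ) - C_H)ρ. Integrating in time bounds the wanted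
integral by an upper bound of u near τ, a lower bound of u near 0, and τ, once ρ ≥ 0 and its mass is
controlled. None of these bounds involves σ.

The difficulty is at infinity: ρ and bρ are merely integrable, u has linear growth, and Du is not
bounded. With a cutoff χ at scale R, the term σρ Dχ·Du is not controlled by the hypotheses. The
remedy is to test with u - ku², where k is of order 1/R. On the support of χ, |u| is of order at
most R, so the factor 1 - 2ku stays in [1/2, 3/2], while concavity produces the extra term
2kσχρ|Du|². Since |Dχ|² ≤ BR⁻²χ, that term absorbs the bad one (`young_cutoff`, `le_energyDensity`).
Every remaining error is a multiple of `weightedFlux`, which tends to 0 as the scale grows.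

The other ingredients are these. Nonnegativity of ρ comes from evolving ∫ χφ(ρ) for smooth convex φ
close to the negative part (`IsFokkerPlanckSolution.nonneg`); the choice φ = id bounds the mass. The
maximum principle and H ≥ 0 give u ≤ M (`IsViscousSolution.le_of_initial_le`). Nothing is known of ρ
at t = 0, so the lower bound is taken at small times s: on a bounded set it follows from continuity
of u at t = 0 (`IsViscousSolution.eventually_ge`), and elsewhere the linear growth of u is paid for
by the first moment of ρ(s) at infinity, which is small uniformly in s
(`IsFokkerPlanckSolution.exists_tail_le`). Exhausting (0, τ) × E by compact sets concludes. -/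

/-- The directional derivative of `f` along `v`. -/
noncomputable def dirDeriv {E : Type*} [NormedAddCommGroup E] [NormedSpace ℝ E]
    (v : E) (f : E → ℝ) (z : E) : ℝ := fderiv ℝ f z v

/-! ### Calculus of directional derivatives; coordinates are used because the product space with its
sup norm has no inner product. -/

section DirDeriv

variable {E : Type*} [NormedAddCommGroup E] [NormedSpace ℝ E]

theorem DifferentiableAt.hasLineDerivAt_dirDeriv {f : E → ℝ} {z : E} (hf : DifferentiableAt ℝ f z)
    (v : E) : HasLineDerivAt ℝ f (dirDeriv v f z) z v :=
  hf.hasFDerivAt.hasLineDerivAt v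

theorem HasLineDerivAt.dirDeriv_eq {f : E → ℝ} {z v : E} {d : ℝ} (h : HasLineDerivAt ℝ f d z v)
    (hf : DifferentiableAt ℝ f z) : dirDeriv v f z = d :=
  (hf.hasLineDerivAt_dirDeriv v).unique h

theorem HasLineDerivAt.fun_mul {f g : E → ℝ} {z v : E} {a b : ℝ} (hf : HasLineDerivAt ℝ f a z v)
    (hg : HasLineDerivAt ℝ g b z v) :
    HasLineDerivAt ℝ (fun z => f z * g z) (a * g z + f z * b) z v := by
  have := HasDerivAt.mul (𝕜 := ℝ) hf hg
  simp only [zero_smul, add_zero] at this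
  exact this

theorem HasLineDerivAt.fun_add {f g : E → ℝ} {z v : E} {a b : ℝ} (hf : HasLineDerivAt ℝ f a z v)
    (hg : HasLineDerivAt ℝ g b z v) :
    HasLineDerivAt ℝ (fun z => f z + g z) (a + b) z v :=
  HasDerivAt.add (𝕜 := ℝ) hf hg

theorem HasLineDerivAt.fun_sub {f g : E → ℝ} {z v : E} {a b : ℝ} (hf : HasLineDerivAt ℝ f a z v)
    (hg : HasLineDerivAt ℝ g b z v) :
    HasLineDerivAt ℝ (fun z => f z - g z) (a - b) z v :=
  HasDerivAt.sub (𝕜 := ℝ) hf hg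

theorem HasLineDerivAt.const_mul {f : E → ℝ} {z v : E} {a : ℝ} (hf : HasLineDerivAt ℝ f a z v)
    (c : ℝ) : HasLineDerivAt ℝ (fun z => c * f z) (c * a) z v :=
  HasDerivAt.const_mul (𝕜 := ℝ) c hf

theorem HasLineDerivAt.fun_sum {ι : Type*} {s : Finset ι} {f : ι → E → ℝ} {z v : E} {a : ι → ℝ}
    (hf : ∀ i ∈ s, HasLineDerivAt ℝ (f i) (a i) z v) :
    HasLineDerivAt ℝ (fun z => ∑ i ∈ s, f i z) (∑ i ∈ s, a i) z v :=
  HasDerivAt.fun_sum (𝕜 := ℝ) hf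

theorem HasLineDerivAt.real_comp {f : E → ℝ} {z v : E} {a c : ℝ} {φ : ℝ → ℝ}
    (hφ : HasDerivAt φ c (f z)) (hf : HasLineDerivAt ℝ f a z v) :
    HasLineDerivAt ℝ (fun z => φ (f z)) (c * a) z v := by
  have hφ' : HasDerivAt φ c (f (z + (0 : ℝ) • v)) := by simpa using hφ
  exact HasDerivAt.comp (𝕜 := ℝ) (0 : ℝ) hφ' hf

theorem ContDiff.dirDeriv {f : E → ℝ} {m n : WithTop ℕ∞} (hf : ContDiff ℝ n f) (hmn : m + 1 ≤ n)
    (v : E) : ContDiff ℝ m (dirDeriv v f) :=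
  (hf.fderiv_right hmn).clm_apply contDiff_const

theorem HasCompactSupport.dirDeriv {f : E → ℝ} (hf : HasCompactSupport f) (v : E) :
    HasCompactSupport (dirDeriv v f) :=
  hf.fderiv_apply ℝ v

theorem dirDeriv_eq_zero_of_notMem_tsupport {f : E → ℝ} {z : E} (hz : z ∉ tsupport f) (v : E) :
    dirDeriv v f z = 0 := by
  have : z ∉ Function.support (fderiv ℝ f) := fun h => hz (support_fderiv_subset ℝ h)
  simp only [Function.mem_support, not_not] at this
  simp [_root_.dirDeriv, this]

theorem tsupport_dirDeriv_subset {f : E → ℝ} (v : E) : tsupport (dirDeriv v f) ⊆ tsupport f := by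
  refine closure_minimal (fun z hz => ?_) (isClosed_tsupport f)
  by_contra h
  exact hz (dirDeriv_eq_zero_of_notMem_tsupport h v)

theorem dirDeriv_dirDeriv_eq_zero_of_notMem_tsupport {f : E → ℝ} {z : E} (hz : z ∉ tsupport f)
    (v : E) : dirDeriv v (dirDeriv v f) z = 0 :=
  dirDeriv_eq_zero_of_notMem_tsupport (fun h => hz (tsupport_dirDeriv_subset v h)) v

theorem dirDeriv_dirDeriv_eq_iteratedFDeriv {f : E → ℝ} (hf : ContDiff ℝ 2 f) (v z : E) :
    dirDeriv v (dirDeriv v f) z = iteratedFDeriv ℝ 2 f z ![v, v] := by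
  rw [iteratedFDeriv_two_apply]
  have h : DifferentiableAt ℝ (fderiv ℝ f) z :=
    ((hf.fderiv_right (m := 1) (by norm_num)).differentiable (by norm_num)) z
  change fderiv ℝ (fun z => fderiv ℝ f z v) z v = _
  rw [fderiv_clm_apply h (differentiableAt_const v)]
  simp

end DirDeriv

/-! ### Balance laws with compactly supported flux. -/

section SpaceTime

variable {E : Type*} [NormedAddCommGroup E] [NormedSpace ℝ E] [FiniteDimensional ℝ E]
  [MeasurableSpace E] [BorelSpace E]

/-- Integration by parts against the constant function 1. -/
theorem integral_dirDeriv_eq_zero (μ : Measure E) [μ.IsAddHaarMeasure] {f : E → ℝ}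
    (hf : ContDiff ℝ 1 f) (hc : HasCompactSupport f) (v : E) : ∫ z, dirDeriv v f z ∂μ = 0 := by
  have h1 : Integrable (dirDeriv v f) μ :=
    (hf.dirDeriv (m := 0) (by norm_num) v).continuous.integrable_of_hasCompactSupport
      (hc.dirDeriv v)
  have h2 : Integrable f μ := hf.continuous.integrable_of_hasCompactSupport hc
  have h1' : Integrable (fun x => fderiv ℝ f x v) μ := h1
  have := integral_mul_fderiv_eq_neg_fderiv_mul_of_integrable (μ := μ) (f := f)
    (g := fun _ => (1 : ℝ)) (v := v) (by simpa using h1') (by simp) (by simpa using h2)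
    (fun x _ => hf.differentiable (by norm_num) x) (fun x _ => differentiableAt_const _)
  simp only [fderiv_fun_const, Pi.zero_apply, _root_.zero_apply, mul_zero, integral_zero,
    mul_one] at this
  have h3 : ∫ z, dirDeriv v f z ∂μ = ∫ x, fderiv ℝ f x v ∂μ := rfl
  linarith

theorem ContinuousOn.integrableOn_Icc_prod_of_compact_support {X : Type*} [NormedAddCommGroup X]
    (μ : Measure E)
    [IsFiniteMeasureOnCompacts μ] {F : ℝ → E → X} {s t : ℝ} {K : Set E} (hK : IsCompact K)
    (hF : ContinuousOn (Function.uncurry F) (Icc s t ×ˢ univ))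
    (h0 : ∀ r ∈ Icc s t, ∀ z, z ∉ K → F r z = 0) :
    IntegrableOn (Function.uncurry F) (Icc s t ×ˢ univ) (volume.prod μ) := by
  have h1 : IntegrableOn (Function.uncurry F) (Icc s t ×ˢ K) (volume.prod μ) :=
    (hF.mono (prod_mono_right (subset_univ _))).integrableOn_compact
      (isCompact_Icc.prod hK)
  refine h1.of_forall_sdiff_eq_zero (measurableSet_Icc.prod MeasurableSet.univ) ?_
  rintro ⟨r, z⟩ ⟨⟨hr, -⟩, hz⟩
  exact h0 r hr z fun h => hz ⟨hr, h⟩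

/-- The balance law: if the time derivative of `g` is `F` plus a compactly supported divergence,
the increment of `∫ g` is the space-time integral of `F`. -/
theorem integral_sub_integral_eq_of_divergence_form (μ : Measure E) [μ.IsAddHaarMeasure]
    {ι : Type*} [Fintype ι] {e : ι → E}
    {g g' F : ℝ → E → ℝ} {V dV : ι → ℝ → E → ℝ} {s t : ℝ} (hst : s ≤ t) {K : Set E}
    (hK : IsCompact K)
    (hg : ContinuousOn (Function.uncurry g) (Icc s t ×ˢ univ))
    (hg' : ContinuousOn (Function.uncurry g') (Icc s t ×ˢ univ))
    (hF : ContinuousOn (Function.uncurry F) (Icc s t ×ˢ univ))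
    (g0 : ∀ r ∈ Icc s t, ∀ z, z ∉ K → g r z = 0)
    (g'0 : ∀ r ∈ Icc s t, ∀ z, z ∉ K → g' r z = 0)
    (F0 : ∀ r ∈ Icc s t, ∀ z, z ∉ K → F r z = 0)
    (V0 : ∀ r ∈ Icc s t, ∀ i, ∀ z, z ∉ K → V i r z = 0)
    (hd : ∀ r ∈ Icc s t, ∀ z, HasDerivAt (fun r => g r z) (g' r z) r)
    (hV : ∀ r ∈ Icc s t, ∀ i, ContDiff ℝ 1 (V i r))
    (hdV : ∀ r ∈ Icc s t, ∀ i z, HasLineDerivAt ℝ (V i r) (dV i r z) z (e i))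
    (heq : ∀ r ∈ Icc s t, ∀ z, g' r z = F r z + ∑ i, dV i r z) :
    ∫ z, g t z ∂μ - ∫ z, g s z ∂μ
      = ∫ a in Icc s t ×ˢ univ, F a.1 a.2 ∂(volume.prod μ) := by
  have slice : ∀ {G : ℝ → E → ℝ}, ContinuousOn (Function.uncurry G) (Icc s t ×ˢ univ) →
      ∀ r ∈ Icc s t, Continuous (G r) := fun {G} hG r hr => by
    have : Continuous fun z => Function.uncurry G (r, z) :=
      hG.comp_continuous (by fun_prop) (fun z => ⟨hr, mem_univ _⟩)
    exact this
  have sliceInt : ∀ {G : ℝ → E → ℝ}, ContinuousOn (Function.uncurry G) (Icc s t ×ˢ univ) →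
      (∀ r ∈ Icc s t, ∀ z, z ∉ K → G r z = 0) → ∀ r ∈ Icc s t, Integrable (G r) μ :=
    fun hG h0 r hr => (slice hG r hr).integrable_of_hasCompactSupport
      (HasCompactSupport.intro hK (h0 r hr))
  have iF := hF.integrableOn_Icc_prod_of_compact_support μ hK F0
  have ig' := hg'.integrableOn_Icc_prod_of_compact_support μ hK g'0
  -- Keeping `dV` as a free expression lets it be the raw output of the product rule, so that `heq`
  -- becomes a polynomial identity.
  have hdV' : ∀ r ∈ Icc s t, ∀ i z, dV i r z = dirDeriv (e i) (V i r) z := fun r hr i z =>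
    ((hdV r hr i z).dirDeriv_eq ((hV r hr i).differentiable (by norm_num) z)).symm
  have hspace : ∀ r ∈ Icc s t, ∫ z, g' r z ∂μ = ∫ z, F r z ∂μ := by
    intro r hr
    have hcs : ∀ i, HasCompactSupport (V i r) := fun i => HasCompactSupport.intro hK (V0 r hr i)
    have hi : ∀ i, Integrable (dV i r) μ := fun i => by
      rw [funext (hdV' r hr i)]
      exact ((hV r hr i).dirDeriv (m := 0) (by norm_num) (e i)).continuous
        |>.integrable_of_hasCompactSupport ((hcs i).dirDeriv (e i))
    rw [integral_congr_ae (Eventually.of_forall (heq r hr)),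
      integral_add (sliceInt hF F0 r hr) (integrable_finsetSum _ fun i _ => hi i),
      integral_finsetSum _ fun i _ => hi i]
    have : ∀ i, ∫ z, dV i r z ∂μ = 0 := fun i => by
      rw [funext (hdV' r hr i)]
      exact integral_dirDeriv_eq_zero μ (hV r hr i) (hcs i) (e i)
    simp [this]
  have hs : s ∈ Icc s t := left_mem_Icc.2 hst
  have ht : t ∈ Icc s t := right_mem_Icc.2 hst
  rw [← integral_sub (sliceInt hg g0 t ht) (sliceInt hg g0 s hs)]
  have hFTC : ∀ z, g t z - g s z = ∫ r in Icc s t, g' r z := by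
    intro z
    rw [integral_Icc_eq_integral_Ioc, ← intervalIntegral.integral_of_le hst]
    symm
    refine intervalIntegral.integral_eq_sub_of_hasDerivAt (f := fun r => g r z)
      (fun r hr => hd r (by rwa [uIcc_of_le hst] at hr) z) ?_
    refine ContinuousOn.intervalIntegrable ?_
    rw [uIcc_of_le hst]
    exact hg'.comp (f := fun r : ℝ => (r, z)) (by fun_prop) (fun r hr => ⟨hr, mem_univ _⟩)
  rw [integral_congr_ae (Eventually.of_forall hFTC)]
  have e1 : ((volume : Measure ℝ).prod μ).restrict (Icc s t ×ˢ univ)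
      = ((volume : Measure ℝ).restrict (Icc s t)).prod μ := by
    rw [← Measure.prod_restrict, Measure.restrict_univ]
  rw [IntegrableOn, e1] at ig'
  rw [← integral_integral_swap ig', setIntegral_prod (fun a : ℝ × E => F a.1 a.2) iF]
  refine setIntegral_congr_fun measurableSet_Icc fun r hr => ?_
  simp only [Measure.restrict_univ]
  exact hspace r hr

end SpaceTime

/-! ### The Fokker–Planck equation and the evolution of nonlinear functions of its solution. -/

section FokkerPlanck

variable {E : Type*} [NormedAddCommGroup E] [NormedSpace ℝ E]

/-- Class `C^{1,2}` for functions on `I × E`. -/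
structure IsSpaceTimeC12 (w : ℝ → E → ℝ) (I : Set ℝ) : Prop where
  differentiable_time : ∀ t ∈ I, ∀ z, DifferentiableAt ℝ (fun s => w s z) t
  contDiff_space : ∀ t ∈ I, ContDiff ℝ 2 (w t)
  continuousOn : ContinuousOn (Function.uncurry w) (I ×ˢ univ)
  continuousOn_deriv : ContinuousOn (fun a : ℝ × E => deriv (fun s => w s a.2) a.1) (I ×ˢ univ)
  continuousOn_fderiv : ContinuousOn (fun a : ℝ × E => fderiv ℝ (w a.1) a.2) (I ×ˢ univ)
  continuousOn_fderiv_two : ContinuousOn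
    (fun a : ℝ × E => iteratedFDeriv ℝ 2 (w a.1) a.2) (I ×ˢ univ)

namespace IsSpaceTimeC12

variable {w : ℝ → E → ℝ} {I : Set ℝ}

theorem mono (h : IsSpaceTimeC12 w I) {J : Set ℝ} (hJ : J ⊆ I) : IsSpaceTimeC12 w J where
  differentiable_time t ht := h.differentiable_time t (hJ ht)
  contDiff_space t ht := h.contDiff_space t (hJ ht)
  continuousOn := h.continuousOn.mono (prod_mono_left hJ)
  continuousOn_deriv := h.continuousOn_deriv.mono (prod_mono_left hJ)
  continuousOn_fderiv := h.continuousOn_fderiv.mono (prod_mono_left hJ)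
  continuousOn_fderiv_two := h.continuousOn_fderiv_two.mono (prod_mono_left hJ)

theorem continuousOn_dirDeriv (h : IsSpaceTimeC12 w I) (v : E) :
    ContinuousOn (fun a : ℝ × E => dirDeriv v (w a.1) a.2) (I ×ˢ univ) :=
  h.continuousOn_fderiv.clm_apply continuousOn_const

end IsSpaceTimeC12

/-- A classical solution `ρ` on `(0, τ) × E`, with integrable flux, of the Fokker-Planck equation
`-∂ₜρ - σ Δρ - div (b ρ) = 0`, `ρ(τ) = ρτ`, in the coordinates given by the vectors `e i`. -/
structure IsFokkerPlanckSolution [MeasurableSpace E] (μ : Measure E) {ι : Type*} [Fintype ι]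
    (e : ι → E) (σ τ : ℝ) (b : ι → ℝ → E → ℝ) (ρτ : E → ℝ) (ρ : ℝ → E → ℝ) : Prop where
  regular : IsSpaceTimeC12 ρ (Ioo 0 τ)
  continuousOn : ContinuousOn (Function.uncurry ρ) (Ioc 0 τ ×ˢ univ)
  equation : ∀ t ∈ Ioo 0 τ, ∀ z, deriv (fun s => ρ s z) t
    = - σ * ∑ i, dirDeriv (e i) (dirDeriv (e i) (ρ t)) z
      - ∑ i, dirDeriv (e i) (fun z => b i t z * ρ t z) z
  terminal : ρ τ = ρτ
  contDiff_drift : ∀ t ∈ Ioo 0 τ, ∀ i, ContDiff ℝ 1 (b i t)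
  continuousOn_drift : ∀ i, ContinuousOn (Function.uncurry (b i)) (Ioo 0 τ ×ˢ univ)
  integrable : IntegrableOn (Function.uncurry ρ) (Ioo 0 τ ×ˢ univ) (volume.prod μ)
  integrable_flux : ∀ i, IntegrableOn (fun a : ℝ × E => b i a.1 a.2 * ρ a.1 a.2)
    (Ioo 0 τ ×ˢ univ) (volume.prod μ)

variable [FiniteDimensional ℝ E] [MeasurableSpace E] [BorelSpace E] {μ : Measure E}
  [μ.IsAddHaarMeasure] {ι : Type*} [Fintype ι] {e : ι → E} {σ τ : ℝ} {b : ι → ℝ → E → ℝ}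
  {ρτ : E → ℝ} {ρ : ℝ → E → ℝ}

/-- The evolution of `∫ ψ φ(ρ(t))`. -/
theorem IsFokkerPlanckSolution.integral_comp_sub (h : IsFokkerPlanckSolution μ e σ τ b ρτ ρ)
    {ψ : E → ℝ} (hψ : ContDiff ℝ 2 ψ) (hψc : HasCompactSupport ψ) {φ φ' φ'' : ℝ → ℝ}
    (hφ : ∀ x, HasDerivAt φ (φ' x) x) (hφ' : ∀ x, HasDerivAt φ' (φ'' x) x)
    (cφ : ContDiff ℝ 1 φ) (cφ' : ContDiff ℝ 1 φ') (cφ'' : Continuous φ'')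
    {s t : ℝ} (hs : 0 < s) (hst : s ≤ t) (ht : t < τ) :
    ∫ z, ψ z * φ (ρ t z) ∂μ - ∫ z, ψ z * φ (ρ s z) ∂μ
      = ∫ a in Icc s t ×ˢ univ, ∑ i,
        (ψ a.2 * φ'' (ρ a.1 a.2) * dirDeriv (e i) (ρ a.1) a.2 *
            (σ * dirDeriv (e i) (ρ a.1) a.2 + b i a.1 a.2 * ρ a.1 a.2)
          + dirDeriv (e i) ψ a.2 * φ' (ρ a.1 a.2) * (b i a.1 a.2 * ρ a.1 a.2)
          - σ * dirDeriv (e i) (dirDeriv (e i) ψ) a.2 * φ (ρ a.1 a.2)) ∂(volume.prod μ) := by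
  have hsub : Icc s t ⊆ Ioo 0 τ := fun r hr => ⟨hs.trans_le hr.1, hr.2.trans_lt ht⟩
  have hsub' : Icc s t ×ˢ (univ : Set E) ⊆ Ioo 0 τ ×ˢ univ := prod_mono_left hsub
  have h2 : ∀ {f : E → ℝ} (i : ι), ContDiff ℝ 2 f → ContDiff ℝ 1 (dirDeriv (e i) f) :=
    fun i hf => hf.dirDeriv (by norm_num) _
  have h3 : ∀ {f : E → ℝ} (i : ι), ContDiff ℝ 1 f → Continuous (dirDeriv (e i) f) :=
    fun i hf => (hf.dirDeriv (m := 0) (by norm_num) _).continuous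
  have cρ := h.regular.continuousOn.mono hsub'
  have cρt := h.regular.continuousOn_deriv.mono hsub'
  have cρi := fun i => (h.regular.continuousOn_dirDeriv (e i)).mono hsub'
  have cb := fun i => (h.continuousOn_drift i).mono hsub'
  have cψ : Continuous ψ := hψ.continuous
  have cψ1 := fun i : ι => (h2 i hψ).continuous
  have cψ2 := fun i : ι => h3 i (h2 i hψ)
  simp only [Function.uncurry_def] at cρ cb
  have cφρ : ContinuousOn (fun a : ℝ × E => φ (ρ a.1 a.2)) (Icc s t ×ˢ univ) :=
    cφ.continuous.comp_continuousOn cρ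
  have cφρ' : ContinuousOn (fun a : ℝ × E => φ' (ρ a.1 a.2)) (Icc s t ×ˢ univ) :=
    cφ'.continuous.comp_continuousOn cρ
  have cφρ'' : ContinuousOn (fun a : ℝ × E => φ'' (ρ a.1 a.2)) (Icc s t ×ˢ univ) :=
    cφ''.comp_continuousOn cρ
  have z0 : ∀ z, z ∉ tsupport ψ → ψ z = 0 := fun z hz => image_eq_zero_of_notMem_tsupport hz
  have z1 : ∀ i z, z ∉ tsupport ψ → dirDeriv (e i) ψ z = 0 :=
    fun i z hz => dirDeriv_eq_zero_of_notMem_tsupport hz _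
  have z2 : ∀ i z, z ∉ tsupport ψ → dirDeriv (e i) (dirDeriv (e i) ψ) z = 0 :=
    fun i z hz => dirDeriv_dirDeriv_eq_zero_of_notMem_tsupport hz _
  have cbρ : ∀ r ∈ Icc s t, ∀ i, ContDiff ℝ 1 (fun z => b i r z * ρ r z) := fun r hr i =>
    (h.contDiff_drift r (hsub hr) i).mul ((h.regular.contDiff_space r (hsub hr)).of_le (by norm_num))
  refine integral_sub_integral_eq_of_divergence_form μ (e := e) (K := tsupport ψ)
    (g := fun r z => ψ z * φ (ρ r z))
    (g' := fun r z => ψ z * (φ' (ρ r z) * deriv (fun r => ρ r z) r))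
    (F := fun r z => ∑ i,
        (ψ z * φ'' (ρ r z) * dirDeriv (e i) (ρ r) z *
            (σ * dirDeriv (e i) (ρ r) z + b i r z * ρ r z)
          + dirDeriv (e i) ψ z * φ' (ρ r z) * (b i r z * ρ r z)
          - σ * dirDeriv (e i) (dirDeriv (e i) ψ) z * φ (ρ r z)))
    -- Two integrations by parts: one moves the divergence off σ∂ρ + bρ, the other writes the
    -- resulting σ ∂ψ φ'(ρ)∂ρ as σ ∂ψ ∂(φ(ρ)) and moves the derivative onto ∂ψ.
    (V := fun i r z => σ * (dirDeriv (e i) ψ z * φ (ρ r z)) -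
      ψ z * φ' (ρ r z) * (σ * dirDeriv (e i) (ρ r) z + b i r z * ρ r z))
    (dV := fun i r z => σ * (dirDeriv (e i) (dirDeriv (e i) ψ) z * φ (ρ r z)
        + dirDeriv (e i) ψ z * (φ' (ρ r z) * dirDeriv (e i) (ρ r) z))
      - ((dirDeriv (e i) ψ z * φ' (ρ r z) + ψ z * (φ'' (ρ r z) * dirDeriv (e i) (ρ r) z))
          * (σ * dirDeriv (e i) (ρ r) z + b i r z * ρ r z)
        + ψ z * φ' (ρ r z) * (σ * dirDeriv (e i) (dirDeriv (e i) (ρ r)) z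
          + dirDeriv (e i) (fun z => b i r z * ρ r z) z)))
    hst hψc ?_ ?_ ?_ ?_ ?_ ?_ ?_ ?_ ?_ ?_ ?_
  · exact (cψ.comp continuous_snd).continuousOn.mul cφρ
  · exact (cψ.comp continuous_snd).continuousOn.mul (cφρ'.mul cρt)
  · refine continuousOn_finsetSum _ fun i _ => ?_
    refine ContinuousOn.sub (ContinuousOn.add ?_ ?_) ?_
    · exact ((((cψ.comp continuous_snd).continuousOn).mul cφρ'').mul (cρi i)).mul
        ((continuousOn_const.mul (cρi i)).add ((cb i).mul cρ))
    · exact ((((cψ1 i).comp continuous_snd).continuousOn).mul cφρ').mul ((cb i).mul cρ)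
    · exact (continuousOn_const.mul (((cψ2 i).comp continuous_snd).continuousOn)).mul cφρ
  · intro r _ z hz; simp [z0 z hz]
  · intro r _ z hz; simp [z0 z hz]
  · intro r _ z hz; simp [z0 z hz, z1 _ z hz, z2 _ z hz]
  · intro r _ i z hz; simp [z0 z hz, z1 _ z hz]
  · intro r hr z
    have := (h.regular.differentiable_time r (hsub hr) z).hasDerivAt
    exact ((hφ (ρ r z)).comp r this).const_mul (ψ z)
  · intro r hr i
    have c2 := h.regular.contDiff_space r (hsub hr)
    have c1 : ContDiff ℝ 1 (ρ r) := c2.of_le (by norm_num)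
    exact (contDiff_const.mul ((h2 i hψ).mul (cφ.comp c1))).sub
      (((hψ.of_le (by norm_num)).mul (cφ'.comp c1)).mul
        ((contDiff_const.mul (h2 i c2)).add (cbρ r hr i)))
  · intro r hr i z
    have c2 := h.regular.contDiff_space r (hsub hr)
    have l : ∀ {f : E → ℝ}, ContDiff ℝ 1 f → HasLineDerivAt ℝ f (dirDeriv (e i) f z) z (e i) :=
      fun hf => (hf.differentiable (by norm_num) z).hasLineDerivAt_dirDeriv (e i)
    have lρ := l (c2.of_le (by norm_num))
    exact (((l (h2 i hψ)).fun_mul (lρ.real_comp (hφ _))).const_mul σ).fun_sub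
      (((l (hψ.of_le (by norm_num))).fun_mul (lρ.real_comp (hφ' _))).fun_mul
        (((l (h2 i c2)).const_mul σ).fun_add (l (cbρ r hr i))))
  · intro r hr z
    rw [h.equation r (hsub hr) z, ← Finset.sum_add_distrib]
    rw [Finset.mul_sum, ← Finset.sum_sub_distrib, Finset.mul_sum, Finset.mul_sum]
    exact Finset.sum_congr rfl fun i _ => by ring

end FokkerPlanck

/-! ### Weighted fluxes and almost monotone quantities. -/

section Weight

variable {E : Type*} [NormedAddCommGroup E]

/-- A weight which tends to `0` locally uniformly as the scale `l` tends to infinity. -/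
noncomputable def scaleWeight (l : ℝ) (z : E) : ℝ := 1 / l + min 1 (‖z‖ / l)

theorem scaleWeight_nonneg {l : ℝ} (hl : 0 < l) (z : E) : 0 ≤ scaleWeight l z := by
  unfold scaleWeight; positivity

theorem scaleWeight_le_two {l : ℝ} (hl : 1 ≤ l) (z : E) : scaleWeight l z ≤ 2 := by
  have h1 : 1 / l ≤ 1 := by rw [div_le_one (by linarith)]; exact hl
  have h2 := min_le_left 1 (‖z‖ / l)
  unfold scaleWeight; linarith

theorem continuous_scaleWeight (l : ℝ) : Continuous (scaleWeight l : E → ℝ) := by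
  unfold scaleWeight; fun_prop

/-- This bound and `one_le_scaleWeight` serve the two kinds of cutoff error: those of size `1 / l`
anywhere, and those of size one outside the ball of radius `l`. -/
theorem one_div_le_scaleWeight {l : ℝ} (hl : 0 < l) (z : E) : 1 / l ≤ scaleWeight l z := by
  have : 0 ≤ min 1 (‖z‖ / l) := by positivity
  unfold scaleWeight; linarith

theorem one_le_scaleWeight {l : ℝ} (hl : 0 < l) {z : E} (hz : l ≤ ‖z‖) : 1 ≤ scaleWeight l z := by
  have h1 : 1 ≤ ‖z‖ / l := by rwa [one_le_div hl]
  have h2 : 0 < 1 / l := by positivity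
  unfold scaleWeight; rw [min_eq_left h1]; linarith

theorem tendsto_scaleWeight (z : E) : Tendsto (fun l => scaleWeight l z) atTop (𝓝 0) := by
  have h1 : Tendsto (fun l : ℝ => 1 / l) atTop (𝓝 0) := tendsto_const_nhds.div_atTop tendsto_id
  have h2 : Tendsto (fun l : ℝ => ‖z‖ / l) atTop (𝓝 0) := tendsto_const_nhds.div_atTop tendsto_id
  have h3 : Tendsto (fun l : ℝ => min 1 (‖z‖ / l)) atTop (𝓝 (min 1 0)) :=
    tendsto_const_nhds.min h2
  simpa [scaleWeight] using h1.add h3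

variable [MeasurableSpace E]

/-- The total mass of `ρ` and of its flux, weighted by `scaleWeight l`. -/
noncomputable def weightedFlux (μ : Measure E) {ι : Type*} [Fintype ι] (τ : ℝ)
    (b : ι → ℝ → E → ℝ) (ρ : ℝ → E → ℝ) (l : ℝ) : ℝ :=
  ∫ a in Ioo 0 τ ×ˢ univ, scaleWeight l a.2 *
    (|ρ a.1 a.2| + ∑ i, |b i a.1 a.2 * ρ a.1 a.2|) ∂(volume.prod μ)

variable [NormedSpace ℝ E] {μ : Measure E}
  {ι : Type*} [Fintype ι] {e : ι → E} {σ τ : ℝ} {b : ι → ℝ → E → ℝ}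
  {ρτ : E → ℝ} {ρ : ℝ → E → ℝ}

theorem IsFokkerPlanckSolution.integrableOn_abs (h : IsFokkerPlanckSolution μ e σ τ b ρτ ρ) :
    IntegrableOn (fun a : ℝ × E => |ρ a.1 a.2| + ∑ i, |b i a.1 a.2 * ρ a.1 a.2|)
      (Ioo 0 τ ×ˢ univ) (volume.prod μ) :=
  (h.integrable.abs).add (integrable_finsetSum _ fun i _ => (h.integrable_flux i).abs)

variable [BorelSpace E] [FiniteDimensional ℝ E]

theorem IsFokkerPlanckSolution.integrableOn_weighted (h : IsFokkerPlanckSolution μ e σ τ b ρτ ρ)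
    {l : ℝ} (hl : 1 ≤ l) :
    IntegrableOn (fun a : ℝ × E => scaleWeight l a.2 *
      (|ρ a.1 a.2| + ∑ i, |b i a.1 a.2 * ρ a.1 a.2|)) (Ioo 0 τ ×ˢ univ) (volume.prod μ) := by
  refine h.integrableOn_abs.bdd_mul (c := 2)
    ((continuous_scaleWeight l).comp continuous_snd).aestronglyMeasurable ?_
  refine Eventually.of_forall fun a => ?_
  rw [Real.norm_eq_abs, abs_of_nonneg (scaleWeight_nonneg (by linarith) _)]
  exact scaleWeight_le_two hl _

/-- Dominated convergence: the weight is at most 2 and tends to 0 pointwise, while ρ and bρ are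
integrable. This makes the cutoff errors vanish at large scale. -/
theorem IsFokkerPlanckSolution.tendsto_weightedFlux (h : IsFokkerPlanckSolution μ e σ τ b ρτ ρ) :
    Tendsto (weightedFlux μ τ b ρ) atTop (𝓝 0) := by
  have := tendsto_integral_filter_of_dominated_convergence (l := (atTop : Filter ℝ))
    (μ := (volume.prod μ).restrict (Ioo (0:ℝ) τ ×ˢ (univ : Set E)))
    (F := fun l (a : ℝ × E) => scaleWeight l a.2 *
      (|ρ a.1 a.2| + ∑ i, |b i a.1 a.2 * ρ a.1 a.2|)) (f := fun _ => (0 : ℝ))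
    (fun a : ℝ × E => 2 * (|ρ a.1 a.2| + ∑ i, |b i a.1 a.2 * ρ a.1 a.2|)) ?_ ?_ ?_ ?_
  · rwa [integral_zero] at this
  · filter_upwards [eventually_ge_atTop (1 : ℝ)] with l hl
    exact (h.integrableOn_weighted hl).aestronglyMeasurable
  · filter_upwards [eventually_ge_atTop (1 : ℝ)] with l hl
    refine Eventually.of_forall fun a => ?_
    have h0 : 0 ≤ |ρ a.1 a.2| + ∑ i, |b i a.1 a.2 * ρ a.1 a.2| := by positivity
    rw [Real.norm_eq_abs, abs_of_nonneg (mul_nonneg (scaleWeight_nonneg (by linarith) _) h0)]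
    exact mul_le_mul_of_nonneg_right (scaleWeight_le_two hl _) h0
  · exact h.integrableOn_abs.const_mul 2
  · refine Eventually.of_forall fun a => ?_
    simpa using (tendsto_scaleWeight a.2).mul_const (|ρ a.1 a.2| + ∑ i, |b i a.1 a.2 * ρ a.1 a.2|)

/-- The integral of `scaleWeight` times the flux over a smaller time interval. -/
theorem IsFokkerPlanckSolution.setIntegral_weighted_le
    (h : IsFokkerPlanckSolution μ e σ τ b ρτ ρ) {l s t : ℝ} (hl : 1 ≤ l) (hs : 0 < s)
    (ht : t < τ) :
    ∫ a in Icc s t ×ˢ univ, scaleWeight l a.2 *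
      (|ρ a.1 a.2| + ∑ i, |b i a.1 a.2 * ρ a.1 a.2|) ∂(volume.prod μ) ≤ weightedFlux μ τ b ρ l :=
  setIntegral_mono_set (h.integrableOn_weighted hl)
    (Eventually.of_forall fun _ => mul_nonneg (scaleWeight_nonneg (by linarith) _) (by positivity))
    (LE.le.eventuallyLE
      (prod_mono_left fun _ hr => ⟨hs.trans_le hr.1, hr.2.trans_lt ht⟩))

variable [μ.IsAddHaarMeasure]

/-- Almost monotonicity of `∫ ψ φ(ρ)` for convex `φ` of linear growth. -/
theorem IsFokkerPlanckSolution.exists_integral_comp_le (h : IsFokkerPlanckSolution μ e σ τ b ρτ ρ)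
    (hσ : 0 < σ) {ψ : E → ℝ} (hψ : ContDiff ℝ 2 ψ) (hψc : HasCompactSupport ψ) (ψ0 : ∀ z, 0 ≤ ψ z)
    {A l : ℝ} (hA : 0 ≤ A) (hl : 1 ≤ l) (hψ1 : ∀ i z, |dirDeriv (e i) ψ z| ≤ A * scaleWeight l z)
    (hψ2 : ∀ i z, |dirDeriv (e i) (dirDeriv (e i) ψ) z| ≤ A * scaleWeight l z)
    {s t : ℝ} (hs : 0 < s) (hst : s ≤ t) (ht : t < τ) :
    ∃ C : ℝ, 0 ≤ C ∧ ∀ ε, 0 ≤ ε → ∀ φ φ' φ'' : ℝ → ℝ, (∀ x, HasDerivAt φ (φ' x) x) →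
      (∀ x, HasDerivAt φ' (φ'' x) x) → ContDiff ℝ 1 φ → ContDiff ℝ 1 φ' → Continuous φ'' →
      (∀ x, 0 ≤ φ'' x) → (∀ x, φ'' x * x ^ 2 ≤ ε) → (∀ x, |φ' x| ≤ 1) → (∀ x, |φ x| ≤ |x| + ε) →
      ∫ z, ψ z * φ (ρ s z) ∂μ ≤ ∫ z, ψ z * φ (ρ t z) ∂μ
        + A * (σ * Fintype.card ι + 1) * weightedFlux μ τ b ρ l + ε * C := by
  have hsub : Icc s t ⊆ Ioo 0 τ := fun r hr => ⟨hs.trans_le hr.1, hr.2.trans_lt ht⟩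
  have hsub' : Icc s t ×ˢ (univ : Set E) ⊆ Ioo 0 τ ×ˢ univ := prod_mono_left hsub
  have h2 : ∀ {f : E → ℝ} (i : ι), ContDiff ℝ 2 f → ContDiff ℝ 1 (dirDeriv (e i) f) :=
    fun i hf => hf.dirDeriv (by norm_num) _
  have h3 : ∀ {f : E → ℝ} (i : ι), ContDiff ℝ 1 f → Continuous (dirDeriv (e i) f) :=
    fun i hf => (hf.dirDeriv (m := 0) (by norm_num) _).continuous
  have cρ := h.regular.continuousOn.mono hsub'
  have cρi := fun i => (h.regular.continuousOn_dirDeriv (e i)).mono hsub'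
  have cb := fun i => (h.continuousOn_drift i).mono hsub'
  simp only [Function.uncurry_def] at cρ cb
  have cψ : ContinuousOn (fun a : ℝ × E => ψ a.2) (Icc s t ×ˢ univ) :=
    (hψ.continuous.comp continuous_snd).continuousOn
  have cψ1 : ∀ i, ContinuousOn (fun a : ℝ × E => dirDeriv (e i) ψ a.2) (Icc s t ×ˢ univ) :=
    fun i : ι => ((h2 i hψ).continuous.comp continuous_snd).continuousOn
  have cψ2 : ∀ i, ContinuousOn (fun a : ℝ × E => dirDeriv (e i) (dirDeriv (e i) ψ) a.2)
      (Icc s t ×ˢ univ) :=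
    fun i : ι => ((h3 i (h2 i hψ)).comp continuous_snd).continuousOn
  have z0 : ∀ z, z ∉ tsupport ψ → ψ z = 0 := fun z hz => image_eq_zero_of_notMem_tsupport hz
  have z1 : ∀ i z, z ∉ tsupport ψ → dirDeriv (e i) ψ z = 0 :=
    fun i z hz => dirDeriv_eq_zero_of_notMem_tsupport hz _
  have z2 : ∀ i z, z ∉ tsupport ψ → dirDeriv (e i) (dirDeriv (e i) ψ) z = 0 :=
    fun i z hz => dirDeriv_dirDeriv_eq_zero_of_notMem_tsupport hz _
  -- The constant `C` is the integral of `q`. It does not involve `φ`, so `φ` can be regularised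
  -- with the cutoff fixed; it is finite because `b` is bounded on `Icc s t ×ˢ tsupport ψ`.
  let q : ℝ → E → ℝ := fun r z => ∑ i, (ψ z * (b i r z ^ 2 / (4 * σ)) +
    σ * |dirDeriv (e i) (dirDeriv (e i) ψ) z|)
  have q0 : ∀ r z, 0 ≤ q r z := fun r z => Finset.sum_nonneg fun i _ => by
    have := ψ0 z
    positivity
  have iq : IntegrableOn (fun a : ℝ × E => q a.1 a.2) (Icc s t ×ˢ univ) (volume.prod μ) := by
    refine ContinuousOn.integrableOn_Icc_prod_of_compact_support μ (F := q) hψc ?_ ?_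
    · refine continuousOn_finsetSum _ fun i _ => ?_
      exact (cψ.mul (((cb i).pow 2).div_const _)).add (continuousOn_const.mul (cψ2 i).abs)
    · intro r _ z hz
      simp [q, z0 z hz, z2 _ z hz]
  refine ⟨∫ a in Icc s t ×ˢ univ, q a.1 a.2 ∂(volume.prod μ), integral_nonneg fun a => q0 _ _, ?_⟩
  intro ε hε φ φ' φ'' hφ hφ' cφ cφ' cφ'' p1 p2 p3 p4
  have key := h.integral_comp_sub hψ hψc hφ hφ' cφ cφ' cφ'' hs hst ht
  have iw : IntegrableOn (fun a : ℝ × E => scaleWeight l a.2 *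
      (|ρ a.1 a.2| + ∑ i, |b i a.1 a.2 * ρ a.1 a.2|)) (Icc s t ×ˢ univ) (volume.prod μ) :=
    (h.integrableOn_weighted hl).mono_set hsub'
  have iF := ContinuousOn.integrableOn_Icc_prod_of_compact_support μ (s := s) (t := t)
    (F := fun r z => ∑ i,
        (ψ z * φ'' (ρ r z) * dirDeriv (e i) (ρ r) z *
            (σ * dirDeriv (e i) (ρ r) z + b i r z * ρ r z)
          + dirDeriv (e i) ψ z * φ' (ρ r z) * (b i r z * ρ r z)
          - σ * dirDeriv (e i) (dirDeriv (e i) ψ) z * φ (ρ r z))) hψc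
    (by
      refine continuousOn_finsetSum _ fun i _ => ?_
      refine ContinuousOn.sub (ContinuousOn.add ?_ ?_) ?_
      · exact ((cψ.mul (cφ''.comp_continuousOn cρ)).mul (cρi i)).mul
          ((continuousOn_const.mul (cρi i)).add ((cb i).mul cρ))
      · exact ((cψ1 i).mul (cφ'.continuous.comp_continuousOn cρ)).mul ((cb i).mul cρ)
      · exact (continuousOn_const.mul (cψ2 i)).mul (cφ.continuous.comp_continuousOn cρ))
    (fun r _ z hz => by simp [z0 z hz, z1 _ z hz, z2 _ z hz])
  have hmono : ∫ a in Icc s t ×ˢ univ, (-(A * (σ * Fintype.card ι + 1)) * (scaleWeight l a.2 *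
      (|ρ a.1 a.2| + ∑ i, |b i a.1 a.2 * ρ a.1 a.2|)) - ε * q a.1 a.2) ∂(volume.prod μ) ≤
      ∫ z, ψ z * φ (ρ t z) ∂μ - ∫ z, ψ z * φ (ρ s z) ∂μ := by
    rw [key]
    refine integral_mono ((iw.const_mul _).sub (iq.const_mul _)) iF ?_
    rintro ⟨r, z⟩
    have hw : 0 ≤ scaleWeight l z := scaleWeight_nonneg (by linarith) z
    have hi : ∀ i, -(A * scaleWeight l z * |b i r z * ρ r z|)
        - σ * (A * scaleWeight l z) * |ρ r z|
        - ε * (ψ z * (b i r z ^ 2 / (4 * σ)) + σ * |dirDeriv (e i) (dirDeriv (e i) ψ) z|) ≤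
        ψ z * φ'' (ρ r z) * dirDeriv (e i) (ρ r) z *
            (σ * dirDeriv (e i) (ρ r) z + b i r z * ρ r z)
          + dirDeriv (e i) ψ z * φ' (ρ r z) * (b i r z * ρ r z)
          - σ * dirDeriv (e i) (dirDeriv (e i) ψ) z * φ (ρ r z) := by
      intro i
      have t1 : -(ε * (ψ z * (b i r z ^ 2 / (4 * σ)))) ≤ ψ z * φ'' (ρ r z) *
          dirDeriv (e i) (ρ r) z * (σ * dirDeriv (e i) (ρ r) z + b i r z * ρ r z) := by
        set p := dirDeriv (e i) (ρ r) z
        set B := b i r z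
        set x := ρ r z
        -- Completing the square in `p` uses convexity and leaves a loss proportional to φ''(x)x²,
        -- which is at most ε.
        have y1 : -(φ'' x * x ^ 2 * (B ^ 2 / (4 * σ))) ≤ φ'' x * (p * (σ * p + B * x)) := by
          have : φ'' x * (p * (σ * p + B * x)) + φ'' x * x ^ 2 * (B ^ 2 / (4 * σ))
              = φ'' x * (σ * (p + B * x / (2 * σ)) ^ 2) := by
            field_simp
            ring
          have h5 : 0 ≤ φ'' x * (σ * (p + B * x / (2 * σ)) ^ 2) := by
            have := p1 x
            positivity
          linarith
        have y2 : φ'' x * x ^ 2 * (B ^ 2 / (4 * σ)) ≤ ε * (B ^ 2 / (4 * σ)) :=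
          mul_le_mul_of_nonneg_right (p2 x) (by positivity)
        have y3 : -(ε * (B ^ 2 / (4 * σ))) ≤ φ'' x * (p * (σ * p + B * x)) := by linarith
        have y4 := mul_le_mul_of_nonneg_left y3 (ψ0 z)
        calc _ = ψ z * -(ε * (B ^ 2 / (4 * σ))) := by ring
          _ ≤ _ := y4
          _ = _ := by ring
      have t2 : |dirDeriv (e i) ψ z * φ' (ρ r z) * (b i r z * ρ r z)| ≤
          A * scaleWeight l z * |b i r z * ρ r z| := by
        rw [abs_mul, abs_mul]
        refine mul_le_mul_of_nonneg_right ?_ (abs_nonneg _)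
        calc _ ≤ A * scaleWeight l z * 1 :=
              mul_le_mul (hψ1 i z) (p3 _) (abs_nonneg _) (by positivity)
          _ = _ := mul_one _
      have t3 : |σ * dirDeriv (e i) (dirDeriv (e i) ψ) z * φ (ρ r z)| ≤
          σ * (A * scaleWeight l z) * |ρ r z|
            + ε * (σ * |dirDeriv (e i) (dirDeriv (e i) ψ) z|) := by
        rw [abs_mul, abs_mul, abs_of_pos hσ]
        set D := |dirDeriv (e i) (dirDeriv (e i) ψ) z|
        have hD : 0 ≤ D := abs_nonneg _
        calc σ * D * |φ (ρ r z)| ≤ σ * D * (|ρ r z| + ε) :=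
              mul_le_mul_of_nonneg_left (p4 _) (by positivity)
          _ = σ * D * |ρ r z| + ε * (σ * D) := by ring
          _ ≤ _ := by
            gcongr
            exact hψ2 i z
      have t2' := neg_le_of_abs_le t2
      have t3' := le_of_abs_le t3
      linarith
    have hsum := Finset.sum_le_sum fun i (_ : i ∈ Finset.univ) => hi i
    refine le_trans ?_ hsum
    simp only [Finset.sum_sub_distrib, Finset.sum_neg_distrib, ← Finset.mul_sum,
      Finset.sum_const, Finset.card_univ, nsmul_eq_mul, q]
    set S := ∑ i, |b i r z * ρ r z|
    have hS : 0 ≤ S := Finset.sum_nonneg fun _ _ => abs_nonneg _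
    have g1 : 0 ≤ A * scaleWeight l z * |ρ r z| := by positivity
    have g2 : 0 ≤ A * scaleWeight l z * S * (σ * Fintype.card ι) := by positivity
    nlinarith
  rw [integral_sub (iw.const_mul _) (iq.const_mul _), integral_const_mul, integral_const_mul]
    at hmono
  have hJ := h.setIntegral_weighted_le hl hs ht
  have hc : 0 ≤ A * (σ * Fintype.card ι + 1) := by positivity
  have := mul_le_mul_of_nonneg_left hJ hc
  linarith

end Weight

/-! ### Cutoff functions at scale R. -/

section Cutoff

variable {E : Type*} [NormedAddCommGroup E] [NormedSpace ℝ E] {ι : Type*}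

/-- A smooth cutoff function between the balls of radii `R` and `2 R`. -/
structure IsCutoff (e : ι → E) (B R : ℝ) (χ : E → ℝ) : Prop where
  contDiff : ContDiff ℝ 2 χ
  nonneg : ∀ z, 0 ≤ χ z
  le_one : ∀ z, χ z ≤ 1
  eq_one : ∀ z, ‖z‖ ≤ R → χ z = 1
  eq_zero : ∀ z, 2 * R ≤ ‖z‖ → χ z = 0
  abs_dirDeriv_le : ∀ i z, |dirDeriv (e i) χ z| ≤ B / R
  sq_dirDeriv_le : ∀ i z, dirDeriv (e i) χ z ^ 2 ≤ B / R ^ 2 * χ z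
  abs_dirDeriv_two_le : ∀ i z, |dirDeriv (e i) (dirDeriv (e i) χ) z| ≤ B / R ^ 2
  dirDeriv_eq_zero : ∀ i z, ‖z‖ < R → dirDeriv (e i) χ z = 0
  dirDeriv_two_eq_zero : ∀ i z, ‖z‖ < R → dirDeriv (e i) (dirDeriv (e i) χ) z = 0

theorem dirDeriv_comp_smul (f : E → ℝ) (c : ℝ) (v : E) :
    dirDeriv v (fun z => f (c • z)) = fun z => c * dirDeriv v f (c • z) := by
  ext z
  simp [dirDeriv, fderiv_comp_smul]

theorem dirDeriv_const_mul (f : E → ℝ) (c : ℝ) (v : E) :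
    dirDeriv v (fun z => c * f z) = fun z => c * dirDeriv v f z := by
  ext z
  have : fderiv ℝ (c • f) z = c • fderiv ℝ f z := by rw [fderiv_const_smul_field]; rfl
  change fderiv ℝ (c • f) z v = _
  rw [this]
  rfl

theorem dirDeriv_eq_of_eventuallyEq {f g : E → ℝ} {z : E} (h : f =ᶠ[𝓝 z] g) (v : E) :
    dirDeriv v f z = dirDeriv v g z := by
  simp [dirDeriv, h.fderiv_eq]

theorem dirDeriv_const (c : ℝ) (v : E) : dirDeriv v (fun _ : E => c) = fun _ => 0 := by
  ext z; simp [dirDeriv]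

/-- The profile is the square of a bump `f`, so that its squared derivative 4f²(∂f)² is bounded by a
multiple of the profile itself. This is the property needed for absorption in `young_cutoff`.
Rescaling one profile makes `B` independent of `R`. -/
theorem exists_isCutoff [FiniteDimensional ℝ E] [Fintype ι] (e : ι → E) :
    ∃ B : ℝ, 0 ≤ B ∧ ∀ R : ℝ, 1 ≤ R → ∃ χ : E → ℝ, IsCutoff e B R χ := by
  let f : ContDiffBump (0 : E) := ⟨1, 2, by norm_num, by norm_num⟩
  have f1 : ∀ z : E, ‖z‖ ≤ 1 → f z = 1 := fun z hz =>
    f.one_of_mem_closedBall (by simpa [mem_closedBall_zero_iff] using hz)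
  have f0 : ∀ z : E, 2 ≤ ‖z‖ → f z = 0 := fun z hz =>
    f.zero_of_le_dist (by simpa [dist_zero_right] using hz)
  have hf : ContDiff ℝ 3 (f : E → ℝ) := f.contDiff
  have hfc : HasCompactSupport (f : E → ℝ) := f.hasCompactSupport
  let g : E → ℝ := fun z => f z * f z
  have hg : ContDiff ℝ 2 g := (hf.mul hf).of_le (by norm_num)
  have hgc : HasCompactSupport g := hfc.mul_right
  have g1 : ∀ z, ‖z‖ ≤ 1 → g z = 1 := fun z hz => by simp [g, f1 z hz]
  have hg1 : ∀ i, ContDiff ℝ 1 (dirDeriv (e i) g) := fun i => hg.dirDeriv (by norm_num) _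
  have hg2 : ∀ i, Continuous (dirDeriv (e i) (dirDeriv (e i) g)) := fun i =>
    ((hg1 i).dirDeriv (m := 0) (by norm_num) _).continuous
  have hf1 : ∀ i, Continuous (dirDeriv (e i) f) := fun i =>
    (hf.dirDeriv (m := 0) (by norm_num) _).continuous
  choose C₁ hC₁ using fun i => (hfc.dirDeriv (e i)).exists_bound_of_continuous (hf1 i)
  choose C₂ hC₂ using fun i => ((hgc.dirDeriv (e i)).dirDeriv (e i)).exists_bound_of_continuous
    (hg2 i)
  have hC₁0 : ∀ i, 0 ≤ C₁ i := fun i => (norm_nonneg _).trans (hC₁ i 0)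
  have hC₂0 : ∀ i, 0 ≤ C₂ i := fun i => (norm_nonneg _).trans (hC₂ i 0)
  have hdg : ∀ i z, dirDeriv (e i) g z = 2 * f z * dirDeriv (e i) f z := fun i z => by
    have l := (hf.differentiable (by norm_num) z).hasLineDerivAt_dirDeriv (e i)
    rw [(l.fun_mul l).dirDeriv_eq (hg.differentiable (by norm_num) z)]
    ring
  have b1 : ∀ i z, |dirDeriv (e i) g z| ≤ 2 * C₁ i := fun i z => by
    rw [hdg, abs_mul, abs_mul, abs_of_nonneg f.nonneg, abs_two]
    have h1 := hC₁ i z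
    rw [Real.norm_eq_abs] at h1
    have : 2 * f z ≤ 2 * 1 := by linarith [f.le_one (x := z)]
    have := mul_le_mul this h1 (abs_nonneg _) (by norm_num)
    linarith
  have b1' : ∀ i z, dirDeriv (e i) g z ^ 2 ≤ 4 * C₁ i ^ 2 * g z := fun i z => by
    rw [hdg]
    have h1 := hC₁ i z
    rw [Real.norm_eq_abs] at h1
    have h2 : dirDeriv (e i) f z ^ 2 ≤ C₁ i ^ 2 := sq_le_sq' (neg_le_of_abs_le h1)
      (le_of_abs_le h1)
    have h3 : 0 ≤ g z := mul_self_nonneg _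
    calc _ = 4 * dirDeriv (e i) f z ^ 2 * g z := by simp only [g]; ring
      _ ≤ _ := by gcongr
  have b2 : ∀ i z, |dirDeriv (e i) (dirDeriv (e i) g) z| ≤ C₂ i := fun i z => by
    simpa [Real.norm_eq_abs] using hC₂ i z
  let B : ℝ := ∑ i, (2 * C₁ i + 4 * C₁ i ^ 2 + C₂ i)
  have hB : ∀ i, 2 * C₁ i + 4 * C₁ i ^ 2 + C₂ i ≤ B := fun i =>
    Finset.single_le_sum (f := fun i => 2 * C₁ i + 4 * C₁ i ^ 2 + C₂ i)
      (fun j _ => by have := hC₁0 j; have := hC₂0 j; positivity) (Finset.mem_univ i)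
  have hB0 : 0 ≤ B := Finset.sum_nonneg fun j _ => by
    have := hC₁0 j; have := hC₂0 j; positivity
  refine ⟨B, hB0, fun R hR => ⟨fun z => g (R⁻¹ • z), ?_⟩⟩
  have hR0 : 0 < R := by linarith
  have d1 : ∀ i, dirDeriv (e i) (fun z => g (R⁻¹ • z)) =
      fun z => R⁻¹ * dirDeriv (e i) g (R⁻¹ • z) := fun i => dirDeriv_comp_smul g _ _
  have d2 : ∀ i, dirDeriv (e i) (dirDeriv (e i) (fun z => g (R⁻¹ • z))) =
      fun z => R⁻¹ * (R⁻¹ * dirDeriv (e i) (dirDeriv (e i) g) (R⁻¹ • z)) := fun i => by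
    rw [d1, dirDeriv_const_mul (fun z => dirDeriv (e i) g (R⁻¹ • z)),
      dirDeriv_comp_smul (dirDeriv (e i) g)]
  have hn : ∀ z : E, ‖R⁻¹ • z‖ = ‖z‖ / R := fun z => by
    rw [norm_smul, Real.norm_eq_abs, abs_of_pos (by positivity)]; field_simp
  have loc : ∀ z : E, ‖z‖ < R → (fun z => g (R⁻¹ • z)) =ᶠ[𝓝 z] fun _ => 1 := fun z hz => by
    filter_upwards [(isOpen_lt continuous_norm continuous_const).mem_nhds hz] with y hy
    exact g1 _ (by rw [hn, div_le_one hR0]; exact le_of_lt hy)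
  have loc1 : ∀ i (z : E), ‖z‖ < R → dirDeriv (e i) (fun z => g (R⁻¹ • z)) z = 0 := fun i z hz => by
    rw [dirDeriv_eq_of_eventuallyEq (loc z hz), dirDeriv_const]
  refine ⟨hg.comp (contDiff_const_smul _), fun z => mul_self_nonneg _, fun z => ?_, fun z hz => ?_,
    fun z hz => ?_, fun i z => ?_, fun i z => ?_, fun i z => ?_, loc1, fun i z hz => ?_⟩
  · have h1 := f.le_one (x := R⁻¹ • z)
    have h2 := f.nonneg (x := R⁻¹ • z)
    simp only [g]
    nlinarith
  · exact g1 _ (by rw [hn, div_le_one hR0]; exact hz)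
  · have : f (R⁻¹ • z) = 0 := f0 _ (by rw [hn, le_div_iff₀ hR0]; exact hz)
    simp [g, this]
  · rw [d1]
    simp only [abs_mul]
    rw [abs_of_pos (inv_pos.2 hR0), div_eq_inv_mul]
    have := hC₂0 i
    have : 2 * C₁ i ≤ B := by nlinarith [hB i]
    exact mul_le_mul_of_nonneg_left ((b1 i _).trans this) (by positivity)
  · rw [d1]
    have := hC₂0 i
    have := hC₁0 i
    have h1 : 4 * C₁ i ^ 2 ≤ B := by nlinarith [hB i]
    have h2 : 0 ≤ g (R⁻¹ • z) := mul_self_nonneg _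
    calc (R⁻¹ * dirDeriv (e i) g (R⁻¹ • z)) ^ 2 = (R ^ 2)⁻¹ * dirDeriv (e i) g (R⁻¹ • z) ^ 2 := by
          field_simp
      _ ≤ (R ^ 2)⁻¹ * (B * g (R⁻¹ • z)) := by
          refine mul_le_mul_of_nonneg_left ((b1' i _).trans ?_) (by positivity)
          exact mul_le_mul_of_nonneg_right h1 h2
      _ = _ := by ring
  · rw [d2]
    simp only [abs_mul]
    rw [abs_of_pos (inv_pos.2 hR0)]
    have := hC₁0 i
    have h1 : C₂ i ≤ B := by nlinarith [hB i]
    calc _ ≤ R⁻¹ * (R⁻¹ * B) := by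
          gcongr
          exact (b2 i _).trans h1
      _ = _ := by field_simp
  · have : dirDeriv (e i) (fun z => g (R⁻¹ • z)) =ᶠ[𝓝 z] fun _ => 0 := by
      filter_upwards [(isOpen_lt continuous_norm continuous_const).mem_nhds hz] with y hy
      exact loc1 i y hy
    rw [dirDeriv_eq_of_eventuallyEq this, dirDeriv_const]

namespace IsCutoff

variable {e : ι → E} {B R : ℝ} {χ : E → ℝ}

theorem hasCompactSupport [FiniteDimensional ℝ E] (h : IsCutoff e B R χ) : HasCompactSupport χ :=
  HasCompactSupport.intro (isCompact_closedBall (0 : E) (2 * R)) fun z hz => h.eq_zero z (by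
    simp only [mem_closedBall_zero_iff, not_le] at hz; exact hz.le)

theorem abs_dirDeriv_le_scaleWeight (h : IsCutoff e B R χ) (hB : 0 ≤ B) (hR : 1 ≤ R) (i : ι)
    (z : E) : |dirDeriv (e i) χ z| ≤ B * scaleWeight R z := by
  refine (h.abs_dirDeriv_le i z).trans ?_
  rw [div_eq_mul_one_div]
  exact mul_le_mul_of_nonneg_left (one_div_le_scaleWeight (by linarith) z) hB

theorem abs_dirDeriv_two_le_scaleWeight (h : IsCutoff e B R χ) (hB : 0 ≤ B) (hR : 1 ≤ R) (i : ι)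
    (z : E) : |dirDeriv (e i) (dirDeriv (e i) χ) z| ≤ B * scaleWeight R z := by
  refine (h.abs_dirDeriv_two_le i z).trans ?_
  rw [div_eq_mul_one_div]
  refine mul_le_mul_of_nonneg_left (le_trans ?_ (one_div_le_scaleWeight (by linarith) z)) hB
  exact one_div_le_one_div_of_le (by linarith) (by nlinarith)

end IsCutoff

end Cutoff

/-! ### The regularised absolute value √(x² + ε²). -/

theorem hasDerivAt_sqrt_sq_add_sq {ε : ℝ} (hε : 0 < ε) (x : ℝ) :
    HasDerivAt (fun x : ℝ => √(x ^ 2 + ε ^ 2)) (x / √(x ^ 2 + ε ^ 2)) x := by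
  have S0 : 0 < x ^ 2 + ε ^ 2 := by positivity
  convert ((hasDerivAt_pow 2 x).add_const (ε ^ 2)).sqrt S0.ne' using 1
  push_cast
  ring

theorem hasDerivAt_div_sqrt_sq_add_sq {ε : ℝ} (hε : 0 < ε) (x : ℝ) :
    HasDerivAt (fun x : ℝ => x / √(x ^ 2 + ε ^ 2)) (ε ^ 2 / √(x ^ 2 + ε ^ 2) ^ 3) x := by
  have S0 : 0 < x ^ 2 + ε ^ 2 := by positivity
  have h1 : 0 < √(x ^ 2 + ε ^ 2) := Real.sqrt_pos.2 S0
  have h2 : √(x ^ 2 + ε ^ 2) ^ 2 = x ^ 2 + ε ^ 2 := Real.sq_sqrt S0.le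
  refine ((hasDerivAt_id x).div (hasDerivAt_sqrt_sq_add_sq hε x) h1.ne').congr_deriv ?_
  simp only [id]
  field_simp
  rw [h2]
  ring

theorem contDiff_sqrt_sq_add_sq {ε : ℝ} (hε : 0 < ε) {n : WithTop ℕ∞} :
    ContDiff ℝ n fun x : ℝ => √(x ^ 2 + ε ^ 2) :=
  ContDiff.sqrt (by fun_prop) fun x => by positivity

/-! ### Nonnegativity of ρ and control of its integrals. -/

section Positivity

variable {E : Type*} [NormedAddCommGroup E] [NormedSpace ℝ E] [FiniteDimensional ℝ E]
  [MeasurableSpace E] [BorelSpace E] {μ : Measure E}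
  [μ.IsAddHaarMeasure] {ι : Type*} [Fintype ι] {e : ι → E} {σ τ : ℝ} {b : ι → ℝ → E → ℝ}
  {ρτ : E → ℝ} {ρ : ℝ → E → ℝ}

theorem IsFokkerPlanckSolution.continuous_slice (h : IsFokkerPlanckSolution μ e σ τ b ρτ ρ) {t : ℝ}
    (ht : t ∈ Ioc 0 τ) : Continuous (ρ t) := by
  have : Continuous fun z => Function.uncurry ρ (t, z) :=
    h.continuousOn.comp_continuous (by fun_prop) (fun z => ⟨ht, mem_univ _⟩)
  exact this

theorem IsFokkerPlanckSolution.integrable_mul_comp (h : IsFokkerPlanckSolution μ e σ τ b ρτ ρ)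
    {ψ : E → ℝ} (hψ : Continuous ψ) (hψc : HasCompactSupport ψ) {φ : ℝ → ℝ} (hφ : Continuous φ)
    {t : ℝ} (ht : t ∈ Ioc 0 τ) : Integrable (fun z => ψ z * φ (ρ t z)) μ :=
  (hψ.mul (hφ.comp (h.continuous_slice ht))).integrable_of_hasCompactSupport hψc.mul_right

theorem IsFokkerPlanckSolution.tendsto_integral_mul_comp
    (h : IsFokkerPlanckSolution μ e σ τ b ρτ ρ) (hτ : 0 < τ)
    {ψ : E → ℝ} (hψ : Continuous ψ) (hψc : HasCompactSupport ψ) {φ : ℝ → ℝ} (hφ : Continuous φ) :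
    Tendsto (fun t => ∫ z, ψ z * φ (ρ t z) ∂μ) (𝓝[<] τ) (𝓝 (∫ z, ψ z * φ (ρτ z) ∂μ)) := by
  have hc : ContinuousOn (fun t => ∫ z, ψ z * φ (ρ t z) ∂μ) (Ioc 0 τ) := by
    refine continuousOn_integral_of_compact_support (k := tsupport ψ) hψc ?_ ?_
    · exact (hψ.comp continuous_snd).continuousOn.mul (hφ.comp_continuousOn h.continuousOn)
    · intro t z _ hz
      simp [image_eq_zero_of_notMem_tsupport hz]
  have h1 := hc τ (right_mem_Ioc.2 hτ)
  rw [ContinuousWithinAt, h.terminal] at h1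
  refine h1.mono_left ?_
  rw [← nhdsWithin_Ioo_eq_nhdsLT hτ]
  exact nhdsWithin_mono _ Ioo_subset_Ioc_self

/-- Almost monotonicity of `∫ ψ ρ⁻`. -/
theorem IsFokkerPlanckSolution.integral_negPart_le (h : IsFokkerPlanckSolution μ e σ τ b ρτ ρ)
    (hσ : 0 < σ) {ψ : E → ℝ} (hψ : ContDiff ℝ 2 ψ) (hψc : HasCompactSupport ψ) (ψ0 : ∀ z, 0 ≤ ψ z)
    {A l : ℝ} (hA : 0 ≤ A) (hl : 1 ≤ l) (hψ1 : ∀ i z, |dirDeriv (e i) ψ z| ≤ A * scaleWeight l z)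
    (hψ2 : ∀ i z, |dirDeriv (e i) (dirDeriv (e i) ψ) z| ≤ A * scaleWeight l z)
    {s t : ℝ} (hs : 0 < s) (hst : s ≤ t) (ht : t < τ) :
    ∫ z, ψ z * max (-ρ s z) 0 ∂μ ≤ ∫ z, ψ z * max (-ρ t z) 0 ∂μ
        + A * (σ * Fintype.card ι + 1) * weightedFlux μ τ b ρ l := by
  obtain ⟨C, hC, H⟩ := h.exists_integral_comp_le hσ hψ hψc ψ0 hA hl hψ1 hψ2 hs hst ht
  have hsI : s ∈ Ioc 0 τ := ⟨hs, by linarith⟩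
  have htI : t ∈ Ioc 0 τ := ⟨by linarith, by linarith⟩
  have cm : Continuous fun x : ℝ => max (-x) 0 := by fun_prop
  have key : ∀ ε > 0, ∫ z, ψ z * max (-ρ s z) 0 ∂μ ≤ (∫ z, ψ z * max (-ρ t z) 0 ∂μ
        + A * (σ * Fintype.card ι + 1) * weightedFlux μ τ b ρ l) + ε * (∫ z, ψ z ∂μ + C) := by
    intro ε hε
    have S0 : ∀ x : ℝ, 0 < x ^ 2 + ε ^ 2 := fun x => by positivity
    have Sp : ∀ x : ℝ, 0 < √(x ^ 2 + ε ^ 2) := fun x => Real.sqrt_pos.2 (S0 x)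
    have Sq : ∀ x : ℝ, √(x ^ 2 + ε ^ 2) ^ 2 = x ^ 2 + ε ^ 2 := fun x => Real.sq_sqrt (S0 x).le
    have Sx : ∀ x : ℝ, |x| ≤ √(x ^ 2 + ε ^ 2) := fun x => Real.abs_le_sqrt (by nlinarith)
    have Se : ∀ x : ℝ, ε ≤ √(x ^ 2 + ε ^ 2) := fun x => Real.le_sqrt_of_sq_le (by nlinarith)
    have Su : ∀ x : ℝ, √(x ^ 2 + ε ^ 2) ≤ |x| + ε := fun x => by
      refine Real.sqrt_le_iff.2 ⟨by positivity, ?_⟩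
      have := abs_nonneg x
      nlinarith [sq_abs x]
    have cS : ContDiff ℝ 1 fun x : ℝ => √(x ^ 2 + ε ^ 2) := contDiff_sqrt_sq_add_sq hε
    -- A smooth convex function within ε above the negative part. With S = √(x² + ε²), φ''(x)x² =
    -- ε²x²/(2S³) ≤ ε/2, because S dominates both |x| and ε.
    let φ : ℝ → ℝ := fun x => (√(x ^ 2 + ε ^ 2) - x) / 2
    have hlow : ∀ x, max (-x) 0 ≤ φ x := fun x => by
      have := Sx x
      have h1 := neg_le_abs x
      have h2 := le_abs_self x
      simp only [φ]
      exact max_le (by linarith) (by linarith)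
    have hup : ∀ x, φ x ≤ max (-x) 0 + ε := fun x => by
      have := Su x
      simp only [φ]
      rcases le_total 0 x with hx | hx
      · rw [abs_of_nonneg hx] at this
        have := le_max_right (-x) 0
        linarith
      · rw [abs_of_nonpos hx] at this
        have := le_max_left (-x) 0
        linarith
    have cφ : Continuous φ := (cS.continuous.sub continuous_id).div_const 2
    have H1 := H ε hε.le φ (fun x => (x / √(x ^ 2 + ε ^ 2) - 1) / 2)
      (fun x => ε ^ 2 / (2 * √(x ^ 2 + ε ^ 2) ^ 3))
      (fun x => ((hasDerivAt_sqrt_sq_add_sq hε x).sub (hasDerivAt_id x)).div_const 2)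
      (fun x => by
        refine (((hasDerivAt_div_sqrt_sq_add_sq hε x).sub_const 1).div_const 2).congr_deriv ?_
        rw [div_div, mul_comm 2])
      ((cS.sub contDiff_id).div_const 2)
      (((contDiff_id.div cS fun x => (Sp x).ne').sub contDiff_const).div_const 2)
      (continuous_const.div (continuous_const.mul (cS.continuous.pow 3)) fun x => by
        have := Sp x
        exact (mul_pos two_pos (pow_pos this 3)).ne')
      (fun x => by
        have := Sp x
        positivity)
      (fun x => by
        have h1 := Sp x
        have h2 := Sq x
        have h3 := Se x
        rw [div_mul_eq_mul_div, div_le_iff₀ (by positivity)]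
        have h4 : x ^ 2 ≤ √(x ^ 2 + ε ^ 2) ^ 2 := by nlinarith
        calc ε ^ 2 * x ^ 2 ≤ (ε * √(x ^ 2 + ε ^ 2)) * √(x ^ 2 + ε ^ 2) ^ 2 :=
              mul_le_mul (by nlinarith) h4 (by positivity) (by positivity)
          _ ≤ _ := by nlinarith [pow_pos h1 3])
      (fun x => by
        have h1 : |x / √(x ^ 2 + ε ^ 2)| ≤ 1 := by
          rw [abs_div, abs_of_pos (Sp x), div_le_one (Sp x)]; exact Sx x
        have h2 := neg_le_of_abs_le h1
        have h3 := le_of_abs_le h1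
        rw [abs_le]
        constructor <;> linarith)
      (fun x => by
        have h1 := hlow x
        have h2 := hup x
        have h3 := le_max_right (-x) 0
        rw [abs_of_nonneg (h3.trans h1)]
        have h4 : max (-x) 0 ≤ |x| := max_le (neg_le_abs x) (abs_nonneg x)
        linarith)
    have i1 : ∫ z, ψ z * max (-ρ s z) 0 ∂μ ≤ ∫ z, ψ z * φ (ρ s z) ∂μ :=
      integral_mono (h.integrable_mul_comp hψ.continuous hψc cm hsI)
        (h.integrable_mul_comp hψ.continuous hψc cφ hsI)
        fun z => mul_le_mul_of_nonneg_left (hlow _) (ψ0 z)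
    have iψ : Integrable ψ μ := hψ.continuous.integrable_of_hasCompactSupport hψc
    have i2 : ∫ z, ψ z * φ (ρ t z) ∂μ ≤ ∫ z, (ψ z * max (-ρ t z) 0 + ε * ψ z) ∂μ :=
      integral_mono (h.integrable_mul_comp hψ.continuous hψc cφ htI)
        ((h.integrable_mul_comp hψ.continuous hψc cm htI).add (iψ.const_mul ε))
        fun z => (mul_le_mul_of_nonneg_left (hup _) (ψ0 z)).trans_eq (by ring)
    rw [integral_add (h.integrable_mul_comp hψ.continuous hψc cm htI) (iψ.const_mul ε),
      integral_const_mul] at i2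
    linarith
  have lim : Tendsto (fun ε : ℝ => (∫ z, ψ z * max (-ρ t z) 0 ∂μ
        + A * (σ * Fintype.card ι + 1) * weightedFlux μ τ b ρ l) + ε * (∫ z, ψ z ∂μ + C))
        (𝓝[>] 0) (𝓝 ((∫ z, ψ z * max (-ρ t z) 0 ∂μ
        + A * (σ * Fintype.card ι + 1) * weightedFlux μ τ b ρ l) + 0 * (∫ z, ψ z ∂μ + C))) :=
    (tendsto_const_nhds.add (tendsto_id.mul_const _)).mono_left nhdsWithin_le_nhds
  have := ge_of_tendsto lim (eventually_nhdsWithin_of_forall key)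
  simpa using this

/-- The negative part vanishes at time τ, so its integral against a cutoff at scale R is, at time s,
at most a multiple of `weightedFlux` at R, which tends to 0. A negative value at z₀ would keep this
integral above a fixed positive number: the cutoffs at scale R dominate a fixed cutoff χ₀ around z₀
once R is twice its inner radius. -/
theorem IsFokkerPlanckSolution.nonneg (h : IsFokkerPlanckSolution μ e σ τ b ρτ ρ)
    (hσ : 0 < σ) (hρτ : ∀ z, 0 ≤ ρτ z) {s : ℝ} (hs : s ∈ Ioo 0 τ) (z₀ : E) : 0 ≤ ρ s z₀ := by
  by_contra! hneg
  obtain ⟨B, hB, hcut⟩ := exists_isCutoff e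
  have hτ : 0 < τ := hs.1.trans hs.2
  have cm : Continuous fun x : ℝ => max (-x) 0 := by fun_prop
  have hsI : s ∈ Ioc 0 τ := ⟨hs.1, hs.2.le⟩
  have bound : ∀ R, 1 ≤ R → ∀ χ, IsCutoff e B R χ → ∫ z, χ z * max (-ρ s z) 0 ∂μ ≤
      B * (σ * Fintype.card ι + 1) * weightedFlux μ τ b ρ R := by
    intro R hR χ hχ
    have lim := (h.tendsto_integral_mul_comp hτ hχ.contDiff.continuous hχ.hasCompactSupport
      cm).add_const (B * (σ * Fintype.card ι + 1) * weightedFlux μ τ b ρ R)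
    have h0 : ∀ z, max (-ρτ z) 0 = 0 := fun z => max_eq_right (by linarith [hρτ z])
    simp only [h0, mul_zero, integral_zero, zero_add] at lim
    refine ge_of_tendsto lim ?_
    filter_upwards [Ioo_mem_nhdsLT hs.2] with t ht
    exact h.integral_negPart_le hσ hχ.contDiff hχ.hasCompactSupport hχ.nonneg hB hR
      (hχ.abs_dirDeriv_le_scaleWeight hB hR) (hχ.abs_dirDeriv_two_le_scaleWeight hB hR) hs.1
      ht.1.le ht.2
  have hR₀ : 1 ≤ max 1 ‖z₀‖ := le_max_left _ _
  obtain ⟨χ₀, hχ₀⟩ := hcut _ hR₀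
  have pos : 0 < ∫ z, χ₀ z * max (-ρ s z) 0 ∂μ := by
    refine Continuous.integral_pos_of_hasCompactSupport_nonneg_nonzero (x := z₀)
      (hχ₀.contDiff.continuous.mul (cm.comp (h.continuous_slice hsI)))
      hχ₀.hasCompactSupport.mul_right
      (fun z => mul_nonneg (hχ₀.nonneg z) (le_max_right _ _)) ?_
    rw [hχ₀.eq_one z₀ (le_max_right _ _), one_mul, max_eq_left (by linarith)]
    linarith
  have lim := h.tendsto_weightedFlux.const_mul (B * (σ * Fintype.card ι + 1))
  rw [mul_zero] at lim
  refine absurd (ge_of_tendsto lim ?_) (not_le.2 pos)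
  filter_upwards [eventually_ge_atTop (2 * max 1 ‖z₀‖)] with R hR
  have hR1 : 1 ≤ R := by linarith
  obtain ⟨χ, hχ⟩ := hcut R hR1
  refine le_trans ?_ (bound R hR1 χ hχ)
  refine integral_mono
    (h.integrable_mul_comp hχ₀.contDiff.continuous hχ₀.hasCompactSupport cm hsI)
    (h.integrable_mul_comp hχ.contDiff.continuous hχ.hasCompactSupport cm hsI) fun z => ?_
  refine mul_le_mul_of_nonneg_right ?_ (le_max_right _ _)
  rcases le_total ‖z‖ R with hz | hz
  · rw [hχ.eq_one z hz]; exact hχ₀.le_one z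
  · rw [hχ₀.eq_zero z (hR.trans hz)]; exact hχ.nonneg z

/-- Almost monotonicity of `∫ ψ ρ`, up to the terminal time. -/
theorem IsFokkerPlanckSolution.integral_le (h : IsFokkerPlanckSolution μ e σ τ b ρτ ρ)
    (hσ : 0 < σ) {ψ : E → ℝ} (hψ : ContDiff ℝ 2 ψ) (hψc : HasCompactSupport ψ) (ψ0 : ∀ z, 0 ≤ ψ z)
    {A l : ℝ} (hA : 0 ≤ A) (hl : 1 ≤ l) (hψ1 : ∀ i z, |dirDeriv (e i) ψ z| ≤ A * scaleWeight l z)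
    (hψ2 : ∀ i z, |dirDeriv (e i) (dirDeriv (e i) ψ) z| ≤ A * scaleWeight l z)
    {s : ℝ} (hs : s ∈ Ioo 0 τ) :
    ∫ z, ψ z * ρ s z ∂μ ≤ ∫ z, ψ z * ρτ z ∂μ
        + A * (σ * Fintype.card ι + 1) * weightedFlux μ τ b ρ l := by
  have lim := (h.tendsto_integral_mul_comp (hs.1.trans hs.2) hψ.continuous hψc
    continuous_id).add_const (A * (σ * Fintype.card ι + 1) * weightedFlux μ τ b ρ l)
  refine ge_of_tendsto lim ?_
  filter_upwards [Ioo_mem_nhdsLT hs.2] with t ht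
  obtain ⟨C, -, H⟩ := h.exists_integral_comp_le hσ hψ hψc ψ0 hA hl hψ1 hψ2 hs.1 ht.1.le ht.2
  -- The identity is admissible with ε = 0, so the error `ε * C` disappears.
  have := H 0 le_rfl id (fun _ => 1) (fun _ => 0) (fun x => hasDerivAt_id x)
    (fun x => hasDerivAt_const x 1) contDiff_id contDiff_const continuous_const (by simp) (by simp)
    (by simp) (by simp)
  simpa using this

end Positivity

/-! ### Mass and first moment at infinity. -/

section Tail

variable {E : Type*} [NormedAddCommGroup E] [NormedSpace ℝ E] [FiniteDimensional ℝ E]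
  {ι : Type*} [Fintype ι]

/-- Functions of linear growth at scale `l`, with small derivatives on bounded sets. -/
theorem exists_linear_growth_function (e : Module.Basis ι ℝ E) :
    ∃ c : ℝ, 1 ≤ c ∧ ∀ l : ℝ, 1 ≤ l → ∃ ψ : E → ℝ, ContDiff ℝ 2 ψ ∧ (∀ z, 0 ≤ ψ z) ∧
      (∀ z, ψ z ≤ c * ‖z‖ * scaleWeight l z) ∧ (∀ z, ψ z ≤ c * ‖z‖ ^ 2 / l) ∧
      (∀ i z, |dirDeriv (e i) ψ z| ≤ c * scaleWeight l z) ∧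
      (∀ i z, |dirDeriv (e i) (dirDeriv (e i) ψ) z| ≤ c * scaleWeight l z) ∧
      ∀ z, c * l ≤ ‖z‖ → ‖z‖ ≤ c * ψ z := by
  classical
  let ℓ : ι → E →L[ℝ] ℝ := fun i => LinearMap.toContinuousLinearMap (e.coord i)
  have hℓ : ∀ i j, ℓ j (e i) = if i = j then 1 else 0 := fun i j => by
    simp [ℓ, Finsupp.single_apply]
  have hrepr : ∀ z, z = ∑ i, ℓ i z • e i := fun z => by simp [ℓ, e.sum_repr]
  let D : ℝ := Fintype.card ι
  let c₀ : ℝ := 1 + ∑ i, ‖ℓ i‖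
  let M : ℝ := 1 + ∑ i, ‖e i‖
  have D0 : 0 ≤ D := Nat.cast_nonneg _
  have c₀1 : 1 ≤ c₀ := by
    have : 0 ≤ ∑ i, ‖ℓ i‖ := by positivity
    simp only [c₀]; linarith
  have M1 : 1 ≤ M := by
    have : 0 ≤ ∑ i, ‖e i‖ := by positivity
    simp only [M]; linarith
  have hc₀ : ∀ i z, |ℓ i z| ≤ c₀ * ‖z‖ := fun i z => by
    have h1 : ‖ℓ i‖ ≤ c₀ := by
      have := Finset.single_le_sum (f := fun i => ‖ℓ i‖) (fun j _ => norm_nonneg _)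
        (Finset.mem_univ i)
      simp only [c₀]; linarith
    calc |ℓ i z| = ‖ℓ i z‖ := rfl
      _ ≤ ‖ℓ i‖ * ‖z‖ := (ℓ i).le_opNorm z
      _ ≤ _ := by gcongr
  have hM : ∀ z, ‖z‖ ≤ M * ∑ i, |ℓ i z| := fun z => by
    calc ‖z‖ = ‖∑ i, ℓ i z • e i‖ := by rw [← hrepr z]
      _ ≤ ∑ i, ‖ℓ i z • e i‖ := norm_sum_le _ _
      _ ≤ ∑ i, M * |ℓ i z| := Finset.sum_le_sum fun i _ => by
          rw [norm_smul, Real.norm_eq_abs, mul_comm]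
          refine mul_le_mul_of_nonneg_right ?_ (abs_nonneg _)
          have := Finset.single_le_sum (f := fun i => ‖e i‖) (fun j _ => norm_nonneg _)
            (Finset.mem_univ i)
          simp only [M]; linarith
      _ = _ := by rw [Finset.mul_sum]
  -- One constant for all the bounds: the first summand dominates Dc₀² and c₀ for the upper bounds,
  -- the second 2M and 2MD for the lower bound.
  refine ⟨(1 + D) * c₀ ^ 2 + 2 * (1 + D) * M, by nlinarith [mul_nonneg D0 (sq_nonneg c₀)], ?_⟩
  intro l hl
  have l0 : 0 < l := by linarith
  have S0 : ∀ x : ℝ, 0 < x ^ 2 + l ^ 2 := fun x => by positivity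
  have Sp : ∀ x : ℝ, 0 < √(x ^ 2 + l ^ 2) := fun x => Real.sqrt_pos.2 (S0 x)
  have Sq : ∀ x : ℝ, √(x ^ 2 + l ^ 2) ^ 2 = x ^ 2 + l ^ 2 := fun x => Real.sq_sqrt (S0 x).le
  have Sx : ∀ x : ℝ, |x| ≤ √(x ^ 2 + l ^ 2) := fun x => Real.abs_le_sqrt (by nlinarith)
  have Sl : ∀ x : ℝ, l ≤ √(x ^ 2 + l ^ 2) := fun x => Real.le_sqrt_of_sq_le (by nlinarith)
  -- `f` lies below both x²/l and |x|, and above |x| - l. Summed over the coordinates it grows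
  -- linearly, yet it is flat at scales below `l`.
  let f : ℝ → ℝ := fun x => √(x ^ 2 + l ^ 2) - l
  have f0 : ∀ x, 0 ≤ f x := fun x => by have := Sl x; simp only [f]; linarith
  have f1 : ∀ x, f x ≤ |x| := fun x => by
    have : √(x ^ 2 + l ^ 2) ≤ |x| + l := by
      refine Real.sqrt_le_iff.2 ⟨by positivity, ?_⟩
      have := abs_nonneg x
      nlinarith [sq_abs x]
    simp only [f]; linarith
  have f2 : ∀ x, f x ≤ x ^ 2 / l := fun x => by
    rw [le_div_iff₀ l0]
    have h1 := Sq x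
    have h2 := Sl x
    simp only [f]
    nlinarith
  have f3 : ∀ x, |x| - l ≤ f x := fun x => by have := Sx x; simp only [f]; linarith
  have f' : ∀ x, HasDerivAt f (x / √(x ^ 2 + l ^ 2)) x := fun x =>
    (hasDerivAt_sqrt_sq_add_sq l0 x).sub_const l
  have f'1 : ∀ x, |x / √(x ^ 2 + l ^ 2)| ≤ min 1 (|x| / l) := fun x => by
    rw [abs_div, abs_of_pos (Sp x)]
    refine le_min ?_ ?_
    · rw [div_le_one (Sp x)]; exact Sx x
    · exact div_le_div_of_nonneg_left (abs_nonneg x) l0 (Sl x)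
  have f''1 : ∀ x, |l ^ 2 / √(x ^ 2 + l ^ 2) ^ 3| ≤ 1 / l := fun x => by
    have h1 := Sp x
    rw [abs_of_nonneg (by positivity), div_le_div_iff₀ (by positivity) l0, one_mul]
    calc l ^ 2 * l = l ^ 3 := by ring
      _ ≤ _ := by gcongr; exact Sl x
  have wle : ∀ i z, min 1 (|ℓ i z| / l) ≤ c₀ * scaleWeight l z := fun i z => by
    have h1 : |ℓ i z| / l ≤ c₀ * (‖z‖ / l) := by
      rw [← mul_div_assoc]
      exact div_le_div_of_nonneg_right (hc₀ i z) l0.le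
    have h2 : min 1 (|ℓ i z| / l) ≤ c₀ * min 1 (‖z‖ / l) := by
      rw [mul_min_of_nonneg _ _ (by linarith)]
      exact min_le_min (by linarith) h1
    refine h2.trans (mul_le_mul_of_nonneg_left ?_ (by linarith))
    have : 0 < 1 / l := by positivity
    unfold scaleWeight; linarith
  have cf : ContDiff ℝ 2 f := (contDiff_sqrt_sq_add_sq l0).sub contDiff_const
  let ψ : E → ℝ := fun z => ∑ i, f (ℓ i z)
  have cψ : ContDiff ℝ 2 ψ := ContDiff.sum fun i _ => cf.comp (ℓ i).contDiff
  have lineℓ : ∀ i j z, HasLineDerivAt ℝ (ℓ j) (if i = j then (1 : ℝ) else 0) z (e i) :=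
    fun i j z => by
      rw [← hℓ i j]
      exact (ℓ j).hasFDerivAt.hasLineDerivAt (e i)
  have d1 : ∀ i, dirDeriv (e i) ψ = fun z => ℓ i z / √(ℓ i z ^ 2 + l ^ 2) := fun i => by
    ext z
    have h1 : HasLineDerivAt ℝ ψ (∑ j, (ℓ j z / √(ℓ j z ^ 2 + l ^ 2)) *
        (if i = j then (1 : ℝ) else 0)) z (e i) :=
      HasLineDerivAt.fun_sum fun j _ => (lineℓ i j z).real_comp (f' _)
    rw [h1.dirDeriv_eq (cψ.differentiable (by norm_num) z)]
    simp
  have d2 : ∀ i z, dirDeriv (e i) (dirDeriv (e i) ψ) z = l ^ 2 / √(ℓ i z ^ 2 + l ^ 2) ^ 3 :=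
    fun i z => by
      have h1 := (lineℓ i i z).real_comp (hasDerivAt_div_sqrt_sq_add_sq l0 (ℓ i z))
      have h2 : DifferentiableAt ℝ (fun z => ℓ i z / √(ℓ i z ^ 2 + l ^ 2)) z := by
        rw [← d1]
        exact (cψ.dirDeriv (m := 1) (by norm_num) (e i)).differentiable (by norm_num) z
      rw [d1, h1.dirDeriv_eq h2]
      simp
  have hw : ∀ z : E, 0 ≤ scaleWeight l z := scaleWeight_nonneg l0
  set C : ℝ := (1 + D) * c₀ ^ 2 + 2 * (1 + D) * M with hC
  have hDM : 0 ≤ 2 * (1 + D) * M := by positivity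
  have hDc : 0 ≤ D * c₀ ^ 2 := by positivity
  have C1 : D * c₀ ^ 2 ≤ C := by nlinarith
  have C2 : c₀ ≤ C := by nlinarith
  have C3 : 1 ≤ C := c₀1.trans C2
  have C4 : 2 * M ≤ C := by nlinarith [mul_nonneg D0 (by linarith : (0:ℝ) ≤ M)]
  have C5 : 2 * M * D ≤ C := by nlinarith
  refine ⟨ψ, cψ, fun z => Finset.sum_nonneg fun i _ => f0 _, fun z => ?_, fun z => ?_,
    fun i z => ?_, fun i z => ?_, fun z hz => ?_⟩
  · have h1 : ∀ i, f (ℓ i z) ≤ c₀ ^ 2 * ‖z‖ * scaleWeight l z := fun i => by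
      have h2 : f (ℓ i z) ≤ |ℓ i z| * min 1 (|ℓ i z| / l) := by
        rw [mul_min_of_nonneg _ _ (abs_nonneg _)]
        refine le_min (by simpa using f1 _) ((f2 _).trans_eq ?_)
        rw [← sq_abs]; ring
      calc _ ≤ |ℓ i z| * min 1 (|ℓ i z| / l) := h2
        _ ≤ (c₀ * ‖z‖) * (c₀ * scaleWeight l z) :=
          mul_le_mul (hc₀ i z) (wle i z) (by positivity) (by positivity)
        _ = _ := by ring
    calc ψ z ≤ ∑ _i : ι, c₀ ^ 2 * ‖z‖ * scaleWeight l z := Finset.sum_le_sum fun i _ => h1 i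
      _ = (D * c₀ ^ 2) * (‖z‖ * scaleWeight l z) := by
        simp only [Finset.sum_const, Finset.card_univ, nsmul_eq_mul, D]; ring
      _ ≤ C * (‖z‖ * scaleWeight l z) :=
        mul_le_mul_of_nonneg_right C1 (mul_nonneg (norm_nonneg _) (hw z))
      _ = _ := by ring
  · have h1 : ∀ i, f (ℓ i z) ≤ c₀ ^ 2 * ‖z‖ ^ 2 / l := fun i => by
      refine (f2 _).trans (div_le_div_of_nonneg_right ?_ l0.le)
      rw [← sq_abs, ← mul_pow]
      exact pow_le_pow_left₀ (abs_nonneg _) (hc₀ i z) 2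
    calc ψ z ≤ ∑ _i : ι, c₀ ^ 2 * ‖z‖ ^ 2 / l := Finset.sum_le_sum fun i _ => h1 i
      _ = (D * c₀ ^ 2) * (‖z‖ ^ 2 / l) := by
        simp only [Finset.sum_const, Finset.card_univ, nsmul_eq_mul, D]; ring
      _ ≤ C * (‖z‖ ^ 2 / l) := mul_le_mul_of_nonneg_right C1 (by positivity)
      _ = _ := by ring
  · rw [d1]
    exact ((f'1 _).trans (wle i z)).trans (mul_le_mul_of_nonneg_right C2 (hw z))
  · rw [d2]
    refine (f''1 _).trans ((one_div_le_scaleWeight l0 z).trans ?_)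
    exact le_mul_of_one_le_left (hw z) C3
  · have h1 : ∑ i, |ℓ i z| - D * l ≤ ψ z := by
      have : ∑ i, (|ℓ i z| - l) ≤ ψ z := Finset.sum_le_sum fun i _ => f3 _
      simpa [D] using this
    have hψ0 : 0 ≤ ψ z := Finset.sum_nonneg fun i _ => f0 _
    have h2 := hM z
    have h3 : M * (∑ i, |ℓ i z| - D * l) ≤ M * ψ z := mul_le_mul_of_nonneg_left h1 (by linarith)
    have h4 : 2 * M * D * l ≤ C * l := mul_le_mul_of_nonneg_right C5 l0.le
    have h5 : 2 * M * ψ z ≤ C * ψ z := mul_le_mul_of_nonneg_right C4 hψ0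
    -- ‖z‖ ≤ Mψ + MDl ≤ (C/2)ψ + (C/2)l, and the last term is at most ‖z‖/2, hence is absorbed.
    nlinarith

variable [MeasurableSpace E] [BorelSpace E] {μ : Measure E} [μ.IsAddHaarMeasure]
  {e : Module.Basis ι ℝ E} {σ τ : ℝ} {b : ι → ℝ → E → ℝ} {ρτ : E → ℝ} {ρ : ℝ → E → ℝ}

/-- The mass of `ρ(s)` is essentially at most that of `ρτ`. -/
theorem IsFokkerPlanckSolution.eventually_mass_le (h : IsFokkerPlanckSolution μ e σ τ b ρτ ρ)
    (hσ : 0 < σ) (hτ : 0 < τ) (hρτ : ∀ z, 0 ≤ ρτ z) (hc : HasCompactSupport ρτ)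
    (h1 : ∫ z, ρτ z ∂μ ≤ 1)
    {B : ℝ} (hB : 0 ≤ B) :
    ∀ᶠ R in atTop, ∀ χ, IsCutoff e B R χ → ∀ s ∈ Ioo 0 τ, ∫ z, χ z * ρ s z ∂μ ≤ 2 := by
  have cρτ : Continuous ρτ := by
    have := h.continuous_slice (right_mem_Ioc.2 hτ)
    rwa [h.terminal] at this
  have iρτ : Integrable ρτ μ := cρτ.integrable_of_hasCompactSupport hc
  have lim := h.tendsto_weightedFlux.const_mul (B * (σ * Fintype.card ι + 1))
  rw [mul_zero] at lim
  -- The bound 2 is 1 for the terminal mass plus 1 for the cutoff error; the threshold on R does not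
  -- depend on s.
  filter_upwards [lim.eventually_lt_const one_pos, eventually_ge_atTop (1 : ℝ)] with R hR hR1
    χ hχ s hs
  have := h.integral_le hσ hχ.contDiff hχ.hasCompactSupport hχ.nonneg hB hR1
      (hχ.abs_dirDeriv_le_scaleWeight hB hR1) (hχ.abs_dirDeriv_two_le_scaleWeight hB hR1) hs
  have h2 : ∫ z, χ z * ρτ z ∂μ ≤ ∫ z, ρτ z ∂μ :=
    integral_mono ((hχ.contDiff.continuous.mul cρτ).integrable_of_hasCompactSupport
      hχ.hasCompactSupport.mul_right) iρτ fun z => mul_le_of_le_one_left (hρτ z) (hχ.le_one z)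
  linarith

/-- The first moment of `ρ(s)` is tight, uniformly in `s`. -/
theorem IsFokkerPlanckSolution.exists_tail_le (h : IsFokkerPlanckSolution μ e σ τ b ρτ ρ)
    (hσ : 0 < σ) (hτ : 0 < τ) (hρτ : ∀ z, 0 ≤ ρτ z) (hc : HasCompactSupport ρτ)
    {B : ℝ} (hB : 0 ≤ B) {δ : ℝ} (hδ : 0 < δ) :
    ∃ L : ℝ, 1 ≤ L ∧ ∃ Θ : E → ℝ, Continuous Θ ∧ (∀ z, 0 ≤ Θ z) ∧ (∀ z, L ≤ ‖z‖ → ‖z‖ ≤ Θ z) ∧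
      ∀ R, L ≤ R → ∀ χ, IsCutoff e B R χ → ∀ s ∈ Ioo 0 τ, ∫ z, χ z * Θ z * ρ s z ∂μ ≤ δ := by
  obtain ⟨c, hc1, H⟩ := exists_linear_growth_function e
  have cρτ : Continuous ρτ := by
    have := h.continuous_slice (right_mem_Ioc.2 hτ)
    rwa [h.terminal] at this
  -- The three summands bound the three terms of the second derivative of χψ, uniformly in R.
  let A : ℝ := 2 * B * c + 2 * B * c + c
  have hA : 0 ≤ A := by positivity
  -- The terminal term decays because ψ ≤ c‖z‖²/l and ρτ has compact support. The scale `l` is fixed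
  -- here, before `R`.
  have lim : Tendsto (fun l : ℝ => c * (c * (∫ z, ‖z‖ ^ 2 * ρτ z ∂μ) / l
      + A * (σ * Fintype.card ι + 1) * weightedFlux μ τ b ρ l)) atTop (𝓝 (c * (0 +
      A * (σ * Fintype.card ι + 1) * 0))) :=
    ((tendsto_const_nhds.div_atTop tendsto_id).add
      (h.tendsto_weightedFlux.const_mul _)).const_mul _
  simp only [mul_zero, add_zero] at lim
  obtain ⟨l, hl, hl1⟩ := ((lim.eventually_lt_const hδ).and (eventually_ge_atTop (1 : ℝ))).exists
  obtain ⟨ψ, cψ, ψ0, ψ1, ψ2, ψ3, ψ4, ψ5⟩ := H l hl1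
  have l0 : 0 < l := by linarith
  have hcl : l ≤ c * l := le_mul_of_one_le_left l0.le hc1
  refine ⟨c * l, hl1.trans hcl, fun z => c * ψ z, continuous_const.mul cψ.continuous,
    fun z => mul_nonneg (by linarith) (ψ0 z), ψ5, fun R hR χ hχ s hs => ?_⟩
  have hR1 : 1 ≤ R := by linarith
  have hR0 : 0 < R := by linarith
  have far : ∀ z, 2 * R < ‖z‖ → z ∉ tsupport χ := fun z hz hz' => by
    have : tsupport χ ⊆ Metric.closedBall 0 (2 * R) := closure_minimal (fun y hy => by
      by_contra h'
      simp only [mem_closedBall_zero_iff, not_le] at h'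
      exact hy (hχ.eq_zero y h'.le)) Metric.isClosed_closedBall
    have := this hz'
    simp only [mem_closedBall_zero_iff] at this
    linarith
  have hw : ∀ z : E, 0 ≤ scaleWeight l z := scaleWeight_nonneg l0
  have cd : ∀ {f : E → ℝ} (_ : ContDiff ℝ 2 f) i z,
      HasLineDerivAt ℝ f (dirDeriv (e i) f z) z (e i) := fun hf i z =>
    (hf.differentiable (by norm_num) z).hasLineDerivAt_dirDeriv _
  have cd' : ∀ {f : E → ℝ} (_ : ContDiff ℝ 2 f) i, ContDiff ℝ 1 (dirDeriv (e i) f) :=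
    fun hf i => hf.dirDeriv (by norm_num) _
  have cd'' : ∀ {f : E → ℝ} (_ : ContDiff ℝ 2 f) i z, HasLineDerivAt ℝ (dirDeriv (e i) f)
      (dirDeriv (e i) (dirDeriv (e i) f) z) z (e i) := fun hf i z =>
    ((cd' hf i).differentiable (by norm_num) z).hasLineDerivAt_dirDeriv _
  have hθ : ContDiff ℝ 2 fun z => χ z * ψ z := hχ.contDiff.mul cψ
  have d1 : ∀ i, dirDeriv (e i) (fun z => χ z * ψ z) =
      fun z => dirDeriv (e i) χ z * ψ z + χ z * dirDeriv (e i) ψ z := fun i => by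
    ext z
    exact ((cd hχ.contDiff i z).fun_mul (cd cψ i z)).dirDeriv_eq (hθ.differentiable (by norm_num) z)
  have d2 : ∀ i z, dirDeriv (e i) (dirDeriv (e i) (fun z => χ z * ψ z)) z =
      dirDeriv (e i) (dirDeriv (e i) χ) z * ψ z + 2 * (dirDeriv (e i) χ z * dirDeriv (e i) ψ z)
        + χ z * dirDeriv (e i) (dirDeriv (e i) ψ) z := fun i z => by
    have hd : DifferentiableAt ℝ
        (fun z => dirDeriv (e i) χ z * ψ z + χ z * dirDeriv (e i) ψ z) z := by
      rw [← d1]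
      exact (cd' hθ i).differentiable (by norm_num) z
    rw [d1, (((cd'' hχ.contDiff i z).fun_mul (cd cψ i z)).fun_add
      ((cd hχ.contDiff i z).fun_mul (cd'' cψ i z))).dirDeriv_eq hd]
    ring
  -- The growth of ψ, at most 2cR times the weight on the support of χ, cancels the factor 1/R of
  -- the cutoff derivative and leaves the weight.
  have hχψ : ∀ z, ‖z‖ ≤ 2 * R → ∀ x, |x| ≤ B / R → |x * ψ z| ≤ 2 * B * c * scaleWeight l z := by
    intro z hz x hx
    rw [abs_mul, abs_of_nonneg (ψ0 z)]
    calc |x| * ψ z ≤ B / R * (c * (2 * R) * scaleWeight l z) := by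
          refine mul_le_mul hx ((ψ1 z).trans ?_) (ψ0 z) (by positivity)
          have := hw z
          gcongr
      _ = _ := by field_simp
  have hBR : B / R ≤ B := div_le_self hB hR1
  have hBR2 : B / R ^ 2 ≤ B / R := div_le_div_of_nonneg_left hB hR0 (by nlinarith)
  have t1 : ∀ i z, |dirDeriv (e i) (fun z => χ z * ψ z) z| ≤ A * scaleWeight l z := by
    intro i z
    have hwz := hw z
    rw [d1]
    beta_reduce
    have h2 : |χ z * dirDeriv (e i) ψ z| ≤ 1 * (c * scaleWeight l z) := by
      rw [abs_mul, abs_of_nonneg (hχ.nonneg z)]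
      exact mul_le_mul (hχ.le_one z) (ψ3 i z) (abs_nonneg _) zero_le_one
    have h3 : 0 ≤ 2 * B * c * scaleWeight l z := by positivity
    have h1 : |dirDeriv (e i) χ z * ψ z| ≤ 2 * B * c * scaleWeight l z := by
      rcases le_or_gt ‖z‖ (2 * R) with hz | hz
      · exact hχψ z hz _ (hχ.abs_dirDeriv_le i z)
      · rw [dirDeriv_eq_zero_of_notMem_tsupport (far z hz)]
        simpa using h3
    refine (abs_add_le _ _).trans ?_
    simp only [A]
    linarith
  have t2 : ∀ i z, |dirDeriv (e i) (dirDeriv (e i) (fun z => χ z * ψ z)) z| ≤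
      A * scaleWeight l z := by
    intro i z
    have hwz := hw z
    rw [d2]
    have h2 : |χ z * dirDeriv (e i) (dirDeriv (e i) ψ) z| ≤ 1 * (c * scaleWeight l z) := by
      rw [abs_mul, abs_of_nonneg (hχ.nonneg z)]
      exact mul_le_mul (hχ.le_one z) (ψ4 i z) (abs_nonneg _) zero_le_one
    have h3 : 0 ≤ 2 * B * c * scaleWeight l z := by positivity
    have h1 : |dirDeriv (e i) (dirDeriv (e i) χ) z * ψ z| ≤ 2 * B * c * scaleWeight l z := by
      rcases le_or_gt ‖z‖ (2 * R) with hz | hz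
      · exact hχψ z hz _ ((hχ.abs_dirDeriv_two_le i z).trans hBR2)
      · rw [dirDeriv_dirDeriv_eq_zero_of_notMem_tsupport (far z hz)]
        simpa using h3
    have h4 : |2 * (dirDeriv (e i) χ z * dirDeriv (e i) ψ z)| ≤ 2 * (B * (c * scaleWeight l z)) := by
      rw [abs_mul, abs_mul, abs_two]
      refine mul_le_mul_of_nonneg_left ?_ zero_le_two
      exact mul_le_mul ((hχ.abs_dirDeriv_le i z).trans hBR) (ψ3 i z) (abs_nonneg _) hB
    refine (abs_add_le _ _).trans ((add_le_add_left (abs_add_le _ _) _).trans ?_)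
    simp only [A]
    linarith
  have key := h.integral_le hσ hθ (hχ.hasCompactSupport.mul_right)
    (fun z => mul_nonneg (hχ.nonneg z) (ψ0 z)) hA hl1 t1 t2 hs
  have term : ∫ z, χ z * ψ z * ρτ z ∂μ ≤ c * (∫ z, ‖z‖ ^ 2 * ρτ z ∂μ) / l := by
    have : c * (∫ z, ‖z‖ ^ 2 * ρτ z ∂μ) / l = ∫ z, c / l * (‖z‖ ^ 2 * ρτ z) ∂μ := by
      rw [integral_const_mul]; ring
    rw [this]
    refine integral_mono ((hθ.continuous.mul cρτ).integrable_of_hasCompactSupport hc.mul_left)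
      ((((continuous_norm.pow 2).mul cρτ).integrable_of_hasCompactSupport hc.mul_left).const_mul _)
      fun z => ?_
    calc χ z * ψ z * ρτ z ≤ (1 * (c * ‖z‖ ^ 2 / l)) * ρτ z :=
          mul_le_mul_of_nonneg_right (mul_le_mul (hχ.le_one z) (ψ2 z) (ψ0 z) zero_le_one) (hρτ z)
      _ = _ := by ring
  have e1 : ∫ z, χ z * (c * ψ z) * ρ s z ∂μ = c * ∫ z, χ z * ψ z * ρ s z ∂μ := by
    rw [← integral_const_mul]
    exact integral_congr_ae (Eventually.of_forall fun z => by ring)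
  rw [e1]
  refine (mul_le_mul_of_nonneg_left (key.trans (add_le_add_left term _)) (by linarith)).trans hl.le

end Tail

/-! ### The upper bound on u and its behaviour near the initial time. -/

section MaximumPrinciple

/-- If a > 0, the second derivative test makes x a local minimum too, so f is constant near x and a
= 0. -/
theorem IsLocalMax.second_deriv_nonpos {f f' : ℝ → ℝ} {x a : ℝ} (h : IsLocalMax f x)
    (hf : ∀ r, HasDerivAt f (f' r) r) (hf' : HasDerivAt f' a x) : a ≤ 0 := by
  by_contra! ha
  have e1 : deriv f = f' := funext fun r => (hf r).deriv
  have hmin : IsLocalMin f x := isLocalMin_of_deriv_deriv_pos (by rwa [e1, hf'.deriv])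
    h.deriv_eq_zero (hf x).continuousAt
  have hconst : f =ᶠ[𝓝 x] fun _ => f x := by
    filter_upwards [h, hmin] with r h1 h2 using le_antisymm h1 h2
  have h0 := hconst.deriv.deriv_eq
  rw [e1, hf'.deriv] at h0
  simp at h0
  linarith

/-- One-sided because, in the maximum principle, the maximum may sit at the final time, where only
earlier times are available for comparison. -/
theorem HasDerivAt.nonneg_of_forall_le_left {f : ℝ → ℝ} {s x a : ℝ} (hf : HasDerivAt f a x)
    (hs : s < x) (h : ∀ r ∈ Ioo s x, f r ≤ f x) : 0 ≤ a := by
  have h1 : Tendsto (slope f x) (𝓝[<] x) (𝓝 a) :=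
    (hasDerivAt_iff_tendsto_slope.1 hf).mono_left
      (nhdsWithin_mono _ fun y (hy : y < x) => hy.ne)
  refine ge_of_tendsto h1 ?_
  filter_upwards [Ioo_mem_nhdsLT hs] with r hr
  rw [slope_def_field]
  exact div_nonneg_of_nonpos (by linarith [h r hr]) (by linarith [hr.2])

variable {E : Type*} [NormedAddCommGroup E] [NormedSpace ℝ E] {ι : Type*} [Fintype ι]

/-- A classical solution, of at most linear growth, of `∂ₜu - σ Δu + h = 0`, `u(0) = u₀`, on
`[0, T] × E`, in the coordinates given by the vectors `e i`. -/
structure IsViscousSolution (e : ι → E) (σ T : ℝ) (h : ℝ → E → ℝ) (u₀ : E → ℝ)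
    (u : ℝ → E → ℝ) : Prop where
  regular : IsSpaceTimeC12 u (Ioo 0 T)
  continuousOn : ContinuousOn (Function.uncurry u) (Icc 0 T ×ˢ univ)
  growth : ∃ K : ℝ, ∀ t ∈ Icc 0 T, ∀ z, |u t z| ≤ K * (1 + ‖z‖)
  equation : ∀ t ∈ Ioo 0 T, ∀ z, deriv (fun s => u s z) t
    = σ * ∑ i, dirDeriv (e i) (dirDeriv (e i) (u t)) z - h t z
  initial : ∀ z, u 0 z = u₀ z

/-- A positive definite quadratic function with constant second derivatives. -/
theorem exists_quadratic_function [FiniteDimensional ℝ E] (e : Module.Basis ι ℝ E) :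
    ∃ c : ℝ, 0 < c ∧ ∃ q : E → ℝ, ContDiff ℝ 2 q ∧ (∀ z, c * ‖z‖ ^ 2 ≤ q z) ∧
      ∀ i z, dirDeriv (e i) (dirDeriv (e i) q) z = 2 := by
  classical
  let ℓ : ι → E →L[ℝ] ℝ := fun i => LinearMap.toContinuousLinearMap (e.coord i)
  have hℓ : ∀ i j, ℓ j (e i) = if i = j then 1 else 0 := fun i j => by
    simp [ℓ, Finsupp.single_apply]
  have hrepr : ∀ z, z = ∑ i, ℓ i z • e i := fun z => by simp [ℓ, e.sum_repr]
  let S : ℝ := 1 + ∑ i, ‖e i‖ ^ 2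
  have hS : 0 < S := by
    have : 0 ≤ ∑ i, ‖e i‖ ^ 2 := by positivity
    simp only [S]; linarith
  let q : E → ℝ := fun z => ∑ i, ℓ i z ^ 2
  have cq : ContDiff ℝ 2 q := ContDiff.sum fun i _ => (ℓ i).contDiff.pow 2
  have lineℓ : ∀ i j z, HasLineDerivAt ℝ (ℓ j) (if i = j then (1 : ℝ) else 0) z (e i) :=
    fun i j z => by
      rw [← hℓ i j]
      exact (ℓ j).hasFDerivAt.hasLineDerivAt (e i)
  have d1 : ∀ i, dirDeriv (e i) q = fun z => 2 * ℓ i z := fun i => by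
    ext z
    have h1 : HasLineDerivAt ℝ q (∑ j, (2 * ℓ j z) * (if i = j then (1 : ℝ) else 0)) z (e i) :=
      HasLineDerivAt.fun_sum fun j _ => HasLineDerivAt.real_comp (φ := fun x => x ^ 2)
        (by simpa using hasDerivAt_pow 2 (ℓ j z)) (lineℓ i j z)
    rw [h1.dirDeriv_eq (cq.differentiable (by norm_num) z)]
    simp
  refine ⟨S⁻¹, inv_pos.2 hS, q, cq, fun z => ?_, fun i z => ?_⟩
  · rw [inv_mul_le_iff₀ hS]
    have h1 : ‖z‖ ≤ ∑ i, |ℓ i z| * ‖e i‖ := by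
      calc ‖z‖ = ‖∑ i, ℓ i z • e i‖ := by rw [← hrepr z]
        _ ≤ ∑ i, ‖ℓ i z • e i‖ := norm_sum_le _ _
        _ = _ := by simp [norm_smul]
    have h2 := Finset.sum_mul_sq_le_sq_mul_sq Finset.univ (fun i => |ℓ i z|) (fun i => ‖e i‖)
    have h3 : ‖z‖ ^ 2 ≤ (∑ i, |ℓ i z| * ‖e i‖) ^ 2 := pow_le_pow_left₀ (norm_nonneg _) h1 2
    simp only [sq_abs] at h2
    have h4 : 0 ≤ q z := Finset.sum_nonneg fun i _ => sq_nonneg _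
    calc ‖z‖ ^ 2 ≤ q z * ∑ i, ‖e i‖ ^ 2 := h3.trans h2
      _ ≤ S * q z := by simp only [S]; nlinarith
  · rw [d1, ((lineℓ i i z).const_mul 2).dirDeriv_eq (by fun_prop)]
    simp

/-- The nonlinearity is frozen into a source `h`, of which only the sign matters, so no gradient
bound is needed. The barrier M + ε(q + κt) beats linear growth, hence a violation is attained on a
compact set, at an interior point in space and a positive time. There ∂ₜu ≥ εκ, whereas the equation
gives ∂ₜu ≤ σΔu ≤ ε(κ - 1). -/
theorem IsViscousSolution.le_of_initial_le [FiniteDimensional ℝ E] {e : Module.Basis ι ℝ E}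
    {σ T : ℝ} {h : ℝ → E → ℝ} {u₀ : E → ℝ} {u : ℝ → E → ℝ} (hu : IsViscousSolution e σ T h u₀ u)
    (hσ : 0 < σ) (h0 : ∀ t ∈ Ioo 0 T, ∀ z, 0 ≤ h t z) {M : ℝ} (hM : ∀ z, u₀ z ≤ M)
    {t₁ : ℝ} (ht₁ : t₁ ∈ Ioo 0 T) (z₁ : E) : u t₁ z₁ ≤ M := by
  obtain ⟨c, hc, q, cq, hq, hq2⟩ := exists_quadratic_function e
  obtain ⟨K, hK⟩ := hu.growth
  -- σ times the Laplacian of `q`, plus one to make the comparison strict.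
  let κ : ℝ := 2 * σ * Fintype.card ι + 1
  have hκ : 0 < κ := by positivity
  have key : ∀ ε > 0, u t₁ z₁ ≤ M + ε * (q z₁ + κ * t₁) := by
    intro ε hε
    by_contra! hlt
    let w : ℝ → E → ℝ := fun t z => u t z - ε * (q z + κ * t)
    have hqz : ∀ z, 0 ≤ q z := fun z => le_trans (by positivity) (hq z)
    have hfar : ∀ᶠ r : ℝ in atTop, K * (1 + r) - ε * (c * r ^ 2) < M := by
      have h1 : Tendsto (fun r : ℝ => r * (ε * c * r - K)) atTop atTop :=
        tendsto_id.atTop_mul_atTop₀ (tendsto_atTop_add_const_right _ (-K)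
          (tendsto_id.const_mul_atTop (by positivity : 0 < ε * c)))
      filter_upwards [h1.eventually_gt_atTop (K - M)] with r hr
      nlinarith
    obtain ⟨R, hR⟩ := eventually_atTop.1 hfar
    let R' := max R ‖z₁‖
    have hcompact : IsCompact (Icc 0 t₁ ×ˢ Metric.closedBall (0 : E) R') :=
      isCompact_Icc.prod (isCompact_closedBall _ _)
    have cw : ContinuousOn (Function.uncurry w) (Icc 0 t₁ ×ˢ Metric.closedBall (0 : E) R') := by
      refine ContinuousOn.sub (hu.continuousOn.mono ?_) (Continuous.continuousOn ?_)
      · exact prod_mono (Icc_subset_Icc_right ht₁.2.le) (subset_univ _)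
      · have := cq.continuous
        fun_prop
    have hmem : (t₁, z₁) ∈ Icc 0 t₁ ×ˢ Metric.closedBall (0 : E) R' :=
      ⟨⟨ht₁.1.le, le_rfl⟩, by simp [R']⟩
    obtain ⟨⟨t₀, z₀⟩, ⟨ht₀, hz₀⟩, hmax⟩ := hcompact.exists_isMaxOn ⟨_, hmem⟩ cw
    have hgt : M < w t₀ z₀ := by
      have h1 : w t₁ z₁ ≤ w t₀ z₀ := hmax hmem
      have h2 : M < w t₁ z₁ := by simp only [w]; linarith
      linarith
    simp only at ht₀ hz₀
    have ht₀T : t₀ ∈ Icc 0 T := ⟨ht₀.1, ht₀.2.trans ht₁.2.le⟩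
    have hz₀R : ‖z₀‖ < R' := by
      by_contra! hge
      have h1 := hR ‖z₀‖ ((le_max_left _ _).trans hge)
      have h2 := (le_abs_self _).trans (hK t₀ ht₀T z₀)
      have h3 : ε * (c * ‖z₀‖ ^ 2) ≤ ε * (q z₀ + κ * t₀) := by
        have := hq z₀
        have : 0 ≤ κ * t₀ := mul_nonneg hκ.le ht₀.1
        exact mul_le_mul_of_nonneg_left (by linarith) hε.le
      simp only [w] at hgt
      linarith
    have ht₀pos : 0 < t₀ := by
      rcases ht₀.1.eq_or_lt with h1 | h1
      · exfalso
        have h2 := hu.initial z₀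
        have h3 := hM z₀
        have h4 : 0 ≤ ε * (q z₀ + κ * t₀) := by
          have := hqz z₀
          have := ht₀.1
          positivity
        simp only [w, ← h1] at hgt h4
        linarith
      · exact h1
    have ht₀I : t₀ ∈ Ioo 0 T := ⟨ht₀pos, ht₀.2.trans_lt ht₁.2⟩
    have htime : 0 ≤ deriv (fun s => u s z₀) t₀ - ε * κ := by
      have hd : HasDerivAt (fun s => w s z₀) (deriv (fun s => u s z₀) t₀ - ε * (κ * 1)) t₀ :=
        (hu.regular.differentiable_time t₀ ht₀I z₀).hasDerivAt.sub
          ((((hasDerivAt_id t₀).const_mul κ).const_add (q z₀)).const_mul ε)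
      rw [mul_one] at hd
      exact hd.nonneg_of_forall_le_left ht₀pos fun r hr =>
        hmax (a := (r, z₀)) ⟨⟨hr.1.le, hr.2.le.trans ht₀.2⟩, hz₀⟩
    have cu := hu.regular.contDiff_space t₀ ht₀I
    have hspace : ∀ i, dirDeriv (e i) (dirDeriv (e i) (u t₀)) z₀ ≤ 2 * ε := by
      intro i
      let g : E → ℝ := fun z => u t₀ z - ε * (q z + κ * t₀)
      have cg : ContDiff ℝ 2 g :=
        cu.sub (contDiff_const.mul (cq.add contDiff_const))
      have ld : ∀ {f : E → ℝ} (_ : ContDiff ℝ 1 f) z,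
          HasLineDerivAt ℝ f (dirDeriv (e i) f z) z (e i) := fun hf z =>
        (hf.differentiable (by norm_num) z).hasLineDerivAt_dirDeriv _
      have c1 : ∀ {f : E → ℝ} (_ : ContDiff ℝ 2 f), ContDiff ℝ 1 (dirDeriv (e i) f) :=
        fun hf => hf.dirDeriv (by norm_num) _
      have dg : dirDeriv (e i) g = fun z => dirDeriv (e i) (u t₀) z - ε * dirDeriv (e i) q z := by
        ext z
        have hconst : HasLineDerivAt ℝ (fun _ : E => κ * t₀) 0 z (e i) := hasDerivAt_const _ _
        rw [((ld (cu.of_le (by norm_num)) z).fun_sub (((ld (cq.of_le (by norm_num)) z).fun_add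
          hconst).const_mul ε)).dirDeriv_eq (cg.differentiable (by norm_num) z), add_zero]
      have d2g : dirDeriv (e i) (dirDeriv (e i) g) z₀ =
          dirDeriv (e i) (dirDeriv (e i) (u t₀)) z₀ - ε * 2 := by
        have hd : DifferentiableAt ℝ
            (fun z => dirDeriv (e i) (u t₀) z - ε * dirDeriv (e i) q z) z₀ := by
          rw [← dg]; exact (c1 cg).differentiable (by norm_num) z₀
        rw [dg, ((ld (c1 cu) z₀).fun_sub ((ld (c1 cq) z₀).const_mul ε)).dirDeriv_eq hd, hq2]
      have hline : ∀ {f : E → ℝ} (_ : ContDiff ℝ 1 f) (r : ℝ),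
          HasDerivAt (fun r : ℝ => f (z₀ + r • e i)) (dirDeriv (e i) f (z₀ + r • e i)) r := by
        intro f hf r
        have h1 := (hf.differentiable (by norm_num) (z₀ + r • e i)).hasFDerivAt
        have h2 : HasDerivAt (fun r : ℝ => z₀ + r • e i) (e i) r := by
          simpa using ((hasDerivAt_id r).smul_const (e i)).const_add z₀
        exact h1.comp_hasDerivAt r h2
      have hloc : IsLocalMax (fun r : ℝ => g (z₀ + r • e i)) 0 := by
        have hcont : ContinuousAt (fun r : ℝ => z₀ + r • e i) 0 := by fun_prop
        have hnear : ∀ᶠ r : ℝ in 𝓝 0, ‖z₀ + r • e i‖ < R' :=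
          hcont.norm.eventually_lt_const (by simpa using hz₀R)
        filter_upwards [hnear] with r hr
        have h1 : w t₀ (z₀ + r • e i) ≤ w t₀ z₀ :=
          hmax (a := (t₀, z₀ + r • e i)) ⟨ht₀, by simpa using hr.le⟩
        simpa [g, w] using h1
      have h2 := hline (c1 cg) 0
      simp only [zero_smul, add_zero] at h2
      have := hloc.second_deriv_nonpos (hline (cg.of_le (by norm_num))) h2
      linarith
    have heq := hu.equation t₀ ht₀I z₀
    have hsum : ∑ i, dirDeriv (e i) (dirDeriv (e i) (u t₀)) z₀ ≤ Fintype.card ι * (2 * ε) := by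
      have := Finset.sum_le_sum fun i (_ : i ∈ Finset.univ) => hspace i
      simpa using this
    have h1 := mul_le_mul_of_nonneg_left hsum hσ.le
    have h2 := h0 t₀ ht₀I z₀
    have h3 : ε * κ = σ * (Fintype.card ι * (2 * ε)) + ε := by simp only [κ]; ring
    linarith
  have lim : Tendsto (fun ε : ℝ => M + ε * (q z₁ + κ * t₁)) (𝓝[>] 0)
      (𝓝 (M + 0 * (q z₁ + κ * t₁))) :=
    (tendsto_const_nhds.add (tendsto_id.mul_const _)).mono_left nhdsWithin_le_nhds
  simpa using ge_of_tendsto lim (eventually_nhdsWithin_of_forall key)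

/-- Near the initial time, `u` is almost bounded below by the bound of its initial datum, on
bounded sets. -/
theorem IsViscousSolution.eventually_ge [FiniteDimensional ℝ E] {e : ι → E}
    {σ T : ℝ} {h : ℝ → E → ℝ} {u₀ : E → ℝ} {u : ℝ → E → ℝ} (hu : IsViscousSolution e σ T h u₀ u)
    (hT : 0 < T) {m : ℝ} (hm : ∀ z, m < u₀ z) (L : ℝ) :
    ∃ s₀ > 0, ∀ s, 0 < s → s < s₀ → ∀ z, ‖z‖ ≤ L → m < u s z := by
  have hK : IsCompact (Metric.closedBall (0 : E) L) := isCompact_closedBall _ _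
  have hc : ContinuousOn (Function.uncurry u) (Icc 0 T ×ˢ univ) := hu.continuousOn
  have h1 : ∀ z ∈ Metric.closedBall (0 : E) L,
      ∀ᶠ p : ℝ × E in 𝓝[Icc 0 T] 0 ×ˢ 𝓝 z, m < u p.1 p.2 := by
    intro z _
    have h2 := hc (0, z) ⟨left_mem_Icc.2 hT.le, mem_univ _⟩
    rw [ContinuousWithinAt, nhdsWithin_prod_eq, nhdsWithin_univ] at h2
    refine h2.eventually_const_lt ?_
    simp only [Function.uncurry_apply_pair, hu.initial]
    exact hm z
  -- Compactness of the ball yields a time interval common to all its points.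
  have h3 : ∀ᶠ p in 𝓝[Icc 0 T] (0 : ℝ) ×ˢ 𝓝ˢ (Metric.closedBall (0 : E) L), m < u p.1 p.2 :=
    hK.mem_prod_nhdsSet_of_forall h1
  obtain ⟨p, hp, p', hp', H⟩ := eventually_prod_iff.1 h3
  have h4 : ∀ᶠ s in 𝓝[>] (0 : ℝ), p s := by
    rw [← nhdsWithin_Ioo_eq_nhdsGT hT]
    exact nhdsWithin_mono _ Ioo_subset_Icc_self hp
  obtain ⟨s₀, hs₀, hsub⟩ := mem_nhdsGT_iff_exists_Ioo_subset.1 h4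
  refine ⟨s₀, hs₀, fun s hs hs' z hz => H (hsub ⟨hs, hs'⟩) ?_⟩
  exact hp'.self_of_nhdsSet z (by simpa using hz)

end MaximumPrinciple

/-! ### The duality identity for u - ku². -/

section Energy

variable {E : Type*} [NormedAddCommGroup E] [NormedSpace ℝ E] [FiniteDimensional ℝ E]
  [MeasurableSpace E] [BorelSpace E] {μ : Measure E} [μ.IsAddHaarMeasure]
  {ι : Type*} [Fintype ι]
  {σ τ : ℝ} {b : ι → ℝ → E → ℝ} {ρτ : E → ℝ} {ρ : ℝ → E → ℝ}
  {h : ℝ → E → ℝ} {u₀ : E → ℝ} {u : ℝ → E → ℝ}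

/-- The density in the evolution of `∫ χ (u - k u²) ρ`. -/
noncomputable def energyDensity (e : ι → E) (σ : ℝ) (b : ι → ℝ → E → ℝ) (h ρ u : ℝ → E → ℝ)
    (χ : E → ℝ) (k : ℝ) (r : ℝ) (z : E) : ℝ :=
  χ z * ρ r z * ((1 - 2 * k * u r z) *
      (∑ i, b i r z * dirDeriv (e i) (u r) z - h r z))
    + ∑ i, (2 * k * σ * (χ z * ρ r z * dirDeriv (e i) (u r) z ^ 2)
      + (u r z - k * u r z ^ 2) * dirDeriv (e i) χ z * (b i r z * ρ r z)
      - 2 * σ * ρ r z * dirDeriv (e i) χ z * ((1 - 2 * k * u r z) * dirDeriv (e i) (u r) z)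
      - σ * ρ r z * (u r z - k * u r z ^ 2) * dirDeriv (e i) (dirDeriv (e i) χ) z)

theorem continuousOn_energyDensity {e : ι → E} (hρ : IsFokkerPlanckSolution μ e σ τ b ρτ ρ)
    (hu : IsViscousSolution e σ τ h u₀ u)
    (hh : ContinuousOn (Function.uncurry h) (Ioo 0 τ ×ˢ univ))
    {χ : E → ℝ} (hχ : ContDiff ℝ 2 χ) (k : ℝ) :
    ContinuousOn (Function.uncurry (energyDensity e σ b h ρ u χ k)) (Ioo 0 τ ×ˢ univ) := by
  have cρ := hρ.regular.continuousOn
  have cu := hu.regular.continuousOn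
  have cui := fun i => hu.regular.continuousOn_dirDeriv (e i)
  have cb := hρ.continuousOn_drift
  have cχ : ContinuousOn (fun a : ℝ × E => χ a.2) (Ioo 0 τ ×ˢ univ) :=
    (hχ.continuous.comp continuous_snd).continuousOn
  have cχ1 : ∀ i, ContinuousOn (fun a : ℝ × E => dirDeriv (e i) χ a.2) (Ioo 0 τ ×ˢ univ) :=
    fun i : ι => ((hχ.dirDeriv (m := 1) (by norm_num) (e i)).continuous.comp
      continuous_snd).continuousOn
  have cχ2 : ∀ i, ContinuousOn (fun a : ℝ × E => dirDeriv (e i) (dirDeriv (e i) χ) a.2)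
      (Ioo 0 τ ×ˢ univ) :=
    fun i : ι => (((hχ.dirDeriv (m := 1) (by norm_num) (e i)).dirDeriv (m := 0) (by norm_num)
      (e i)).continuous.comp continuous_snd).continuousOn
  simp only [Function.uncurry_def] at cρ cu cb hh
  simp only [Function.uncurry_def, energyDensity]
  have cw : ContinuousOn (fun a : ℝ × E => u a.1 a.2 - k * u a.1 a.2 ^ 2) (Ioo 0 τ ×ˢ univ) :=
    cu.sub (continuousOn_const.mul (cu.pow 2))
  have cw' : ContinuousOn (fun a : ℝ × E => 1 - 2 * k * u a.1 a.2) (Ioo 0 τ ×ˢ univ) :=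
    continuousOn_const.sub (continuousOn_const.mul cu)
  refine ContinuousOn.add ?_ (continuousOn_finsetSum _ fun i _ => ?_)
  · exact (cχ.mul cρ).mul (cw'.mul
      ((continuousOn_finsetSum _ fun i _ => (cb i).mul (cui i)).sub hh))
  · refine ((ContinuousOn.add ?_ ?_).sub ?_).sub ?_
    · exact continuousOn_const.mul ((cχ.mul cρ).mul ((cui i).pow 2))
    · exact (cw.mul (cχ1 i)).mul ((cb i).mul cρ)
    · exact ((continuousOn_const.mul cρ).mul (cχ1 i)).mul (cw'.mul (cui i))
    · exact ((continuousOn_const.mul cρ).mul cw).mul (cχ2 i)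

theorem energyDensity_eq_zero {e : ι → E} {χ : E → ℝ} {k r : ℝ} {z : E} (hz : z ∉ tsupport χ) :
    energyDensity e σ b h ρ u χ k r z = 0 := by
  simp [energyDensity, image_eq_zero_of_notMem_tsupport hz,
    dirDeriv_eq_zero_of_notMem_tsupport hz, dirDeriv_dirDeriv_eq_zero_of_notMem_tsupport hz]

/-- The evolution of `∫ χ (u - k u²) ρ`. -/
theorem integral_energy_sub {e : ι → E} (hρ : IsFokkerPlanckSolution μ e σ τ b ρτ ρ)
    (hu : IsViscousSolution e σ τ h u₀ u)
    (hh : ContinuousOn (Function.uncurry h) (Ioo 0 τ ×ˢ univ))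
    {χ : E → ℝ} (hχ : ContDiff ℝ 2 χ) (hχc : HasCompactSupport χ) (k : ℝ)
    {s t : ℝ} (hs : 0 < s) (hst : s ≤ t) (ht : t < τ) :
    ∫ z, χ z * (u t z - k * u t z ^ 2) * ρ t z ∂μ - ∫ z, χ z * (u s z - k * u s z ^ 2) * ρ s z ∂μ
      = ∫ a in Icc s t ×ˢ univ, energyDensity e σ b h ρ u χ k a.1 a.2 ∂(volume.prod μ) := by
  have hsub : Icc s t ⊆ Ioo 0 τ := fun r hr => ⟨hs.trans_le hr.1, hr.2.trans_lt ht⟩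
  have hsub' : Icc s t ×ˢ (univ : Set E) ⊆ Ioo 0 τ ×ˢ univ := prod_mono_left hsub
  have h2 : ∀ {f : E → ℝ} (i : ι), ContDiff ℝ 2 f → ContDiff ℝ 1 (dirDeriv (e i) f) :=
    fun i hf => hf.dirDeriv (by norm_num) _
  have cρ := hρ.regular.continuousOn.mono hsub'
  have cρt := hρ.regular.continuousOn_deriv.mono hsub'
  have cu := hu.regular.continuousOn.mono hsub'
  have cut := hu.regular.continuousOn_deriv.mono hsub'
  have cχ : ContinuousOn (fun a : ℝ × E => χ a.2) (Icc s t ×ˢ univ) :=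
    (hχ.continuous.comp continuous_snd).continuousOn
  simp only [Function.uncurry_def] at cρ cu
  have cw : ContinuousOn (fun a : ℝ × E => u a.1 a.2 - k * u a.1 a.2 ^ 2) (Icc s t ×ˢ univ) :=
    cu.sub (continuousOn_const.mul (cu.pow 2))
  have cw' : ContinuousOn (fun a : ℝ × E => 1 - 2 * k * u a.1 a.2) (Icc s t ×ˢ univ) :=
    continuousOn_const.sub (continuousOn_const.mul cu)
  have z0 : ∀ z, z ∉ tsupport χ → χ z = 0 := fun z hz => image_eq_zero_of_notMem_tsupport hz
  have z1 : ∀ i z, z ∉ tsupport χ → dirDeriv (e i) χ z = 0 :=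
    fun i z hz => dirDeriv_eq_zero_of_notMem_tsupport hz _
  have cbρ : ∀ r ∈ Icc s t, ∀ i, ContDiff ℝ 1 (fun z => b i r z * ρ r z) := fun r hr i =>
    (hρ.contDiff_drift r (hsub hr) i).mul
      ((hρ.regular.contDiff_space r (hsub hr)).of_le (by norm_num))
  refine integral_sub_integral_eq_of_divergence_form μ (e := e) (K := tsupport χ)
    (g := fun r z => χ z * (u r z - k * u r z ^ 2) * ρ r z)
    (g' := fun r z => χ z * (((1 - 2 * k * u r z) * deriv (fun r => u r z) r) * ρ r z
      + (u r z - k * u r z ^ 2) * deriv (fun r => ρ r z) r))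
    (F := energyDensity e σ b h ρ u χ k)
    -- With w = u - ku², the part carrying χ is the Green flux ρσ∂w - w(σ∂ρ + bρ), and the last term
    -- removes the derivative of ρ from σw ∂χ ∂ρ. Since σΔw = (1 - 2ku)σΔu - 2kσ|Du|², what remains
    -- contains the favourable term 2kσχρ|Du|².
    (V := fun i r z => χ z * (σ * ((1 - 2 * k * u r z) * (ρ r z * dirDeriv (e i) (u r) z))
        - (u r z - k * u r z ^ 2) * (σ * dirDeriv (e i) (ρ r) z + b i r z * ρ r z))
      + σ * ((u r z - k * u r z ^ 2) * (ρ r z * dirDeriv (e i) χ z)))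
    (dV := fun i r z => (dirDeriv (e i) χ z * (σ * ((1 - 2 * k * u r z)
          * (ρ r z * dirDeriv (e i) (u r) z))
          - (u r z - k * u r z ^ 2) * (σ * dirDeriv (e i) (ρ r) z + b i r z * ρ r z))
        + χ z * (σ * ((-(2 * k)) * dirDeriv (e i) (u r) z * (ρ r z * dirDeriv (e i) (u r) z)
            + (1 - 2 * k * u r z) * (dirDeriv (e i) (ρ r) z * dirDeriv (e i) (u r) z
              + ρ r z * dirDeriv (e i) (dirDeriv (e i) (u r)) z))
          - ((1 - 2 * k * u r z) * dirDeriv (e i) (u r) z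
              * (σ * dirDeriv (e i) (ρ r) z + b i r z * ρ r z)
            + (u r z - k * u r z ^ 2) * (σ * dirDeriv (e i) (dirDeriv (e i) (ρ r)) z
              + dirDeriv (e i) (fun z => b i r z * ρ r z) z))))
      + σ * ((1 - 2 * k * u r z) * dirDeriv (e i) (u r) z * (ρ r z * dirDeriv (e i) χ z)
        + (u r z - k * u r z ^ 2) * (dirDeriv (e i) (ρ r) z * dirDeriv (e i) χ z
          + ρ r z * dirDeriv (e i) (dirDeriv (e i) χ) z)))
    hst hχc ?_ ?_ ?_ ?_ ?_ ?_ ?_ ?_ ?_ ?_ ?_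
  · exact (cχ.mul cw).mul cρ
  · exact cχ.mul (((cw'.mul cut).mul cρ).add (cw.mul cρt))
  · exact (continuousOn_energyDensity hρ hu hh hχ k).mono hsub'
  · intro r _ z hz; simp [z0 z hz]
  · intro r _ z hz; simp [z0 z hz]
  · intro r _ z hz; exact energyDensity_eq_zero hz
  · intro r _ i z hz; simp [z0 z hz, z1 _ z hz]
  · intro r hr z
    have du := (hu.regular.differentiable_time r (hsub hr) z).hasDerivAt
    have dρ := (hρ.regular.differentiable_time r (hsub hr) z).hasDerivAt
    refine (((du.sub ((du.pow 2).const_mul k)).const_mul (χ z)).mul dρ).congr_deriv ?_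
    simp
    ring
  · intro r hr i
    have c2ρ := hρ.regular.contDiff_space r (hsub hr)
    have c1ρ : ContDiff ℝ 1 (ρ r) := c2ρ.of_le (by norm_num)
    have c2u := hu.regular.contDiff_space r (hsub hr)
    have c1u : ContDiff ℝ 1 (u r) := c2u.of_le (by norm_num)
    have c1χ : ContDiff ℝ 1 χ := hχ.of_le (by norm_num)
    have c1w : ContDiff ℝ 1 fun z => u r z - k * u r z ^ 2 :=
      c1u.sub (contDiff_const.mul (c1u.pow 2))
    have c1w' : ContDiff ℝ 1 fun z => 1 - 2 * k * u r z :=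
      contDiff_const.sub (contDiff_const.mul c1u)
    exact (c1χ.mul ((contDiff_const.mul (c1w'.mul (c1ρ.mul (h2 i c2u)))).sub
      (c1w.mul ((contDiff_const.mul (h2 i c2ρ)).add (cbρ r hr i))))).add
      (contDiff_const.mul (c1w.mul (c1ρ.mul (h2 i hχ))))
  · intro r hr i z
    have c2ρ := hρ.regular.contDiff_space r (hsub hr)
    have c2u := hu.regular.contDiff_space r (hsub hr)
    have l : ∀ {f : E → ℝ}, ContDiff ℝ 1 f → HasLineDerivAt ℝ f (dirDeriv (e i) f z) z (e i) :=
      fun hf => (hf.differentiable (by norm_num) z).hasLineDerivAt_dirDeriv (e i)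
    have lρ := l (c2ρ.of_le (by norm_num))
    have lu := l (c2u.of_le (by norm_num))
    have lχ := l (hχ.of_le (by norm_num))
    have lw : HasLineDerivAt ℝ (fun z => u r z - k * u r z ^ 2)
        ((1 - 2 * k * u r z) * dirDeriv (e i) (u r) z) z (e i) := by
      refine HasLineDerivAt.real_comp (φ := fun x => x - k * x ^ 2) ?_ lu
      refine ((hasDerivAt_id (u r z)).sub ((hasDerivAt_pow 2 (u r z)).const_mul k)).congr_deriv ?_
      simp
      ring
    have lw' : HasLineDerivAt ℝ (fun z => 1 - 2 * k * u r z)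
        ((-(2 * k)) * dirDeriv (e i) (u r) z) z (e i) := by
      refine HasLineDerivAt.real_comp (φ := fun x => 1 - 2 * k * x) ?_ lu
      simpa using ((hasDerivAt_id (u r z)).const_mul (2 * k)).const_sub 1
    exact (lχ.fun_mul (((lw'.fun_mul (lρ.fun_mul (l (h2 i c2u)))).const_mul σ).fun_sub
      (lw.fun_mul (((l (h2 i c2ρ)).const_mul σ).fun_add (l (cbρ r hr i)))))).fun_add
      ((lw.fun_mul (lρ.fun_mul (l (h2 i hχ)))).const_mul σ)
  · intro r hr z
    rw [hρ.equation r (hsub hr) z, hu.equation r (hsub hr) z, energyDensity]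
    have : χ z * ((1 - 2 * k * u r z) * (σ * ∑ i, dirDeriv (e i) (dirDeriv (e i) (u r)) z - h r z)
          * ρ r z + (u r z - k * u r z ^ 2) *
          (-σ * ∑ i, dirDeriv (e i) (dirDeriv (e i) (ρ r)) z
            - ∑ i, dirDeriv (e i) (fun z => b i r z * ρ r z) z))
        = -(χ z * ρ r z * ((1 - 2 * k * u r z) * h r z)) +
          ∑ i, (χ z * ((1 - 2 * k * u r z) * (σ * dirDeriv (e i) (dirDeriv (e i) (u r)) z) * ρ r z
            + (u r z - k * u r z ^ 2) * (-σ * dirDeriv (e i) (dirDeriv (e i) (ρ r)) z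
            - dirDeriv (e i) (fun z => b i r z * ρ r z) z))) := by
      simp only [← Finset.mul_sum, Finset.sum_add_distrib, Finset.sum_sub_distrib,
        ← Finset.sum_mul]
      ring
    rw [this, mul_sub, mul_sub, Finset.mul_sum, Finset.mul_sum, sub_add_eq_add_sub,
      sub_add_eq_add_sub, ← Finset.sum_add_distrib, ← Finset.sum_add_distrib, neg_add_eq_sub]
    congr 1
    exact Finset.sum_congr rfl fun i _ => by ring

end Energy

/-! ### Absorption of the cutoff errors and the energy estimate. -/

section EnergyBound

variable {E : Type*} [NormedAddCommGroup E] [NormedSpace ℝ E]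
  {ι : Type*} [Fintype ι] {σ : ℝ} {b : ι → ℝ → E → ℝ} {ρ h u : ℝ → E → ℝ}

/-- Young's inequality in the form 4XY ≤ (X + Y)², with X the quadratic term. The factor 27/2 in Y
makes 4XY equal to 9(B/R²)xp², which dominates the square of the left side; 14 is 27/2 rounded up.
-/
theorem young_cutoff {B R K W D p x : ℝ} (hK : 0 < K) (hR : 0 < R) (hB : 0 ≤ B) (hx : 0 ≤ x)
    (hD : D ^ 2 ≤ B / R ^ 2 * x) (hW : 1 / R ≤ W) :
    3 * |D| * |p| ≤ 2 * (1 / (12 * K * R)) * x * p ^ 2 + 14 * K * B * W := by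
  set X := 2 * (1 / (12 * K * R)) * x * p ^ 2 with hX
  set Y := 27 / 2 * K * B * (1 / R) with hY
  have hX0 : 0 ≤ X := by positivity
  have hY0 : 0 ≤ Y := by positivity
  have hXY : 4 * X * Y = 9 * (B / R ^ 2 * x) * p ^ 2 := by
    rw [hX, hY]
    field_simp
    ring
  have h2 : (3 * |D| * |p|) ^ 2 ≤ (X + Y) ^ 2 := by
    rw [mul_pow, mul_pow, sq_abs, sq_abs]
    have : 9 * D ^ 2 * p ^ 2 ≤ 9 * (B / R ^ 2 * x) * p ^ 2 := by gcongr
    linarith [sq_nonneg (X - Y), add_sq X Y, sub_sq X Y]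
  have h3 := le_of_abs_le (abs_le_of_sq_le_sq h2 (by positivity))
  have h5 : K * B * (1 / R) ≤ K * B * W := by gcongr
  have h6 : 0 ≤ K * B * (1 / R) := by positivity
  linarith

/-- Pointwise lower bound of the energy density on the support of the cutoff. -/
theorem le_energyDensity {e : ι → E} {B R K P c : ℝ} {χ : E → ℝ} (hχ : IsCutoff e B R χ)
    (hB : 0 ≤ B) (hR : 1 ≤ R) (hK : 0 < K) (hσ : 0 < σ) (hc : 0 ≤ c) (hP : 0 ≤ P) {r : ℝ} {z : E}
    (hρ : 0 ≤ ρ r z) (hu : |u r z| ≤ 3 * K * R)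
    (hcoer : P - c ≤ ∑ i, b i r z * dirDeriv (e i) (u r) z - h r z) :
    1 / 2 * (P * (χ z * ρ r z)) - 3 / 2 * c * (χ z * ρ r z)
      - (4 * K * B + 18 * K * B * σ * Fintype.card ι) *
        (scaleWeight R z * (|ρ r z| + ∑ i, |b i r z * ρ r z|)) ≤
      energyDensity e σ b h ρ u χ (1 / (12 * K * R)) r z := by
  have hR0 : 0 < R := by linarith
  set k : ℝ := 1 / (12 * K * R) with hk
  have hk0 : 0 < k := by positivity
  -- The 12 in `k` is chosen against |u| ≤ 3KR, and keeps the factor `Φ` between 1/2 and 3/2.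
  have hku : |k * u r z| ≤ 1 / 4 := by
    rw [abs_mul, abs_of_pos hk0]
    calc k * |u r z| ≤ k * (3 * K * R) := by gcongr
      _ = 1 / 4 := by rw [hk]; field_simp; norm_num
  have hku1 := neg_le_of_abs_le hku
  have hku2 := le_of_abs_le hku
  set Φ : ℝ := 1 - 2 * k * u r z with hΦ
  have hΦ1 : 1 / 2 ≤ Φ := by rw [hΦ]; linarith
  have hΦ2 : Φ ≤ 3 / 2 := by rw [hΦ]; linarith
  set w : ℝ := u r z - k * u r z ^ 2 with hw
  have hwle : |w| ≤ 4 * K * R := by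
    have h1 : w = u r z * (1 - k * u r z) := by rw [hw]; ring
    rw [h1, abs_mul]
    have h2 : |1 - k * u r z| ≤ 5 / 4 := by rw [abs_le]; constructor <;> linarith
    calc |u r z| * |1 - k * u r z| ≤ (3 * K * R) * (5 / 4) :=
          mul_le_mul hu h2 (abs_nonneg _) (by positivity)
      _ ≤ _ := by nlinarith [mul_pos hK hR0]
  set W := scaleWeight R z with hW
  have hW0 : 0 ≤ W := scaleWeight_nonneg hR0 z
  have hWR : 1 / R ≤ W := one_div_le_scaleWeight hR0 z
  have hχ0 := hχ.nonneg z
  have hχρ : 0 ≤ χ z * ρ r z := mul_nonneg hχ0 hρ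
  have t0 : 1 / 2 * (P * (χ z * ρ r z)) - 3 / 2 * c * (χ z * ρ r z) ≤
      χ z * ρ r z * (Φ * (∑ i, b i r z * dirDeriv (e i) (u r) z - h r z)) := by
    have h1 : Φ * (P - c) ≤ Φ * (∑ i, b i r z * dirDeriv (e i) (u r) z - h r z) :=
      mul_le_mul_of_nonneg_left hcoer (by linarith)
    have h2 : 1 / 2 * P - 3 / 2 * c ≤ Φ * (P - c) := by nlinarith
    have h3 := mul_le_mul_of_nonneg_left (h2.trans h1) hχρ
    linarith
  -- 18 = 4 + 14: the second derivative of the cutoff, and the remainder in `young_cutoff`.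
  have ti : ∀ i, -(4 * K * B * W * |b i r z * ρ r z|) - 18 * K * B * σ * W * |ρ r z| ≤
      2 * k * σ * (χ z * ρ r z * dirDeriv (e i) (u r) z ^ 2)
      + w * dirDeriv (e i) χ z * (b i r z * ρ r z)
      - 2 * σ * ρ r z * dirDeriv (e i) χ z * (Φ * dirDeriv (e i) (u r) z)
      - σ * ρ r z * w * dirDeriv (e i) (dirDeriv (e i) χ) z := by
    intro i
    rw [abs_of_nonneg hρ]
    set D := dirDeriv (e i) χ z
    set D2 := dirDeriv (e i) (dirDeriv (e i) χ) z
    set p := dirDeriv (e i) (u r) z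
    -- `w` is of order R and `D` of order 1/R, so their product is merely bounded. The gain is in
    -- its support: `D` vanishes inside the ball of radius R, and outside the weight is at least
    -- one.
    have a1 : |w * D| ≤ 4 * K * B * W := by
      rcases lt_or_ge ‖z‖ R with hz | hz
      · have : D = 0 := hχ.dirDeriv_eq_zero i z hz
        rw [this, mul_zero, abs_zero]
        positivity
      · rw [abs_mul]
        calc |w| * |D| ≤ (4 * K * R) * (B / R) :=
              mul_le_mul hwle (hχ.abs_dirDeriv_le i z) (abs_nonneg _) (by positivity)
          _ = 4 * K * B * 1 := by field_simp
          _ ≤ _ := by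
            gcongr
            exact one_le_scaleWeight hR0 hz
    have a2 : |w * D2| ≤ 4 * K * B * W := by
      rw [abs_mul]
      calc |w| * |D2| ≤ (4 * K * R) * (B / R ^ 2) :=
            mul_le_mul hwle (hχ.abs_dirDeriv_two_le i z) (abs_nonneg _) (by positivity)
        _ = 4 * K * B * (1 / R) := by field_simp
        _ ≤ _ := by gcongr
    have a3 : 3 * |D| * |p| ≤ 2 * k * χ z * p ^ 2 + 14 * K * B * W :=
      young_cutoff hK hR0 hB hχ0 (hχ.sq_dirDeriv_le i z) hWR
    have s1 : -(4 * K * B * W * |b i r z * ρ r z|) ≤ w * D * (b i r z * ρ r z) := by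
      refine neg_le_of_abs_le ?_
      rw [abs_mul]
      exact mul_le_mul_of_nonneg_right a1 (abs_nonneg _)
    have s2 : σ * ρ r z * w * D2 ≤ σ * ρ r z * (4 * K * B * W) := by
      rw [mul_assoc]
      exact mul_le_mul_of_nonneg_left (le_of_abs_le a2) (by positivity)
    have s3 : 2 * σ * ρ r z * D * (Φ * p) ≤
        σ * ρ r z * (2 * k * χ z * p ^ 2 + 14 * K * B * W) := by
      have h1 : 2 * Φ * (D * p) ≤ 3 * |D| * |p| := by
        have h2 : D * p ≤ |D| * |p| := by rw [← abs_mul]; exact le_abs_self _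
        have h3 : 0 ≤ |D| * |p| := by positivity
        have h4 : Φ * (D * p) ≤ Φ * (|D| * |p|) := mul_le_mul_of_nonneg_left h2 (by linarith)
        have h5 : Φ * (|D| * |p|) ≤ 3 / 2 * (|D| * |p|) := mul_le_mul_of_nonneg_right hΦ2 h3
        linarith
      calc _ = σ * ρ r z * (2 * Φ * (D * p)) := by ring
        _ ≤ _ := mul_le_mul_of_nonneg_left (h1.trans a3) (by positivity)
    linarith
  have hsum := Finset.sum_le_sum fun i (_ : i ∈ Finset.univ) => ti i
  rw [energyDensity]
  refine le_trans ?_ (add_le_add t0 hsum)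
  simp only [Finset.sum_sub_distrib, Finset.sum_neg_distrib, ← Finset.mul_sum, Finset.sum_const,
    Finset.card_univ, nsmul_eq_mul]
  have hS : 0 ≤ ∑ i, |b i r z * ρ r z| := Finset.sum_nonneg fun _ _ => abs_nonneg _
  have g1 : 0 ≤ 4 * K * B * W * |ρ r z| := by positivity
  have g2 : 0 ≤ 18 * K * B * σ * Fintype.card ι * W * ∑ i, |b i r z * ρ r z| := by positivity
  linarith

variable [FiniteDimensional ℝ E] [MeasurableSpace E] [BorelSpace E] {μ : Measure E}
  [μ.IsAddHaarMeasure] {e : Module.Basis ι ℝ E} {τ : ℝ} {ρτ u₀ : E → ℝ} {P : ℝ → E → ℝ}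

/-- Integrates the pointwise bound over `Icc s t` and controls the two time boundary terms. The
radii and `s₀` may depend on u, ρ and σ, but the final bound does not: half the integral is at most
2M + (5/2)(M + 1) + 5/2 + 1 + 3cτ, from time t, the bulk at time s, the tail at time s, the flux
error and the mass term. -/
theorem exists_integral_energy_le (hρ : IsFokkerPlanckSolution μ e σ τ b ρτ ρ)
    (hu : IsViscousSolution e σ τ h u₀ u) (hσ : 0 < σ) (hτ : 0 < τ)
    (hρτ : ∀ z, 0 ≤ ρτ z) (hc : HasCompactSupport ρτ) (h1 : ∫ z, ρτ z ∂μ ≤ 1)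
    (hh : ContinuousOn (Function.uncurry h) (Ioo 0 τ ×ˢ univ))
    (hh0 : ∀ t ∈ Ioo 0 τ, ∀ z, 0 ≤ h t z) {M : ℝ} (hM : ∀ z, |u₀ z| ≤ M)
    (hP : ContinuousOn (Function.uncurry P) (Ioo 0 τ ×ˢ univ))
    (hP0 : ∀ t ∈ Ioo 0 τ, ∀ z, 0 ≤ P t z) {c : ℝ} (hc0 : 0 ≤ c)
    (hcoer : ∀ t ∈ Ioo 0 τ, ∀ z, P t z - c ≤ ∑ i, b i t z * dirDeriv (e i) (u t) z - h t z) :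
    ∃ s₀ > 0, ∀ s t R₀, 0 < s → s < s₀ → s ≤ t → t < τ →
      ∫ a in Icc s t ×ˢ Metric.closedBall 0 R₀, P a.1 a.2 * ρ a.1 a.2 ∂(volume.prod μ) ≤
        9 * M + 13 + 6 * c * τ := by
  obtain ⟨B, hB, hcut⟩ := exists_isCutoff e
  obtain ⟨K', hK'⟩ := hu.growth
  let K := max K' 1
  have hK1 : 1 ≤ K := le_max_right _ _
  have hK0 : 0 < K := by linarith
  have hK : ∀ t ∈ Icc 0 τ, ∀ z, |u t z| ≤ K * (1 + ‖z‖) := fun t ht z =>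
    (hK' t ht z).trans (mul_le_mul_of_nonneg_right (le_max_left _ _) (by positivity))
  have hM0 : 0 ≤ M := (abs_nonneg _).trans (hM 0)
  have ρ0 : ∀ t ∈ Ioo 0 τ, ∀ z, 0 ≤ ρ t z := fun t ht z => hρ.nonneg hσ hρτ ht z
  have uM : ∀ t ∈ Ioo 0 τ, ∀ z, u t z ≤ M := fun t ht z =>
    hu.le_of_initial_le hσ hh0 (fun z => le_of_abs_le (hM z)) ht z
  -- Taking δ = 1/K cancels the growth constant K, which may depend on u and σ.
  obtain ⟨L, hL1, Θ, cΘ, Θ0, ΘL, hΘ⟩ := hρ.exists_tail_le hσ hτ hρτ hc hB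
    (δ := 1 / K) (by positivity)
  obtain ⟨s₀, hs₀, hlow⟩ := hu.eventually_ge hτ (m := -(M + 1))
    (fun z => by linarith [neg_le_of_abs_le (hM z)]) L
  let A : ℝ := 4 * K * B + 18 * K * B * σ * Fintype.card ι
  have limA := hρ.tendsto_weightedFlux.const_mul A
  rw [mul_zero] at limA
  refine ⟨s₀, hs₀, fun s t R₀ hs hss₀ hst ht => ?_⟩
  obtain ⟨R, ⟨⟨hRmass, hRA⟩, hR1⟩, hRL⟩ := (((hρ.eventually_mass_le hσ hτ hρτ hc h1 hB).and
    (limA.eventually_lt_const one_pos)).and (eventually_ge_atTop (1 : ℝ))).and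
    (eventually_ge_atTop (max L R₀)) |>.exists
  obtain ⟨χ, hχ⟩ := hcut R hR1
  have hLR : L ≤ R := (le_max_left _ _).trans hRL
  have hR₀R : R₀ ≤ R := (le_max_right _ _).trans hRL
  have hR0 : 0 < R := by linarith
  set k : ℝ := 1 / (12 * K * R) with hk
  have hk0 : 0 < k := by positivity
  have hsI : s ∈ Ioo 0 τ := ⟨hs, by linarith⟩
  have htI : t ∈ Ioo 0 τ := ⟨by linarith, ht⟩
  have hsub : Icc s t ⊆ Ioo 0 τ := fun r hr => ⟨hs.trans_le hr.1, hr.2.trans_lt ht⟩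
  have hsub' : Icc s t ×ˢ (univ : Set E) ⊆ Ioo 0 τ ×ˢ univ := prod_mono_left hsub
  have hχc := hχ.hasCompactSupport
  have ubound : ∀ r ∈ Ioo 0 τ, ∀ z, ‖z‖ ≤ 2 * R → |u r z| ≤ 3 * K * R := fun r hr z hz => by
    refine (hK r (Ioo_subset_Icc_self hr) z).trans ?_
    have : 1 + ‖z‖ ≤ 3 * R := by linarith
    calc K * (1 + ‖z‖) ≤ K * (3 * R) := by gcongr
      _ = _ := by ring
  have kubound : ∀ r ∈ Ioo 0 τ, ∀ z, ‖z‖ ≤ 2 * R → |k * u r z| ≤ 1 / 4 := fun r hr z hz => by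
    rw [abs_mul, abs_of_pos hk0]
    calc k * |u r z| ≤ k * (3 * K * R) := by gcongr; exact ubound r hr z hz
      _ = 1 / 4 := by rw [hk]; field_simp; norm_num
  have cρs : ∀ r ∈ Ioo 0 τ, Continuous (ρ r) := fun r hr =>
    hρ.continuous_slice (Ioo_subset_Ioc_self hr)
  have cus : ∀ r ∈ Ioo 0 τ, Continuous (u r) := fun r hr =>
    (hu.regular.contDiff_space r hr).continuous
  have iχρ : ∀ r ∈ Ioo 0 τ, Integrable (fun z => χ z * ρ r z) μ := fun r hr =>
    (hχ.contDiff.continuous.mul (cρs r hr)).integrable_of_hasCompactSupport hχc.mul_right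
  have iχwρ : ∀ r ∈ Ioo 0 τ, Integrable (fun z => χ z * (u r z - k * u r z ^ 2) * ρ r z) μ :=
    fun r hr => ((hχ.contDiff.continuous.mul ((cus r hr).sub
      (continuous_const.mul ((cus r hr).pow 2)))).mul (cρs r hr)).integrable_of_hasCompactSupport
      hχc.mul_right.mul_right
  have upper : ∫ z, χ z * (u t z - k * u t z ^ 2) * ρ t z ∂μ ≤ M * 2 := by
    calc _ ≤ ∫ z, M * (χ z * ρ t z) ∂μ := by
          refine integral_mono (iχwρ t htI) ((iχρ t htI).const_mul M) fun z => ?_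
          have h2 : u t z - k * u t z ^ 2 ≤ M := by
            have := uM t htI z
            have : 0 ≤ k * u t z ^ 2 := by positivity
            linarith
          have h3 : 0 ≤ χ z * ρ t z := mul_nonneg (hχ.nonneg z) (ρ0 t htI z)
          have := mul_le_mul_of_nonneg_right h2 h3
          simp only
          linarith
      _ = M * ∫ z, χ z * ρ t z ∂μ := integral_const_mul _ _
      _ ≤ _ := mul_le_mul_of_nonneg_left (hRmass χ hχ t htI) hM0
  have lower : -(∫ z, χ z * (u s z - k * u s z ^ 2) * ρ s z ∂μ) ≤
      5 / 4 * (M + 1) * 2 + 5 / 2 * K * (1 / K) := by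
    have iΘ : Integrable (fun z => χ z * Θ z * ρ s z) μ :=
      ((hχ.contDiff.continuous.mul cΘ).mul (cρs s hsI)).integrable_of_hasCompactSupport
        hχc.mul_right.mul_right
    calc _ = ∫ z, -(χ z * (u s z - k * u s z ^ 2) * ρ s z) ∂μ := (integral_neg _).symm
      _ ≤ ∫ z, (5 / 4 * (M + 1) * (χ z * ρ s z) + 5 / 2 * K * (χ z * Θ z * ρ s z)) ∂μ := by
          refine integral_mono (iχwρ s hsI).neg
            (((iχρ s hsI).const_mul _).add (iΘ.const_mul _)) fun z => ?_
          have h3 : 0 ≤ χ z * ρ s z := mul_nonneg (hχ.nonneg z) (ρ0 s hsI z)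
          rcases le_or_gt ‖z‖ (2 * R) with hz | hz
          · have h4 := kubound s hsI z hz
            have h5 := neg_le_of_abs_le h4
            have h6 := le_of_abs_le h4
            -- Within radius L the value of u(s) exceeds -(M + 1); beyond L its linear growth is
            -- charged to Θ.
            have h7 : -(u s z - k * u s z ^ 2) ≤ 5 / 4 * (M + 1) + 5 / 2 * K * Θ z := by
              have e1 : -(u s z - k * u s z ^ 2) = (-u s z) * (1 - k * u s z) := by ring
              rw [e1]
              have g0 : 0 ≤ 5 / 2 * K * Θ z := by have := Θ0 z; positivity
              rcases le_or_gt 0 (u s z) with hpos | hneg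
              · have : (-u s z) * (1 - k * u s z) ≤ 0 :=
                  mul_nonpos_of_nonpos_of_nonneg (by linarith) (by linarith)
                linarith
              · have g1 : (-u s z) * (1 - k * u s z) ≤ (-u s z) * (5 / 4) :=
                  mul_le_mul_of_nonneg_left (by linarith) (by linarith)
                rcases le_or_gt ‖z‖ L with hzL | hzL
                · have := hlow s hs hss₀ z hzL
                  linarith
                · have g2 := neg_le_of_abs_le (hK s (Ioo_subset_Icc_self hsI) z)
                  have g3 : 1 + ‖z‖ ≤ 2 * Θ z := by linarith [ΘL z hzL.le]
                  have g4 : K * (1 + ‖z‖) ≤ K * (2 * Θ z) := mul_le_mul_of_nonneg_left g3 hK0.le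
                  linarith
            have := mul_le_mul_of_nonneg_right h7 h3
            simp only
            linarith
          · have : χ z = 0 := hχ.eq_zero z hz.le
            simp [this]
      _ = 5 / 4 * (M + 1) * ∫ z, χ z * ρ s z ∂μ + 5 / 2 * K * ∫ z, χ z * Θ z * ρ s z ∂μ := by
          rw [integral_add ((iχρ s hsI).const_mul _) (iΘ.const_mul _), integral_const_mul,
            integral_const_mul]
      _ ≤ _ := by
          gcongr
          · exact hRmass χ hχ s hsI
          · exact hΘ R hLR χ hχ s hsI
  have iw : IntegrableOn (fun a : ℝ × E => scaleWeight R a.2 *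
      (|ρ a.1 a.2| + ∑ i, |b i a.1 a.2 * ρ a.1 a.2|)) (Icc s t ×ˢ univ) (volume.prod μ) :=
    (hρ.integrableOn_weighted hR1).mono_set hsub'
  have cρ := hρ.regular.continuousOn.mono hsub'
  have cχ : ContinuousOn (fun a : ℝ × E => χ a.2) (Icc s t ×ˢ univ) :=
    (hχ.contDiff.continuous.comp continuous_snd).continuousOn
  have z0 : ∀ z, z ∉ tsupport χ → χ z = 0 := fun z hz => image_eq_zero_of_notMem_tsupport hz
  have iχρ' : IntegrableOn (fun a : ℝ × E => χ a.2 * ρ a.1 a.2) (Icc s t ×ˢ univ)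
      (volume.prod μ) :=
    ContinuousOn.integrableOn_Icc_prod_of_compact_support μ (F := fun r z => χ z * ρ r z) hχc
      (cχ.mul cρ) (fun r _ z hz => by simp [z0 z hz])
  have iPχρ : IntegrableOn (fun a : ℝ × E => P a.1 a.2 * (χ a.2 * ρ a.1 a.2)) (Icc s t ×ˢ univ)
      (volume.prod μ) :=
    ContinuousOn.integrableOn_Icc_prod_of_compact_support μ
      (F := fun r z => P r z * (χ z * ρ r z)) hχc
      ((hP.mono hsub').mul (cχ.mul cρ)) (fun r _ z hz => by simp [z0 z hz])
  have iF : IntegrableOn (fun a : ℝ × E => energyDensity e σ b h ρ u χ k a.1 a.2)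
      (Icc s t ×ˢ univ) (volume.prod μ) :=
    ContinuousOn.integrableOn_Icc_prod_of_compact_support μ
      (F := energyDensity e σ b h ρ u χ k) hχc
      ((continuousOn_energyDensity hρ hu hh hχ.contDiff k).mono hsub')
      (fun r _ z hz => energyDensity_eq_zero hz)
  have mass : ∫ a in Icc s t ×ˢ univ, χ a.2 * ρ a.1 a.2 ∂(volume.prod μ) ≤ 2 * τ := by
    rw [setIntegral_prod (fun a : ℝ × E => χ a.2 * ρ a.1 a.2) iχρ']
    simp only [Measure.restrict_univ]
    have hb : ∀ r ∈ Icc s t, ‖∫ z, χ z * ρ r z ∂μ‖ ≤ 2 := fun r hr => by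
      rw [Real.norm_eq_abs, abs_of_nonneg (integral_nonneg fun z =>
        mul_nonneg (hχ.nonneg z) (ρ0 r (hsub hr) z))]
      exact hRmass χ hχ r (hsub hr)
    have := norm_setIntegral_le_of_norm_le_const (μ := volume) (s := Icc s t)
      measure_Icc_lt_top hb
    rw [Real.norm_eq_abs] at this
    refine (le_abs_self _).trans (this.trans ?_)
    rw [Real.volume_real_Icc_of_le hst]
    linarith
  have flux := hρ.setIntegral_weighted_le hR1 hs ht
  have A0 : 0 ≤ A := by positivity
  have main : ∫ a in Icc s t ×ˢ univ, (1 / 2 * (P a.1 a.2 * (χ a.2 * ρ a.1 a.2))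
      - 3 / 2 * c * (χ a.2 * ρ a.1 a.2) - A * (scaleWeight R a.2 *
      (|ρ a.1 a.2| + ∑ i, |b i a.1 a.2 * ρ a.1 a.2|))) ∂(volume.prod μ) ≤
      ∫ a in Icc s t ×ˢ univ, energyDensity e σ b h ρ u χ k a.1 a.2 ∂(volume.prod μ) := by
    refine setIntegral_mono_on (((iPχρ.const_mul _).sub (iχρ'.const_mul _)).sub (iw.const_mul _)) iF
      (measurableSet_Icc.prod MeasurableSet.univ) ?_
    rintro ⟨r, z⟩ ⟨hr, -⟩
    have hr' := hsub hr
    rcases le_or_gt ‖z‖ (2 * R) with hz | hz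
    · exact le_energyDensity hχ hB hR1 hK0 hσ hc0 (hP0 r hr' z) (ρ0 r hr' z) (ubound r hr' z hz)
        (hcoer r hr' z)
    · have hz' : z ∉ tsupport χ := fun hmem => by
        have : tsupport χ ⊆ Metric.closedBall 0 (2 * R) := closure_minimal (fun y hy => by
          by_contra h'
          simp only [mem_closedBall_zero_iff, not_le] at h'
          exact hy (hχ.eq_zero y h'.le)) Metric.isClosed_closedBall
        have := this hmem
        simp only [mem_closedBall_zero_iff] at this
        linarith
      simp only [energyDensity_eq_zero hz', z0 z hz']
      have : 0 ≤ A * (scaleWeight R z * (|ρ r z| + ∑ i, |b i r z * ρ r z|)) :=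
        mul_nonneg A0 (mul_nonneg (scaleWeight_nonneg hR0 z) (by positivity))
      linarith
  have i12 : IntegrableOn (fun a : ℝ × E => 1 / 2 * (P a.1 a.2 * (χ a.2 * ρ a.1 a.2))
      - 3 / 2 * c * (χ a.2 * ρ a.1 a.2)) (Icc s t ×ˢ univ) (volume.prod μ) :=
    (iPχρ.const_mul _).sub (iχρ'.const_mul _)
  rw [integral_sub i12 (iw.const_mul _), integral_sub (iPχρ.const_mul _) (iχρ'.const_mul _), integral_const_mul, integral_const_mul,
    integral_const_mul, ← integral_energy_sub hρ hu hh hχ.contDiff hχc k hs hst ht] at main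
  have small : ∫ a in Icc s t ×ˢ Metric.closedBall 0 R₀, P a.1 a.2 * ρ a.1 a.2 ∂(volume.prod μ) ≤
      ∫ a in Icc s t ×ˢ univ, P a.1 a.2 * (χ a.2 * ρ a.1 a.2) ∂(volume.prod μ) := by
    have e1 : ∫ a in Icc s t ×ˢ Metric.closedBall 0 R₀, P a.1 a.2 * ρ a.1 a.2 ∂(volume.prod μ) =
        ∫ a in Icc s t ×ˢ Metric.closedBall 0 R₀, P a.1 a.2 * (χ a.2 * ρ a.1 a.2)
          ∂(volume.prod μ) := by
      refine setIntegral_congr_fun (measurableSet_Icc.prod Metric.isClosed_closedBall.measurableSet)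
        ?_
      rintro ⟨r, z⟩ ⟨-, hz⟩
      simp only [mem_closedBall_zero_iff] at hz
      simp [hχ.eq_one z (hz.trans hR₀R)]
    rw [e1]
    refine setIntegral_mono_set iPχρ ?_ (LE.le.eventuallyLE (prod_mono_right (subset_univ _)))
    refine (ae_restrict_iff' (measurableSet_Icc.prod MeasurableSet.univ)).2
      (Eventually.of_forall ?_)
    rintro ⟨r, z⟩ ⟨hr, -⟩
    exact mul_nonneg (hP0 r (hsub hr) z) (mul_nonneg (hχ.nonneg z) (ρ0 r (hsub hr) z))
  have f1 : A * ∫ a in Icc s t ×ˢ univ, scaleWeight R a.2 *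
      (|ρ a.1 a.2| + ∑ i, |b i a.1 a.2 * ρ a.1 a.2|) ∂(volume.prod μ) ≤ 1 :=
    (mul_le_mul_of_nonneg_left flux A0).trans hRA.le
  have f2 : 3 / 2 * c * ∫ a in Icc s t ×ˢ univ, χ a.2 * ρ a.1 a.2 ∂(volume.prod μ) ≤
      3 / 2 * c * (2 * τ) := mul_le_mul_of_nonneg_left mass (by positivity)
  have f3 : 5 / 2 * K * (1 / K) = 5 / 2 := by field_simp
  rw [f3] at lower
  linarith

/-- The energy estimate: the coercive quantity is integrable against `ρ`, with a bound that does
not depend on `σ`. -/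
theorem integrableOn_and_integral_energy_le (hρ : IsFokkerPlanckSolution μ e σ τ b ρτ ρ)
    (hu : IsViscousSolution e σ τ h u₀ u) (hσ : 0 < σ) (hτ : 0 < τ)
    (hρτ : ∀ z, 0 ≤ ρτ z) (hc : HasCompactSupport ρτ) (h1 : ∫ z, ρτ z ∂μ ≤ 1)
    (hh : ContinuousOn (Function.uncurry h) (Ioo 0 τ ×ˢ univ))
    (hh0 : ∀ t ∈ Ioo 0 τ, ∀ z, 0 ≤ h t z) {M : ℝ} (hM : ∀ z, |u₀ z| ≤ M)
    (hP : ContinuousOn (Function.uncurry P) (Ioo 0 τ ×ˢ univ))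
    (hP0 : ∀ t ∈ Ioo 0 τ, ∀ z, 0 ≤ P t z) {c : ℝ} (hc0 : 0 ≤ c)
    (hcoer : ∀ t ∈ Ioo 0 τ, ∀ z, P t z - c ≤ ∑ i, b i t z * dirDeriv (e i) (u t) z - h t z) :
    IntegrableOn (fun a : ℝ × E => P a.1 a.2 * ρ a.1 a.2) (Ioo 0 τ ×ˢ univ) (volume.prod μ) ∧
      ∫ a in Ioo 0 τ ×ˢ univ, P a.1 a.2 * ρ a.1 a.2 ∂(volume.prod μ) ≤
        9 * M + 13 + 6 * c * τ := by
  obtain ⟨s₀, hs₀, H⟩ := exists_integral_energy_le hρ hu hσ hτ hρτ hc h1 hh hh0 hM hP hP0 hc0 hcoer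
  have mU : MeasurableSet (Ioo 0 τ ×ˢ (univ : Set E)) := measurableSet_Ioo.prod MeasurableSet.univ
  -- The shift by 2 gives `a n ≤ τ / 2`, so the time intervals below are nonempty from n = 0 on.
  let a : ℕ → ℝ := fun n => τ / (n + 2)
  have apos : ∀ n, 0 < a n := fun n => by positivity
  have ahalf : ∀ n, a n ≤ τ / 2 := fun n =>
    div_le_div_of_nonneg_left hτ.le two_pos (by linarith [Nat.cast_nonneg (α := ℝ) n])
  have alim : Tendsto a atTop (𝓝 0) :=
    tendsto_const_nhds.div_atTop
      (tendsto_atTop_add_const_right _ 2 tendsto_natCast_atTop_atTop)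
  -- On these compact sets the integrand is continuous, nonnegative, and its integrals are
  -- eventually uniformly bounded; exhaustion then yields both integrability and the bound.
  let S : ℕ → Set (ℝ × E) := fun n => Icc (a n) (τ - a n) ×ˢ Metric.closedBall 0 n
  have hSsub : ∀ n, S n ⊆ Ioo 0 τ ×ˢ univ := fun n => prod_mono
    (fun r hr => ⟨(apos n).trans_le hr.1, hr.2.trans_lt (by linarith [apos n])⟩) (subset_univ _)
  have mS : ∀ n, MeasurableSet (S n) := fun n =>
    measurableSet_Icc.prod Metric.isClosed_closedBall.measurableSet
  have cover : AECover ((volume.prod μ).restrict (Ioo 0 τ ×ˢ univ)) atTop S := by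
    refine ⟨?_, mS⟩
    refine (ae_restrict_iff' mU).2 (Eventually.of_forall ?_)
    rintro ⟨r, z⟩ ⟨hr, -⟩
    filter_upwards [alim.eventually_lt_const hr.1,
      alim.eventually_lt_const (sub_pos.2 hr.2), tendsto_natCast_atTop_atTop.eventually_ge_atTop ‖z‖]
      with n h2 h3 h4
    exact ⟨⟨h2.le, by linarith⟩, by simpa using h4⟩
  have hres : ∀ n, ((volume.prod μ).restrict (Ioo 0 τ ×ˢ (univ : Set E))).restrict (S n) =
      (volume.prod μ).restrict (S n) := fun n =>
    Measure.restrict_restrict_of_subset (hSsub n)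
  have hint : ∀ n, IntegrableOn (fun a : ℝ × E => P a.1 a.2 * ρ a.1 a.2) (S n)
      ((volume.prod μ).restrict (Ioo 0 τ ×ˢ univ)) := fun n => by
    rw [IntegrableOn, hres]
    exact ContinuousOn.integrableOn_compact (isCompact_Icc.prod (isCompact_closedBall _ _))
      ((hP.mul hρ.regular.continuousOn).mono (hSsub n))
  have hbound : ∀ᶠ n in atTop, ∫ a in S n, P a.1 a.2 * ρ a.1 a.2
      ∂((volume.prod μ).restrict (Ioo 0 τ ×ˢ univ)) ≤ 9 * M + 13 + 6 * c * τ := by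
    filter_upwards [alim.eventually_lt_const hs₀] with n hn
    rw [hres]
    exact H (a n) (τ - a n) n (apos n) hn (by linarith [ahalf n]) (by linarith [apos n])
  have hnn : ∀ᵐ a : ℝ × E ∂((volume.prod μ).restrict (Ioo 0 τ ×ˢ univ)),
      0 ≤ P a.1 a.2 * ρ a.1 a.2 := by
    refine (ae_restrict_iff' mU).2 (Eventually.of_forall ?_)
    rintro ⟨r, z⟩ ⟨hr, -⟩
    exact mul_nonneg (hP0 r hr z) (hρ.nonneg hσ hρτ hr z)
  have hI := cover.integrable_of_integral_bounded_of_nonneg_ae _ hint hnn hbound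
  exact ⟨hI, le_of_tendsto (cover.integral_tendsto_of_countably_generated hI) hbound⟩

end EnergyBound

/-! ### From gradients, Laplacians and divergences to coordinates on ℝ^{d₁} × ℝ^{d₂}. -/

section Transfer

variable {d₁ d₂ : ℕ}

section Partial

variable {X Y : Type*} [NormedAddCommGroup X] [NormedSpace ℝ X] [NormedAddCommGroup Y]
  [NormedSpace ℝ Y]

theorem fderiv_partial_fst {W : X × Y → ℝ} {z : X × Y} (hW : DifferentiableAt ℝ W z) :
    fderiv ℝ (fun x => W (x, z.2)) z.1 = (fderiv ℝ W z).comp (ContinuousLinearMap.inl ℝ X Y) :=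
  (HasFDerivAt.comp (g := W) z.1 hW.hasFDerivAt (hasFDerivAt_prodMk_left z.1 z.2)).fderiv

theorem fderiv_partial_snd {W : X × Y → ℝ} {z : X × Y} (hW : DifferentiableAt ℝ W z) :
    fderiv ℝ (fun y => W (z.1, y)) z.2 = (fderiv ℝ W z).comp (ContinuousLinearMap.inr ℝ X Y) :=
  (HasFDerivAt.comp (g := W) z.2 hW.hasFDerivAt (hasFDerivAt_prodMk_right z.1 z.2)).fderiv

theorem dirDeriv_partial_fst {W : X × Y → ℝ} {z : X × Y} (hW : DifferentiableAt ℝ W z) (v : X) :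
    dirDeriv v (fun x => W (x, z.2)) z.1 = dirDeriv (v, 0) W z := by
  simp [dirDeriv, fderiv_partial_fst hW]

theorem dirDeriv_partial_snd {W : X × Y → ℝ} {z : X × Y} (hW : DifferentiableAt ℝ W z) (v : Y) :
    dirDeriv v (fun y => W (z.1, y)) z.2 = dirDeriv (0, v) W z := by
  simp [dirDeriv, fderiv_partial_snd hW]

theorem dirDeriv_two_partial_fst {W : X × Y → ℝ} (hW : ContDiff ℝ 2 W) (z : X × Y) (v : X) :
    dirDeriv v (dirDeriv v (fun x => W (x, z.2))) z.1 = dirDeriv (v, 0) (dirDeriv (v, 0) W) z := by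
  have h1 : dirDeriv v (fun x => W (x, z.2)) = fun x => dirDeriv (v, 0) W (x, z.2) := by
    ext x
    exact dirDeriv_partial_fst (z := (x, z.2)) (hW.differentiable (by norm_num) _) v
  rw [h1]
  exact dirDeriv_partial_fst
    ((hW.dirDeriv (m := 1) (by norm_num) _).differentiable (by norm_num) _) v

theorem dirDeriv_two_partial_snd {W : X × Y → ℝ} (hW : ContDiff ℝ 2 W) (z : X × Y) (v : Y) :
    dirDeriv v (dirDeriv v (fun y => W (z.1, y))) z.2 = dirDeriv (0, v) (dirDeriv (0, v) W) z := by
  have h1 : dirDeriv v (fun y => W (z.1, y)) = fun y => dirDeriv (0, v) W (z.1, y) := by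
    ext y
    exact dirDeriv_partial_snd (z := (z.1, y)) (hW.differentiable (by norm_num) _) v
  rw [h1]
  exact dirDeriv_partial_snd
    ((hW.dirDeriv (m := 1) (by norm_num) _).differentiable (by norm_num) _) v

end Partial

theorem gradient_apply_eq_dirDeriv {d : ℕ} (f : Euc d → ℝ) (x : Euc d) (i : Fin d) :
    gradient f x i = dirDeriv (EuclideanSpace.single i 1) f x := by
  have h1 : inner ℝ (gradient f x) (EuclideanSpace.single i (1 : ℝ))
      = fderiv ℝ f x (EuclideanSpace.single i 1) := by
    rw [gradient, InnerProductSpace.toDual_symm_apply]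
  rw [EuclideanSpace.inner_single_right] at h1
  simpa [dirDeriv] using h1

theorem laplacian_eq_sum_dirDeriv {d : ℕ} {f : Euc d → ℝ} (hf : ContDiff ℝ 2 f) (x : Euc d) :
    Laplacian.laplacian f x = ∑ i, dirDeriv (EuclideanSpace.single i (1 : ℝ))
      (dirDeriv (EuclideanSpace.single i (1 : ℝ)) f) x := by
  rw [InnerProductSpace.laplacian_eq_iteratedFDeriv_orthonormalBasis f
    (EuclideanSpace.basisFun (Fin d) ℝ)]
  simp [dirDeriv_dirDeriv_eq_iteratedFDeriv hf]

theorem divergence_eq_sum_dirDeriv {d : ℕ} {F : Euc d → Euc d} {x : Euc d}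
    (hF : DifferentiableAt ℝ F x) :
    divergence F x = ∑ i, dirDeriv (EuclideanSpace.single i (1 : ℝ)) (fun x => F x i) x := by
  rw [divergence, LinearMap.trace_eq_sum_inner _ (EuclideanSpace.basisFun (Fin d) ℝ)]
  refine Finset.sum_congr rfl fun i _ => ?_
  have h1 : HasFDerivAt (fun x => F x i)
      ((EuclideanSpace.proj i : Euc d →L[ℝ] ℝ).comp (fderiv ℝ F x)) x :=
    (EuclideanSpace.proj i : Euc d →L[ℝ] ℝ).hasFDerivAt.comp x hF.hasFDerivAt
  rw [dirDeriv, h1.fderiv]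
  simp [EuclideanSpace.inner_single_left]

/-- The standard basis of `ℝ^{d₁} × ℝ^{d₂}`. -/
noncomputable def prodBasis (d₁ d₂ : ℕ) : Module.Basis (Fin d₁ ⊕ Fin d₂) ℝ (Euc d₁ × Euc d₂) :=
  (EuclideanSpace.basisFun (Fin d₁) ℝ).toBasis.prod (EuclideanSpace.basisFun (Fin d₂) ℝ).toBasis

theorem prodBasis_inl (i : Fin d₁) :
    prodBasis d₁ d₂ (Sum.inl i) = (EuclideanSpace.single i 1, 0) := by
  simp [prodBasis, Module.Basis.prod_apply]

theorem prodBasis_inr (j : Fin d₂) :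
    prodBasis d₁ d₂ (Sum.inr j) = (0, EuclideanSpace.single j 1) := by
  simp [prodBasis, Module.Basis.prod_apply]

theorem IsC12On.isSpaceTimeC12 {w : ℝ → Euc d₁ → Euc d₂ → ℝ} {I : Set ℝ} (h : IsC12On w I) :
    IsSpaceTimeC12 (fun t (z : Euc d₁ × Euc d₂) => w t z.1 z.2) I where
  differentiable_time t ht z := h.differentiable_time t ht z.1 z.2
  contDiff_space := h.contDiff_space
  continuousOn := h.continuousOn
  continuousOn_deriv := h.continuousOn_deriv
  continuousOn_fderiv := h.continuousOn_fderiv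
  continuousOn_fderiv_two := h.continuousOn_fderiv_two

variable {w : ℝ → Euc d₁ → Euc d₂ → ℝ} {t : ℝ}

theorem gradX_apply (hw : ContDiff ℝ 2 fun z : Euc d₁ × Euc d₂ => w t z.1 z.2)
    (z : Euc d₁ × Euc d₂) (i : Fin d₁) : gradX w t z.1 z.2 i =
      dirDeriv (prodBasis d₁ d₂ (Sum.inl i)) (fun z => w t z.1 z.2) z := by
  rw [gradX, gradient_apply_eq_dirDeriv, prodBasis_inl,
    ← dirDeriv_partial_fst (hw.differentiable (by norm_num) z)]

theorem gradY_apply (hw : ContDiff ℝ 2 fun z : Euc d₁ × Euc d₂ => w t z.1 z.2)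
    (z : Euc d₁ × Euc d₂) (j : Fin d₂) : gradY w t z.1 z.2 j =
      dirDeriv (prodBasis d₁ d₂ (Sum.inr j)) (fun z => w t z.1 z.2) z := by
  rw [gradY, gradient_apply_eq_dirDeriv, prodBasis_inr,
    ← dirDeriv_partial_snd (hw.differentiable (by norm_num) z)]

theorem lapXY_eq_sum (hw : ContDiff ℝ 2 fun z : Euc d₁ × Euc d₂ => w t z.1 z.2)
    (z : Euc d₁ × Euc d₂) : lapXY w t z.1 z.2 =
      ∑ i, dirDeriv (prodBasis d₁ d₂ i) (dirDeriv (prodBasis d₁ d₂ i) fun z => w t z.1 z.2) z := by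
  have hx : ContDiff ℝ 2 fun x => w t x z.2 :=
    hw.comp (contDiff_id.prodMk contDiff_const)
  have hy : ContDiff ℝ 2 fun y => w t z.1 y :=
    hw.comp (contDiff_const.prodMk contDiff_id)
  rw [lapXY, laplacian_eq_sum_dirDeriv hx, laplacian_eq_sum_dirDeriv hy, Fintype.sum_sum_type]
  congr 1
  · refine Finset.sum_congr rfl fun i _ => ?_
    rw [prodBasis_inl]
    exact dirDeriv_two_partial_fst hw z _
  · refine Finset.sum_congr rfl fun i _ => ?_
    rw [prodBasis_inr]
    exact dirDeriv_two_partial_snd hw z _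

theorem contDiff_gradX (hw : ContDiff ℝ 2 fun z : Euc d₁ × Euc d₂ => w t z.1 z.2) :
    ContDiff ℝ 1 fun z : Euc d₁ × Euc d₂ => gradX w t z.1 z.2 := by
  refine contDiff_euclidean.2 fun i => ?_
  simp only [gradX_apply hw]
  exact hw.dirDeriv (by norm_num) _

theorem contDiff_gradY (hw : ContDiff ℝ 2 fun z : Euc d₁ × Euc d₂ => w t z.1 z.2) :
    ContDiff ℝ 1 fun z : Euc d₁ × Euc d₂ => gradY w t z.1 z.2 := by
  refine contDiff_euclidean.2 fun i => ?_
  simp only [gradY_apply hw]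
  exact hw.dirDeriv (by norm_num) _

theorem IsC12On.continuousOn_gradX {I : Set ℝ} (h : IsC12On w I) :
    ContinuousOn (fun a : ℝ × Euc d₁ × Euc d₂ => gradX w a.1 a.2.1 a.2.2) (I ×ˢ univ) := by
  have h1 : Continuous fun L : (Euc d₁ × Euc d₂) →L[ℝ] ℝ =>
      (InnerProductSpace.toDual ℝ (Euc d₁)).symm
        (L.comp (ContinuousLinearMap.inl ℝ (Euc d₁) (Euc d₂))) :=
    (LinearIsometryEquiv.continuous _).comp (by fun_prop)
  refine (h1.comp_continuousOn h.continuousOn_fderiv).congr fun a ha => ?_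
  simp only [Function.comp, gradX, gradient]
  rw [← fderiv_partial_fst ((h.contDiff_space a.1 ha.1).differentiable (by norm_num) a.2)]

theorem IsC12On.continuousOn_gradY {I : Set ℝ} (h : IsC12On w I) :
    ContinuousOn (fun a : ℝ × Euc d₁ × Euc d₂ => gradY w a.1 a.2.1 a.2.2) (I ×ˢ univ) := by
  have h1 : Continuous fun L : (Euc d₁ × Euc d₂) →L[ℝ] ℝ =>
      (InnerProductSpace.toDual ℝ (Euc d₂)).symm
        (L.comp (ContinuousLinearMap.inr ℝ (Euc d₁) (Euc d₂))) :=
    (LinearIsometryEquiv.continuous _).comp (by fun_prop)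
  refine (h1.comp_continuousOn h.continuousOn_fderiv).congr fun a ha => ?_
  simp only [Function.comp, gradY, gradient]
  rw [← fderiv_partial_snd ((h.contDiff_space a.1 ha.1).differentiable (by norm_num) a.2)]

variable {H : Euc d₁ → Euc d₂ → Euc d₁ → Euc d₂ → ℝ} {γ CH : ℝ}

theorem gradP_apply (hH : ContDiff ℝ 2
      (fun z : Euc d₁ × Euc d₂ × Euc d₁ × Euc d₂ => H z.1 z.2.1 z.2.2.1 z.2.2.2))
    (z : Euc d₁ × Euc d₂ × Euc d₁ × Euc d₂) (i : Fin d₁) :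
    gradP H z.1 z.2.1 z.2.2.1 z.2.2.2 i = dirDeriv (0, 0, EuclideanSpace.single i (1 : ℝ), 0)
      (fun z : Euc d₁ × Euc d₂ × Euc d₁ × Euc d₂ => H z.1 z.2.1 z.2.2.1 z.2.2.2) z := by
  have c3 : ContDiff ℝ 2 fun z' : Euc d₁ × Euc d₂ => H z.1 z.2.1 z'.1 z'.2 :=
    hH.comp (contDiff_const.prodMk (contDiff_const.prodMk contDiff_id))
  have c2 : ContDiff ℝ 2 fun z' : Euc d₂ × Euc d₁ × Euc d₂ => H z.1 z'.1 z'.2.1 z'.2.2 :=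
    hH.comp (contDiff_const.prodMk contDiff_id)
  rw [gradP, gradient_apply_eq_dirDeriv,
    dirDeriv_partial_fst (c3.differentiable (by norm_num) z.2.2),
    dirDeriv_partial_snd (c2.differentiable (by norm_num) z.2),
    dirDeriv_partial_snd (hH.differentiable (by norm_num) z)]

theorem gradQ_apply (hH : ContDiff ℝ 2
      (fun z : Euc d₁ × Euc d₂ × Euc d₁ × Euc d₂ => H z.1 z.2.1 z.2.2.1 z.2.2.2))
    (z : Euc d₁ × Euc d₂ × Euc d₁ × Euc d₂) (j : Fin d₂) :
    gradQ H z.1 z.2.1 z.2.2.1 z.2.2.2 j = dirDeriv (0, 0, 0, EuclideanSpace.single j (1 : ℝ))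
      (fun z : Euc d₁ × Euc d₂ × Euc d₁ × Euc d₂ => H z.1 z.2.1 z.2.2.1 z.2.2.2) z := by
  have c3 : ContDiff ℝ 2 fun z' : Euc d₁ × Euc d₂ => H z.1 z.2.1 z'.1 z'.2 :=
    hH.comp (contDiff_const.prodMk (contDiff_const.prodMk contDiff_id))
  have c2 : ContDiff ℝ 2 fun z' : Euc d₂ × Euc d₁ × Euc d₂ => H z.1 z'.1 z'.2.1 z'.2.2 :=
    hH.comp (contDiff_const.prodMk contDiff_id)
  rw [gradQ, gradient_apply_eq_dirDeriv,
    dirDeriv_partial_snd (c3.differentiable (by norm_num) z.2.2),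
    dirDeriv_partial_snd (c2.differentiable (by norm_num) z.2),
    dirDeriv_partial_snd (hH.differentiable (by norm_num) z)]

/-- The coordinates of the drift `(∂_p H, ∂_q H)` along `u`. -/
noncomputable def driftCoord (H : Euc d₁ → Euc d₂ → Euc d₁ → Euc d₂ → ℝ)
    (u : ℝ → Euc d₁ → Euc d₂ → ℝ) (i : Fin d₁ ⊕ Fin d₂) (t : ℝ) (z : Euc d₁ × Euc d₂) : ℝ :=
  Sum.elim (fun i => driftX H u t z.1 z.2 i) (fun j => driftY H u t z.1 z.2 j) i

/-- The direction of the momentum space that corresponds to a coordinate. -/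
noncomputable def momentumDirection (i : Fin d₁ ⊕ Fin d₂) :
    Euc d₁ × Euc d₂ × Euc d₁ × Euc d₂ :=
  Sum.elim (fun i => (0, 0, EuclideanSpace.single i (1 : ℝ), 0))
    (fun j => (0, 0, 0, EuclideanSpace.single j (1 : ℝ))) i

/-- Presents the drift as a first derivative of H composed with (x, y, ∂_x u, ∂_y u), so that its
regularity follows by composition from that of H and u. -/
theorem driftCoord_eq (hH : ContDiff ℝ 2
      (fun z : Euc d₁ × Euc d₂ × Euc d₁ × Euc d₂ => H z.1 z.2.1 z.2.2.1 z.2.2.2))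
    (u : ℝ → Euc d₁ → Euc d₂ → ℝ) (i : Fin d₁ ⊕ Fin d₂) (t : ℝ) (z : Euc d₁ × Euc d₂) :
    driftCoord H u i t z = dirDeriv (momentumDirection i)
      (fun z : Euc d₁ × Euc d₂ × Euc d₁ × Euc d₂ => H z.1 z.2.1 z.2.2.1 z.2.2.2)
      (z.1, z.2, gradX u t z.1 z.2, gradY u t z.1 z.2) := by
  rcases i with i | j
  · exact gradP_apply hH (z.1, z.2, gradX u t z.1 z.2, gradY u t z.1 z.2) i
  · exact gradQ_apply hH (z.1, z.2, gradX u t z.1 z.2, gradY u t z.1 z.2) j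

theorem contDiff_driftCoord (hH : ContDiff ℝ 2
      (fun z : Euc d₁ × Euc d₂ × Euc d₁ × Euc d₂ => H z.1 z.2.1 z.2.2.1 z.2.2.2))
    (hw : ContDiff ℝ 2 fun z : Euc d₁ × Euc d₂ => w t z.1 z.2) (i : Fin d₁ ⊕ Fin d₂) :
    ContDiff ℝ 1 (driftCoord H w i t) := by
  rw [funext (driftCoord_eq hH w i t)]
  exact (hH.dirDeriv (m := 1) (by norm_num) _).comp
    (contDiff_fst.prodMk (contDiff_snd.prodMk ((contDiff_gradX hw).prodMk (contDiff_gradY hw))))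

theorem continuousOn_jet {I : Set ℝ} (h : IsC12On w I) :
    ContinuousOn (fun a : ℝ × Euc d₁ × Euc d₂ => (a.2.1, a.2.2, gradX w a.1 a.2.1 a.2.2,
      gradY w a.1 a.2.1 a.2.2)) (I ×ˢ univ) :=
  (by fun_prop : Continuous fun a : ℝ × Euc d₁ × Euc d₂ => a.2.1).continuousOn.prodMk
    ((by fun_prop : Continuous fun a : ℝ × Euc d₁ × Euc d₂ => a.2.2).continuousOn.prodMk
      (h.continuousOn_gradX.prodMk h.continuousOn_gradY))

theorem continuousOn_driftCoord (hH : ContDiff ℝ 2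
      (fun z : Euc d₁ × Euc d₂ × Euc d₁ × Euc d₂ => H z.1 z.2.1 z.2.2.1 z.2.2.2))
    {I : Set ℝ} (h : IsC12On w I) (i : Fin d₁ ⊕ Fin d₂) :
    ContinuousOn (Function.uncurry (driftCoord H w i)) (I ×ˢ univ) :=
  ((hH.dirDeriv (m := 0) (by norm_num) (momentumDirection i)).continuous.comp_continuousOn
    (continuousOn_jet h)).congr fun a _ => driftCoord_eq hH w i a.1 a.2

theorem IsFPSolution.isFokkerPlanckSolution {σ T τ : ℝ} {u ρ : ℝ → Euc d₁ → Euc d₂ → ℝ}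
    {ρτ : Euc d₁ → Euc d₂ → ℝ} (h : IsFPSolution H σ u τ ρτ ρ)
    (hH : ContDiff ℝ 2
      (fun z : Euc d₁ × Euc d₂ × Euc d₁ × Euc d₂ => H z.1 z.2.1 z.2.2.1 z.2.2.2))
    (hu : IsC12On u (Ioo 0 T)) (hτ : τ ≤ T) :
    IsFokkerPlanckSolution (volume : Measure (Euc d₁ × Euc d₂)) (prodBasis d₁ d₂) σ τ
      (driftCoord H u) (fun z => ρτ z.1 z.2) (fun t z => ρ t z.1 z.2) where
  regular := h.regular.isSpaceTimeC12
  continuousOn := h.continuousOn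
  terminal := by ext z; exact h.terminal z.1 z.2
  contDiff_drift t ht i := contDiff_driftCoord hH (hu.contDiff_space t ⟨ht.1, ht.2.trans_le hτ⟩) i
  continuousOn_drift i := (continuousOn_driftCoord hH hu i).mono
    (prod_mono_left (Ioo_subset_Ioo_right hτ))
  integrable := h.integrable
  integrable_flux i := by
    rcases i with i | j
    · have := (EuclideanSpace.proj i : Euc d₁ →L[ℝ] ℝ).integrable_comp
        h.integrable_fluxX
      refine this.congr (Eventually.of_forall fun a => ?_)
      simp [driftCoord, mul_comm]
    · have := (EuclideanSpace.proj j : Euc d₂ →L[ℝ] ℝ).integrable_comp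
        h.integrable_fluxY
      refine this.congr (Eventually.of_forall fun a => ?_)
      simp [driftCoord, mul_comm]
  equation t ht z := by
    have heq := h.equation t ht z.1 z.2
    have cρ := h.regular.contDiff_space t ht
    have cb := fun i => contDiff_driftCoord hH (hu.contDiff_space t ⟨ht.1, ht.2.trans_le hτ⟩) i
    have cbρ : ∀ i, ContDiff ℝ 1 fun z : Euc d₁ × Euc d₂ => driftCoord H u i t z * ρ t z.1 z.2 :=
      fun i => (cb i).mul (cρ.of_le (by norm_num))
    have cX : ContDiff ℝ 1 fun x => ρ t x z.2 • driftX H u t x z.2 := by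
      refine contDiff_euclidean.2 fun i => ?_
      have h0 : ContDiff ℝ 1 fun x => driftCoord H u (Sum.inl i) t (x, z.2) * ρ t x z.2 :=
        (cbρ (Sum.inl i)).comp (contDiff_id.prodMk (contDiff_const (c := z.2)))
      simpa [driftCoord, mul_comm] using h0
    have cY : ContDiff ℝ 1 fun y => ρ t z.1 y • driftY H u t z.1 y := by
      refine contDiff_euclidean.2 fun i => ?_
      have h0 : ContDiff ℝ 1 fun y => driftCoord H u (Sum.inr i) t (z.1, y) * ρ t z.1 y :=
        (cbρ (Sum.inr i)).comp ((contDiff_const (c := z.1)).prodMk contDiff_id)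
      simpa [driftCoord, mul_comm] using h0
    have dX : divergence (fun x => ρ t x z.2 • driftX H u t x z.2) z.1 =
        ∑ i : Fin d₁, dirDeriv (prodBasis d₁ d₂ (Sum.inl i))
          (fun z => driftCoord H u (Sum.inl i) t z * ρ t z.1 z.2) z := by
      rw [divergence_eq_sum_dirDeriv (cX.differentiable (by norm_num) _)]
      refine Finset.sum_congr rfl fun i _ => ?_
      rw [prodBasis_inl, ← dirDeriv_partial_fst ((cbρ (Sum.inl i)).differentiable (by norm_num) z)]
      congr 1
      ext x
      simp [driftCoord, mul_comm]
    have dY : divergence (fun y => ρ t z.1 y • driftY H u t z.1 y) z.2 =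
        ∑ j : Fin d₂, dirDeriv (prodBasis d₁ d₂ (Sum.inr j))
          (fun z => driftCoord H u (Sum.inr j) t z * ρ t z.1 z.2) z := by
      rw [divergence_eq_sum_dirDeriv (cY.differentiable (by norm_num) _)]
      refine Finset.sum_congr rfl fun i _ => ?_
      rw [prodBasis_inr, ← dirDeriv_partial_snd ((cbρ (Sum.inr i)).differentiable (by norm_num) z)]
      congr 1
      ext x
      simp [driftCoord, mul_comm]
    rw [dX, dY, lapXY_eq_sum cρ z] at heq
    rw [Fintype.sum_sum_type (f := fun i => dirDeriv (prodBasis d₁ d₂ i)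
      (fun z => driftCoord H u i t z * ρ t z.1 z.2) z)]
    linarith

theorem IsHJSolution.isViscousSolution {σ T τ : ℝ} {u₀ : Euc d₁ → Euc d₂ → ℝ}
    {u : ℝ → Euc d₁ → Euc d₂ → ℝ} (h : IsHJSolution H σ T u₀ u) (hτ : τ ≤ T) :
    IsViscousSolution (prodBasis d₁ d₂) σ τ
      (fun t z => H z.1 z.2 (gradX u t z.1 z.2) (gradY u t z.1 z.2))
      (fun z => u₀ z.1 z.2) (fun t z => u t z.1 z.2) where
  regular := h.regular.isSpaceTimeC12.mono (Ioo_subset_Ioo_right hτ)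
  continuousOn := h.continuousOn.mono (prod_mono_left (Icc_subset_Icc_right hτ))
  growth := by
    obtain ⟨K, hK⟩ := h.growth
    -- The factor 2 passes from ‖x‖ + ‖y‖ to the sup norm of the product.
    refine ⟨|K| * 2, fun t ht z => (hK t (Icc_subset_Icc_right hτ ht) z.1 z.2).trans ?_⟩
    have h1 := norm_fst_le z
    have h2 := norm_snd_le z
    have h3 : 1 + ‖z.1‖ + ‖z.2‖ ≤ 2 * (1 + ‖z‖) := by linarith
    calc K * (1 + ‖z.1‖ + ‖z.2‖) ≤ |K| * (1 + ‖z.1‖ + ‖z.2‖) :=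
          mul_le_mul_of_nonneg_right (le_abs_self K) (by positivity)
      _ ≤ |K| * (2 * (1 + ‖z‖)) := mul_le_mul_of_nonneg_left h3 (abs_nonneg K)
      _ = _ := by ring
  equation t ht z := by
    have ht' : t ∈ Ioo 0 T := ⟨ht.1, ht.2.trans_le hτ⟩
    have heq := h.equation t ht' z.1 z.2
    rw [lapXY_eq_sum (h.regular.contDiff_space t ht') z] at heq
    linarith
  initial z := h.initial z.1 z.2

/-- Matches the coordinate sum of the energy estimate with the inner products in the coercivity
hypothesis. -/
theorem sum_driftCoord_mul_dirDeriv (u : ℝ → Euc d₁ → Euc d₂ → ℝ)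
    (hu : ContDiff ℝ 2 fun z : Euc d₁ × Euc d₂ => u t z.1 z.2) (z : Euc d₁ × Euc d₂) :
    ∑ i, driftCoord H u i t z * dirDeriv (prodBasis d₁ d₂ i) (fun z => u t z.1 z.2) z =
      inner ℝ (driftX H u t z.1 z.2) (gradX u t z.1 z.2)
        + inner ℝ (driftY H u t z.1 z.2) (gradY u t z.1 z.2) := by
  rw [Fintype.sum_sum_type, PiLp.inner_apply, PiLp.inner_apply]
  congr 1
  · refine Finset.sum_congr rfl fun i _ => ?_
    rw [← gradX_apply hu]
    simp [driftCoord, mul_comm]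
  · refine Finset.sum_congr rfl fun i _ => ?_
    rw [← gradY_apply hu]
    simp [driftCoord, mul_comm]

end Transfer

/-! ### The σ-independent bound for the Hamilton–Jacobi equation. -/

theorem mainTheorem8 (d₁ d₂ : ℕ) (H : Euc d₁ → Euc d₂ → Euc d₁ → Euc d₂ → ℝ)
    (γ CH : ℝ) (hH : HamiltonianAssumption H γ CH)
    (u₀ : Euc d₁ → Euc d₂ → ℝ) (hu₀ : IsBoundedLipschitz u₀) (T : ℝ) (hT : 0 < T) :
    ∃ C : ℝ, 0 ≤ C ∧
      ∀ σ : ℝ, 0 < σ →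
      ∀ u : ℝ → Euc d₁ → Euc d₂ → ℝ, IsHJSolution H σ T u₀ u →
      ∀ τ ∈ Ioc 0 T, ∀ ρτ : Euc d₁ → Euc d₂ → ℝ, IsTerminalDensity ρτ →
      ∀ ρ : ℝ → Euc d₁ → Euc d₂ → ℝ, IsFPSolution H σ u τ ρτ ρ →
        IntegrableOn (fun a : ℝ × Euc d₁ × Euc d₂ =>
            (‖gradX u a.1 a.2.1 a.2.2‖ ^ γ + ‖gradY u a.1 a.2.1 a.2.2‖ ^ γ)
              * ρ a.1 a.2.1 a.2.2) (Icc 0 τ ×ˢ univ) ∧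
          ∫ a in (Icc 0 τ ×ˢ univ : Set (ℝ × Euc d₁ × Euc d₂)),
            (‖gradX u a.1 a.2.1 a.2.2‖ ^ γ + ‖gradY u a.1 a.2.1 a.2.2‖ ^ γ)
              * ρ a.1 a.2.1 a.2.2 ≤ C := by
  obtain ⟨⟨M, hM⟩, -⟩ := hu₀
  have hM0 : 0 ≤ M := (abs_nonneg _).trans (hM 0 0)
  have hCH := hH.const_pos
  have hγ : 0 ≤ γ := zero_le_one.trans hH.one_le_gamma
  -- The energy estimate is applied to CH⁻¹(|∂_x u|^γ + |∂_y u|^γ) with c = CH, whence the outer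
  -- factor; T replaces τ for uniformity.
  refine ⟨CH * (9 * M + 13 + 6 * CH * T), by positivity, ?_⟩
  intro σ hσ u hu τ hτ ρτ hρτ ρ hρ
  have hIoo : Ioo 0 τ ⊆ Ioo 0 T := Ioo_subset_Ioo_right hτ.2
  have sub : Ioo 0 τ ×ˢ (univ : Set (Euc d₁ × Euc d₂)) ⊆ Ioo 0 T ×ˢ univ := prod_mono_left hIoo
  have cH := hH.contDiff.continuous
  have mass : ∫ z : Euc d₁ × Euc d₂, ρτ z.1 z.2 ≤ 1 := by
    rw [← hρτ.integral_eq_one]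
    refine le_of_eq (integral_congr_ae (Eventually.of_forall fun z => ?_))
    exact (abs_of_nonneg (hρτ.nonneg z.1 z.2)).symm
  have cP : ContinuousOn (fun a : ℝ × Euc d₁ × Euc d₂ => CH⁻¹ *
      (‖gradX u a.1 a.2.1 a.2.2‖ ^ γ + ‖gradY u a.1 a.2.1 a.2.2‖ ^ γ)) (Ioo 0 τ ×ˢ univ) := by
    refine continuousOn_const.mul (ContinuousOn.add ?_ ?_)
    · exact (hu.regular.continuousOn_gradX.mono sub).norm.rpow_const fun _ _ => Or.inr hγ
    · exact (hu.regular.continuousOn_gradY.mono sub).norm.rpow_const fun _ _ => Or.inr hγ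
  have : (volume : Measure (Euc d₁ × Euc d₂)).IsAddHaarMeasure :=
    inferInstanceAs ((volume : Measure (Euc d₁)).prod (volume : Measure (Euc d₂))).IsAddHaarMeasure
  have key := integrableOn_and_integral_energy_le
    (P := fun t (z : Euc d₁ × Euc d₂) =>
      CH⁻¹ * (‖gradX u t z.1 z.2‖ ^ γ + ‖gradY u t z.1 z.2‖ ^ γ))
    (hρ.isFokkerPlanckSolution hH.contDiff hu.regular hτ.2) (hu.isViscousSolution hτ.2) hσ hτ.1
    (fun z => hρτ.nonneg z.1 z.2) hρτ.compactSupport mass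
    ((cH.comp_continuousOn (continuousOn_jet hu.regular)).mono sub)
    (fun t _ z => hH.nonneg _ _ _ _) (fun z => hM z.1 z.2) cP
    (fun t _ z => by positivity) hCH.le
    (fun t ht z => by
      rw [sum_driftCoord_mul_dirDeriv u (hu.regular.contDiff_space t (hIoo ht)) z]
      exact hH.coercive z.1 z.2 (gradX u t z.1 z.2) (gradY u t z.1 z.2))
  have hae : (Icc 0 τ ×ˢ univ : Set (ℝ × Euc d₁ × Euc d₂)) =ᵐ[volume]
      (Ioo 0 τ ×ˢ univ : Set (ℝ × Euc d₁ × Euc d₂)) :=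
    Measure.set_prod_ae_eq Ioo_ae_eq_Icc.symm ae_eq_rfl
  rw [integrableOn_congr_set_ae hae, setIntegral_congr_set hae]
  have hmul : (fun a : ℝ × Euc d₁ × Euc d₂ =>
      (‖gradX u a.1 a.2.1 a.2.2‖ ^ γ + ‖gradY u a.1 a.2.1 a.2.2‖ ^ γ) * ρ a.1 a.2.1 a.2.2) =
      fun a => CH * (CH⁻¹ * (‖gradX u a.1 a.2.1 a.2.2‖ ^ γ + ‖gradY u a.1 a.2.1 a.2.2‖ ^ γ)
        * ρ a.1 a.2.1 a.2.2) := by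
    ext a
    field_simp
  rw [hmul, integral_const_mul]
  refine ⟨key.1.const_mul CH, mul_le_mul_of_nonneg_left (key.2.trans ?_) hCH.le⟩
  have := mul_le_mul_of_nonneg_left hτ.2 (by positivity : 0 ≤ 6 * CH)
  linarith
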